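/- Let $d$ be a natural number. Put $\mathbf R_\flat=\mathbf R_+\cup\{\flat_\sigma:\sigma>0\}$, ordered by the usual order on $\mathbf R_+$ and by $x_1<\flat_{\sigma_1}<\flat_{\sigma_2}<x_2$ whenever $0<x_1<\frac12\le x_2$ and $0<\sigma_1<\sigma_2$. Let $h_\alpha$, $\alpha\in\mathbf N^d$, be the Hermite functions $$h_\alpha(x)=\pi^{-d/4}(-1)^{|\alpha|}(2^{|\alpha|}\alpha!)^{-1/2}e^{|x|^2/2}\,\partial^\alpha e^{-|x|^2},\qquad x\in\mathbf R^d,$$ and let $\mathcal H_0'(\mathbf R^d)$ be the space of all formal Hermite series $f=\sum_{\alpha\in\mathbf N^d}c(f,\alpha)h_\alpha$, $c(f,\alpha)\in\mathbf C$. Fix $p\in[1,\infty]$. For $s\in\mathbf R_\flat$ and $r>0$ let $$\vartheta_{r,s}(\alpha)=\begin{cases}e^{r|\alpha|^{1/(2s)}},& s\in\mathbf R_+,\\ r^{|\alpha|}(\alpha!)^{1/(2\sigma)},& s=\flat_\sigma,\end{cases}$$ and let $\mathcal H_{0,s}(\mathbf R^d)$ be the set of all $f\in\mathcal H_0'(\mathbf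 R^d)$ such that $\{c(f,\alpha)\vartheta_{r,s}(\alpha)\}_{\alpha}\in\ell^p(\mathbf N^d)$ for every $r>0$. For $t\in\mathbf R^d$ the fractional Fourier transform on $\mathcal H_0'(\mathbf R^d)$ is $\mathscr F_tf=\sum_\alpha e^{-i\frac\pi2\langle t,\alpha\rangle}c(f,\alpha)h_\alpha$. A series $f\in\mathcal H_0'(\mathbf R^d)$ is identified with a measurable function $g$ if $g\,e^{-a|\cdot|^2}\in L^1(\mathbf R^d)$ for some $a<\frac12$ and $c(f,\alpha)=\int g\,h_\alpha\,dx$ for all $\alpha$ (such a $g$ is unique up to null sets). For a weight $w$, $\|f\cdot w\|_{L^\infty}$ means $\|g\cdot w\|_{L^\infty}$ if $f$ is identified with such a $g$, and $\infty$ otherwise. With $\langle x\rangle=(1+|x|^2)^{1/2}$, let $$\omega_{d,r,s}(x)=\begin{cases}e^{-r(\log\langle x\rangle)^{1/(1-2s)}},& s\in\mathbf R,\ 0<s<\frac12,\\ e^{-r|x|^{2\sigma/(\sigma+1)}},& s=\flat_\sigma,\\ e^{-r|x|^2},& s=\frac12.\end{cases}$$ **Theorem.** Let $s\in\mathbf R_\flat$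 with $s\le\frac12$, let $t_0\in\mathbf R^d$, let $u\in(0,1]^d$ if $s=\frac12$ and $u\in(0,1)^d$ if $s<\frac12$, and let $$\Lambda_{t_0,u}=\{t_0+(k_1u_1,\dots,k_du_d):\ k_j\in\mathbf Z,\ 0\le k_ju_j<2\}.$$ For every $f\in\mathcal H_0'(\mathbf R^d)$ the following conditions are equivalent: 1. $f\in\mathcal H_{0,s}(\mathbf R^d)$; 2. for every $r>0$, $\ \sup_{t\in\Lambda_{t_0,u}}\|(\mathscr F_tf)\cdot e^{\frac12|\cdot|^2}\omega_{d,r,s}\|_{L^\infty}<\infty$; 3. for every $r>0$, $\ \sup_{t\in\mathbf R^d}\|(\mathscr F_tf)\cdot e^{\frac12|\cdot|^2}\omega_{d,r,s}\|_{L^\infty}<\infty$. -/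

import Mathlib

open MeasureTheory
open scoped ENNReal Nat

noncomputable section

namespace Pilipovic

/-- The index set `ℝ_♭ = ℝ_+ ∪ {♭_σ : σ > 0}`. -/
inductive RFlat : Type
  | real (s : ℝ) (hs : 0 < s) : RFlat
  | flat (σ : ℝ) (hσ : 0 < σ) : RFlat

namespace RFlat

/-- Sorting key for the order of `ℝ_♭`: first the reals `x < 1/2`, then the `♭_σ` (increasing in
`σ`), then the reals `x ≥ 1/2`. -/
def key : RFlat → ℕ ×ₗ ℝ
  | real s _ => if s < 1 / 2 then toLex (0, s) else toLex (2, s)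
  | flat σ _ => toLex (1, σ)

theorem key_injective : Function.Injective key := by
  rintro (⟨s, hs⟩ | ⟨s, hs⟩) (⟨t, ht⟩ | ⟨t, ht⟩) h <;> simp only [key] at h
  · split_ifs at h <;> simp_all
  · split_ifs at h <;> simp_all
  · split_ifs at h <;> simp_all
  · simp_all

instance : LinearOrder RFlat := LinearOrder.lift' key key_injective

theorem real_le_real {x y : ℝ} (hx : 0 < x) (hy : 0 < y) : real x hx ≤ real y hy ↔ x ≤ y := by
  change key _ ≤ key _ ↔ _
  simp only [key]
  split_ifs with h1 h2 h2 <;> simp [Prod.Lex.toLex_le_toLex] <;> linarith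

theorem flat_le_flat {σ τ : ℝ} (hσ : 0 < σ) (hτ : 0 < τ) : flat σ hσ ≤ flat τ hτ ↔ σ ≤ τ := by
  change key _ ≤ key _ ↔ _
  simp [key, Prod.Lex.toLex_le_toLex]

theorem real_lt_flat {x σ : ℝ} (hx : 0 < x) (hσ : 0 < σ) : real x hx < flat σ hσ ↔ x < 1 / 2 := by
  change key _ < key _ ↔ _
  simp only [key]
  split_ifs with h1 <;> simp [Prod.Lex.toLex_lt_toLex] <;> linarith

theorem flat_lt_real {x σ : ℝ} (hx : 0 < x) (hσ : 0 < σ) : flat σ hσ < real x hx ↔ 1 / 2 ≤ x := by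
  change key _ < key _ ↔ _
  simp only [key]
  split_ifs with h1 <;> simp [Prod.Lex.toLex_lt_toLex] <;> linarith

/-- The element `1/2` of `ℝ_♭`. -/
def half : RFlat := real (1 / 2) (by norm_num)

end RFlat

/-- The one-dimensional Hermite function
`h_n(y) = π^{-1/4} (-1)^n (2^n n!)^{-1/2} e^{y²/2} (d/dy)^n e^{-y²}`. -/
def hermiteFun1 (n : ℕ) (y : ℝ) : ℝ :=
  Real.pi ^ (-(1 / 4) : ℝ) * (-1) ^ n * ((2 : ℝ) ^ n * (n ! : ℝ)) ^ (-(1 / 2) : ℝ) *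
    Real.exp (y ^ 2 / 2) * iteratedDeriv n (fun v : ℝ => Real.exp (-v ^ 2)) y

/-- The Hermite function
`h_α(x) = π^{-d/4} (-1)^{|α|} (2^{|α|} α!)^{-1/2} e^{|x|²/2} ∂^α e^{-|x|²}` on `ℝ^d`, `α ∈ ℕ^d`.
Since `e^{-|x|²} = ∏_j e^{-x_j²}`, it is the product of the one-dimensional `h_{α_j}(x_j)`. -/
def hermiteFun {d : ℕ} (α : Fin d → ℕ) (x : EuclideanSpace ℝ (Fin d)) : ℝ :=
  ∏ j, hermiteFun1 (α j) (x j)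

/-- The space `𝓗₀'(ℝ^d)` of formal Hermite series `f = ∑_α c(f, α) h_α` with arbitrary complex
coefficients. A series is given by its coefficients: `f α` is `c(f, α)`. -/
abbrev HermiteSeries (d : ℕ) : Type := (Fin d → ℕ) → ℂ

/-- The weight `ϑ_{r,s}` on `ℕ^d`: `e^{r |α|^{1/(2s)}}` for real `s`, and
`r^{|α|} (α!)^{1/(2σ)}` for `s = ♭_σ`. -/
def seqWeight {d : ℕ} (r : ℝ) : RFlat → (Fin d → ℕ) → ℝ
  | .real s _, α => Real.exp (r * ((∑ j, α j : ℕ) : ℝ) ^ (1 / (2 * s)))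
  | .flat σ _, α => r ^ (∑ j, α j) * ((∏ j, (α j)! : ℕ) : ℝ) ^ (1 / (2 * σ))

/-- The Beurling type Pilipović space `𝓗_{0,s}(ℝ^d)`: formal Hermite series whose coefficients
belong to `ℓ^p_{[ϑ_{r,s}]}(ℕ^d)` for every `r > 0`. -/
def beurlingSpace (d : ℕ) (p : ℝ≥0∞) (s : RFlat) : Set (HermiteSeries d) :=
  {f | ∀ r : ℝ, 0 < r → Memℓp (fun α : Fin d → ℕ => f α * (seqWeight r s α : ℂ)) p}

/-- The (partial) fractional Fourier transform `𝓕_t` of multi-order `t ∈ ℝ^d` on `𝓗₀'(ℝ^d)`,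
`𝓕_t (∑_α c(α) h_α) = ∑_α e^{-iπ⟨t,α⟩/2} c(α) h_α`. -/
def fracFourier {d : ℕ} (t : Fin d → ℝ) (f : HermiteSeries d) : HermiteSeries d :=
  fun α => Complex.exp (-Complex.I * (Real.pi / 2 : ℝ) * ((∑ j, t j * (α j : ℝ) : ℝ) : ℂ)) * f α

/-- The formal Hermite series `f` is (identified with) the measurable function `g` on `ℝ^d`:
`c(f, α) = ∫ g h_α dx` for all `α`. The requirement `g e^{-a|x|²} ∈ L¹` for some `a < 1/2` makes
all these integrals absolutely convergent and makes `g` unique up to null sets. -/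
def IsFunction {d : ℕ} (f : HermiteSeries d) (g : EuclideanSpace ℝ (Fin d) → ℂ) : Prop :=
  AEStronglyMeasurable g volume ∧
    (∃ a : ℝ, a < 1 / 2 ∧
      Integrable (fun x => g x * (Real.exp (-a * ‖x‖ ^ 2) : ℂ)) volume) ∧
    ∀ α : Fin d → ℕ, ∫ x, g x * (hermiteFun α x : ℂ) = f α

/-- The norm `‖f · w‖_{L^∞}` of a formal Hermite series `f` against a weight `w`: the essential
supremum of `|g w|` if `f` is a function `g`, and `∞` if `f` is not a function. -/
def weightedSupNorm {d : ℕ} (f : HermiteSeries d) (w : EuclideanSpace ℝ (Fin d) → ℝ) : ℝ≥0∞ :=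
  ⨅ (g : EuclideanSpace ℝ (Fin d) → ℂ) (_ : IsFunction f g),
    eLpNorm (fun x => g x * (w x : ℂ)) ∞ volume

/-- The weight `ω_{d,r,s}`, restricted to `ℝ^d`, for `s ≤ 1/2`, where `⟨x⟩ = (1 + |x|²)^{1/2}`:
`e^{-r (log⟨x⟩)^{1/(1-2s)}}` for real `s < 1/2`, `e^{-r |x|^{2σ/(σ+1)}}` for `s = ♭_σ`, and
`e^{-r |x|²}` for `s = 1/2` (the value for `s > 1/2` is never used). -/
def omega {d : ℕ} (r : ℝ) : RFlat → EuclideanSpace ℝ (Fin d) → ℝ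
  | .real s _, x =>
      if s < 1 / 2 then
        Real.exp (-r * Real.log (Real.sqrt (1 + ‖x‖ ^ 2)) ^ (1 / (1 - 2 * s)))
      else Real.exp (-r * ‖x‖ ^ 2)
  | .flat σ _, x => Real.exp (-r * ‖x‖ ^ (2 * σ / (σ + 1)))

/-- The norm `‖(𝓕_t f) · e^{|·|²/2} ω_{d,r,s}‖_{L^∞}`. -/
def fracFourierNorm {d : ℕ} (r : ℝ) (s : RFlat) (f : HermiteSeries d) (t : Fin d → ℝ) : ℝ≥0∞ :=
  weightedSupNorm (fracFourier t f) (fun x => Real.exp (‖x‖ ^ 2 / 2) * omega r s x)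

/-- The finite lattice piece
`Λ_{t₀,u} = {t₀ + (k₁u₁, …, k_du_d) : 0 ≤ k_j u_j < 2, k_j ∈ ℤ}`. -/
def lattice {d : ℕ} (t₀ u : Fin d → ℝ) : Set (Fin d → ℝ) :=
  {t | ∃ k : Fin d → ℤ, (∀ j, 0 ≤ (k j : ℝ) * u j ∧ (k j : ℝ) * u j < 2) ∧
    ∀ j, t j = t₀ j + (k j : ℝ) * u j}

end Pilipovic

end

noncomputable section

namespace Pilipovic

open Real (pi exp sqrt)

/-! All values of `s` share one argument, driven by a growth function `W` with `omega r s x = exp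
(-r * W ‖x‖)`; `exists_growth` collects what is needed of `W`.

From coefficients to functions: `|h_α(x)| e^{|x|²/2}` is at most a constant times `ϑ_{R,s}(α)
e^{rW(|x|)}` (`HermiteBound`), so a series whose coefficients beat every weight converges to a
function with the required bound. Fractional Fourier transforms change only the phases of the
coefficients, which makes the estimate uniform in `t` (`exists_fracFourierNorm_le`).

The converse passes to the Bargmann transform `F(z) = ∑ c(α) z^α/√α!`, on which `𝓕_t` acts by
rotating each variable (`bargmann_fracFourier`). If `𝓕_t f` is of size `e^{-|x|²/2 + rW}`,
completing the square in the kernel bounds its Bargmann transform by `∏ exp(Im(z_j)²/2 +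
CrW(|z_j|))` (`exists_norm_bargmann_le`), so there is no Gaussian growth in real directions. As `t`
runs through the lattice, `F` is seen to grow like `e^{CrW}` along finitely many lines through the
origin in each coordinate, neighbouring lines being at an angle of at most `πu_j/2`. Since `F` has
order at most two in each variable, Phragmén–Lindelöf in sectors of opening less than `π/2` carries
this growth to the whole plane, one coordinate at a time (`norm_le_of_separate`). For `W(x) = x²`
and opening exactly `π/2` the principle is critical; there the bound is also used near the lines,
and the sector is shrunk slightly (`phragmenLindelofProperty_sq`).

Cauchy's estimates on polydiscs with well-chosen radii (`CauchyBound`) then turn the growth of `F`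
into decay of the coefficients. The exponent in `W` is the one for which `HermiteBound` and
`CauchyBound` hold with the same sequence weight. The index `p` plays no role, because all `ℓ^p`
conditions agree once every `r` is allowed (`mem_beurlingSpace_iff`). -/

/-! ### Derivatives of the Gaussian -/

/-- The `n`-th derivative of the Gaussian `e^{-v²}` on the real line. -/
def gaussDeriv (n : ℕ) (y : ℝ) : ℝ := iteratedDeriv n (fun v : ℝ => exp (-v ^ 2)) y

theorem differentiable_cexp_neg_sq : Differentiable ℂ (fun v : ℂ => Complex.exp (-v ^ 2)) := by
  fun_prop

/-- The link to complex analysis: Cauchy estimates and Taylor series of the entire function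
`e^{-v²}` become available for the real derivatives. -/
theorem ofReal_gaussDeriv (n : ℕ) (y : ℝ) :
    ((gaussDeriv n y : ℝ) : ℂ) = iteratedDeriv n (fun v : ℂ => Complex.exp (-v ^ 2)) (y : ℂ) := by
  induction n generalizing y with
  | zero => simp [gaussDeriv]
  | succ n ih =>
    have hd : Differentiable ℂ (iteratedDeriv n (fun v : ℂ => Complex.exp (-v ^ 2))) := by
      have : ContDiff ℂ (n + 1 : ℕ) (fun v : ℂ => Complex.exp (-v ^ 2)) := by fun_prop
      exact this.differentiable_iteratedDeriv n (by exact_mod_cast Nat.lt_succ_self n)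
    have h1 : HasDerivAt (fun x : ℝ => iteratedDeriv n (fun v : ℂ => Complex.exp (-v ^ 2)) (x : ℂ))
        (iteratedDeriv (n + 1) (fun v : ℂ => Complex.exp (-v ^ 2)) (y : ℂ)) y := by
      rw [iteratedDeriv_succ]
      exact (hd (y : ℂ)).hasDerivAt.comp_ofReal
    have hr : Differentiable ℝ (gaussDeriv n) := by
      have : ContDiff ℝ (n + 1 : ℕ) (fun v : ℝ => exp (-v ^ 2)) := by fun_prop
      exact this.differentiable_iteratedDeriv n (by exact_mod_cast Nat.lt_succ_self n)
    have h2 : HasDerivAt (fun x : ℝ => ((gaussDeriv n x : ℝ) : ℂ))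
        ((gaussDeriv (n + 1) y : ℝ) : ℂ) y := by
      have := (hr y).hasDerivAt.ofReal_comp
      have e : gaussDeriv (n + 1) y = deriv (gaussDeriv n) y := by
        unfold gaussDeriv; rw [iteratedDeriv_succ]
      rwa [e]
    simp_rw [ih] at h2
    exact h2.unique h1

theorem hasDerivAt_gaussDeriv (n : ℕ) (y : ℝ) :
    HasDerivAt (gaussDeriv n) (gaussDeriv (n + 1) y) y := by
  have hr : Differentiable ℝ (gaussDeriv n) := by
    have : ContDiff ℝ (n + 1 : ℕ) (fun v : ℝ => exp (-v ^ 2)) := by fun_prop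
    exact this.differentiable_iteratedDeriv n (by exact_mod_cast Nat.lt_succ_self n)
  have e : gaussDeriv (n + 1) y = deriv (gaussDeriv n) y := by
    unfold gaussDeriv; rw [iteratedDeriv_succ]
  rw [e]
  exact (hr y).hasDerivAt

theorem gaussDeriv_zero (y : ℝ) : gaussDeriv 0 y = exp (-y ^ 2) := by simp [gaussDeriv]

theorem gaussDeriv_one (y : ℝ) : gaussDeriv 1 y = -2 * y * exp (-y ^ 2) := by
  have h : HasDerivAt (gaussDeriv 0) (-2 * y * exp (-y ^ 2)) y := by
    have : HasDerivAt (fun v : ℝ => exp (-v ^ 2)) (exp (-y ^ 2) * (-(2 * y))) y := by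
      have := ((hasDerivAt_pow 2 y).neg).exp
      simpa using this
    convert this using 1
    · ext; exact gaussDeriv_zero _
    · ring
  exact (hasDerivAt_gaussDeriv 0 y).unique h

/-- Obtained by differentiating `g' = -2y g` repeatedly. It makes the derivative of `e^{y²} g_{m+1}`
a multiple of `e^{y²} g_m`, the lowering step behind orthogonality. -/
theorem gaussDeriv_recurrence (n : ℕ) (y : ℝ) :
    gaussDeriv (n + 2) y = -2 * y * gaussDeriv (n + 1) y - 2 * (n + 1) * gaussDeriv n y := by
  induction n generalizing y with
  | zero =>
    have h : HasDerivAt (gaussDeriv 1) (-2 * gaussDeriv 0 y + -2 * y * gaussDeriv 1 y) y := by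
      have := ((hasDerivAt_id y).const_mul (-2)).mul (hasDerivAt_gaussDeriv 0 y)
      have e : gaussDeriv 1 = (fun y => -2 * id y) * gaussDeriv 0 := by
        ext z; rw [gaussDeriv_one]; simp [gaussDeriv_zero]
      rw [e]
      simpa [e] using this
    rw [(hasDerivAt_gaussDeriv 1 y).unique h]
    simp; ring
  | succ n ih =>
    have h := ((((hasDerivAt_id y).const_mul (-2)).mul (hasDerivAt_gaussDeriv (n + 1) y))).sub
      ((hasDerivAt_gaussDeriv n y).const_mul (2 * ((n : ℝ) + 1)))
    have h2 : HasDerivAt (gaussDeriv (n + 2)) (gaussDeriv (n + 3) y) y :=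
      hasDerivAt_gaussDeriv (n + 2) y
    have e : gaussDeriv (n + 2) = (fun y => -2 * id y) * gaussDeriv (n + 1) -
        fun y => 2 * ((n : ℝ) + 1) * gaussDeriv n y := by
      ext z; simp [ih z]
    rw [e] at h2
    have := h2.unique h
    rw [show n + 1 + 2 = n + 3 from rfl, this]
    push_cast; simp only [id]; ring

/-- Cauchy's estimate on the circle of radius `ρ` about `y`. The radius stays free so that it can be
adapted to `n` and `y`. -/
theorem abs_gaussDeriv_le (n : ℕ) (y : ℝ) {ρ : ℝ} (hρ : 0 < ρ) :
    |gaussDeriv n y| ≤ n ! * (exp (-y ^ 2) * exp (2 * |y| * ρ + ρ ^ 2)) / ρ ^ n := by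
  have h := Complex.norm_iteratedDeriv_le_of_forall_mem_sphere_norm_le (c := (y : ℂ)) (R := ρ)
    (C := exp (-y ^ 2) * exp (2 * |y| * ρ + ρ ^ 2)) n hρ
    differentiable_cexp_neg_sq.diffContOnCl ?_
  · rwa [← ofReal_gaussDeriv, Complex.norm_real, Real.norm_eq_abs] at h
  · intro z hz
    rw [mem_sphere_iff_norm] at hz
    obtain ⟨w, rfl⟩ : ∃ w, z = y + w := ⟨z - y, by ring⟩
    rw [add_sub_cancel_left] at hz
    rw [Complex.norm_exp, ← Real.exp_add]
    apply Real.exp_le_exp.2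
    have e : (-((y : ℂ) + w) ^ 2).re = -y ^ 2 - 2 * y * w.re + (w.im ^ 2 - w.re ^ 2) := by
      simp [pow_two]; ring
    rw [e]
    have h1 : ‖w‖ ^ 2 = w.re ^ 2 + w.im ^ 2 := by
      rw [← Complex.normSq_eq_norm_sq, Complex.normSq_apply]; ring
    have h2 : |w.re| ≤ ρ := hz ▸ Complex.abs_re_le_norm w
    have h3 : -(y * w.re) ≤ |y| * ρ := by
      calc -(y * w.re) ≤ |y * w.re| := neg_le_abs _
        _ = |y| * |w.re| := abs_mul _ _
        _ ≤ |y| * ρ := by gcongr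
    rw [hz] at h1
    nlinarith [sq_nonneg w.re]

/-! ### One-dimensional Hermite functions: generating function and growth -/

theorem hermiteFun1_eq (n : ℕ) (y : ℝ) : hermiteFun1 n y =
    pi ^ (-(1 / 4) : ℝ) * (-1) ^ n * ((2 : ℝ) ^ n * (n ! : ℝ)) ^ (-(1 / 2) : ℝ) *
    exp (y ^ 2 / 2) * gaussDeriv n y := rfl

theorem rpow_neg_half_eq (x : ℝ) (hx : 0 ≤ x) : x ^ (-(1 / 2) : ℝ) = (sqrt x)⁻¹ := by
  rw [Real.rpow_neg hx, Real.sqrt_eq_rpow]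

theorem continuous_hermiteFun1 (n : ℕ) : Continuous (hermiteFun1 n) := by
  have h : Continuous (gaussDeriv n) :=
    continuous_iff_continuousAt.2 fun y => (hasDerivAt_gaussDeriv n y).continuousAt
  have e : hermiteFun1 n = fun y => pi ^ (-(1 / 4) : ℝ) * (-1) ^ n *
    ((2 : ℝ) ^ n * (n ! : ℝ)) ^ (-(1 / 2) : ℝ) * exp (y ^ 2 / 2) * gaussDeriv n y := rfl
  rw [e]
  fun_prop

theorem pi_rpow_le_one : pi ^ (-(1 / 4) : ℝ) ≤ 1 :=
  Real.rpow_le_one_of_one_le_of_nonpos (by linarith [Real.pi_gt_three]) (by norm_num)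

/-- The generating function of the Hermite functions. -/
theorem hasSum_hermiteFun1 (y : ℝ) (z : ℂ) :
    HasSum (fun n : ℕ => (hermiteFun1 n y : ℂ) * (z ^ n / (sqrt (n ! : ℝ) : ℂ)))
      (((pi ^ (-(1 / 4) : ℝ) : ℝ) : ℂ) *
        Complex.exp (-(z ^ 2 + y ^ 2) / 2 + (sqrt 2 : ℂ) * z * y)) := by
  have h2 : ((sqrt 2 : ℝ) : ℂ) ^ 2 = 2 := by
    rw [← Complex.ofReal_pow, Real.sq_sqrt (by norm_num)]; norm_num
  have h20 : ((sqrt 2 : ℝ) : ℂ) ≠ 0 := by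
    intro h; rw [h] at h2; norm_num at h2
  -- Taylor series of `e^{-v²}` about `y`, evaluated at `y - z/√2`: the powers of `-1/√2` match the
  -- sign and the factor `2^n` in the normalisation of `h_n`.
  have h := (Complex.hasSum_taylorSeries_of_entire differentiable_cexp_neg_sq (y : ℂ)
    ((y : ℂ) - z / (sqrt 2 : ℂ))).mul_left
      (((pi ^ (-(1 / 4) : ℝ) : ℝ) : ℂ) * Complex.exp ((y : ℂ) ^ 2 / 2))
  have hf : (fun n : ℕ => (hermiteFun1 n y : ℂ) * (z ^ n / (sqrt (n ! : ℝ) : ℂ))) = fun n =>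
      ((pi ^ (-(1 / 4) : ℝ) : ℝ) : ℂ) * Complex.exp ((y : ℂ) ^ 2 / 2) * ((n ! : ℂ)⁻¹ •
        ((y : ℂ) - z / (sqrt 2 : ℂ) - y) ^ n •
          iteratedDeriv n (fun v : ℂ => Complex.exp (-v ^ 2)) (y : ℂ)) := by
    ext n
    have hs : ((sqrt (n ! : ℝ) : ℝ) : ℂ) ^ 2 = (n ! : ℂ) := by
      rw [← Complex.ofReal_pow, Real.sq_sqrt (by positivity)]; norm_num
    have hs0 : ((sqrt (n ! : ℝ) : ℝ) : ℂ) ≠ 0 := by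
      intro h; rw [h] at hs; exact Nat.factorial_ne_zero n (by exact_mod_cast (by simpa using hs.symm : (n ! : ℂ) = 0))
    have h2n : sqrt ((2 : ℝ) ^ n) = sqrt 2 ^ n := by
      rw [Real.sqrt_eq_rpow, Real.sqrt_eq_rpow, ← Real.rpow_natCast, ← Real.rpow_natCast,
        ← Real.rpow_mul (by norm_num), ← Real.rpow_mul (by norm_num), mul_comm]
    rw [hermiteFun1_eq, ← ofReal_gaussDeriv, rpow_neg_half_eq _ (by positivity),
      Real.sqrt_mul (by positivity), h2n, ← hs]
    push_cast
    rw [show (y : ℂ) - z / (sqrt 2 : ℂ) - y = -1 * (z / (sqrt 2 : ℂ)) by ring, mul_pow, div_pow]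
    simp only [smul_eq_mul]
    field_simp
  have hg : ((pi ^ (-(1 / 4) : ℝ) : ℝ) : ℂ) *
        Complex.exp (-(z ^ 2 + y ^ 2) / 2 + (sqrt 2 : ℂ) * z * y) =
      ((pi ^ (-(1 / 4) : ℝ) : ℝ) : ℂ) * Complex.exp ((y : ℂ) ^ 2 / 2) *
        Complex.exp (-((y : ℂ) - z / (sqrt 2 : ℂ)) ^ 2) := by
    rw [mul_assoc (((pi ^ (-(1 / 4) : ℝ) : ℝ) : ℂ)), ← Complex.exp_add]
    congr 2
    have : (z / ((sqrt 2 : ℝ) : ℂ)) ^ 2 = z ^ 2 / 2 := by rw [div_pow, h2]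
    have h3 : z / ((sqrt 2 : ℝ) : ℂ) = z * ((sqrt 2 : ℝ) : ℂ) / 2 := by
      field_simp; rw [h2]
    rw [sub_sq, this, h3]; ring
  rw [hf, hg]
  exact h

theorem abs_hermiteFun1_mul_exp (n : ℕ) (y : ℝ) : |hermiteFun1 n y| * exp (y ^ 2 / 2) =
    pi ^ (-(1 / 4) : ℝ) * (sqrt (2 ^ n * (n ! : ℝ)))⁻¹ * (exp (y ^ 2) * |gaussDeriv n y|) := by
  rw [hermiteFun1_eq, rpow_neg_half_eq _ (by positivity)]
  simp only [abs_mul, abs_pow, abs_neg, abs_one, one_pow, mul_one, Real.abs_exp, abs_inv]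
  rw [abs_of_nonneg (Real.rpow_nonneg Real.pi_pos.le _), abs_of_nonneg (Real.sqrt_nonneg _)]
  have : exp (y ^ 2) = exp (y ^ 2 / 2) * exp (y ^ 2 / 2) := by rw [← Real.exp_add]; ring_nf
  rw [this]; ring

theorem abs_hermiteFun1_le_cauchy (n : ℕ) (y : ℝ) {ρ : ℝ} (hρ : 0 < ρ) :
    |hermiteFun1 n y| * exp (y ^ 2 / 2) ≤ sqrt (n ! : ℝ) * exp (2 * |y| * ρ + ρ ^ 2) / ρ ^ n := by
  rw [abs_hermiteFun1_mul_exp]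
  have h := abs_gaussDeriv_le n y hρ
  have h1 : exp (y ^ 2) * |gaussDeriv n y| ≤ n ! * exp (2 * |y| * ρ + ρ ^ 2) / ρ ^ n := by
    calc exp (y ^ 2) * |gaussDeriv n y|
        ≤ exp (y ^ 2) * (n ! * (exp (-y ^ 2) * exp (2 * |y| * ρ + ρ ^ 2)) / ρ ^ n) := by gcongr
      _ = (exp (y ^ 2) * exp (-y ^ 2)) * (n ! * exp (2 * |y| * ρ + ρ ^ 2) / ρ ^ n) := by ring
      _ = _ := by rw [← Real.exp_add]; simp
  have h2 : (sqrt (2 ^ n * (n ! : ℝ)))⁻¹ ≤ (sqrt (n ! : ℝ))⁻¹ := by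
    have : (0 : ℝ) < n ! := by positivity
    gcongr
    have : (1 : ℝ) ≤ 2 ^ n := one_le_pow₀ (by norm_num)
    nlinarith
  have h3 : (n ! : ℝ) = sqrt (n ! : ℝ) * sqrt (n ! : ℝ) := (Real.mul_self_sqrt (by positivity)).symm
  have h4 : sqrt (n ! : ℝ) ≠ 0 := by positivity
  calc pi ^ (-(1 / 4) : ℝ) * (sqrt (2 ^ n * (n ! : ℝ)))⁻¹ * (exp (y ^ 2) * |gaussDeriv n y|)
      ≤ 1 * (sqrt (n ! : ℝ))⁻¹ * (n ! * exp (2 * |y| * ρ + ρ ^ 2) / ρ ^ n) := by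
        gcongr; exact pi_rpow_le_one
    _ = (sqrt (n ! : ℝ))⁻¹ * ((sqrt (n ! : ℝ) * sqrt (n ! : ℝ)) *
          exp (2 * |y| * ρ + ρ ^ 2) / ρ ^ n) := by rw [← h3]; ring
    _ = _ := by field_simp

/-- Growth of Hermite functions: `|h_n(y)| e^{y²/2}` is at most `|y|^n / √n!` up to a factor `C^n`,
away from the region where it is bounded by `C^n`. -/
theorem abs_hermiteFun1_le (n : ℕ) (y : ℝ) : |hermiteFun1 n y| * exp (y ^ 2 / 2) ≤
    (2 * exp 3) ^ n * (1 + |y| ^ n / sqrt (n ! : ℝ)) := by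
  rcases Nat.eq_zero_or_pos n with rfl | hn
  · rw [abs_hermiteFun1_mul_exp, gaussDeriv_zero]
    have := pi_rpow_le_one
    have h : exp (y ^ 2) * |exp (-y ^ 2)| = 1 := by rw [Real.abs_exp, ← Real.exp_add]; simp
    rw [h]
    simp at this ⊢
    linarith
  have hn' : (0 : ℝ) < n := by exact_mod_cast hn
  set q := sqrt (n : ℝ) with hq
  have hq0 : 0 < q := Real.sqrt_pos.2 hn'
  have hqq : q * q = n := Real.mul_self_sqrt hn'.le
  have hy := abs_nonneg y
  -- With `ρ = n/(√n + |y|)` one has `ρ|y| ≤ n` and `ρ² ≤ n`, so the exponential costs only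
  -- `e^{3n}`, while `ρ^{-n}` splits into the contributions of `√n` and of `|y|`.
  have hρ : 0 < (n : ℝ) / (q + |y|) := by positivity
  refine (abs_hermiteFun1_le_cauchy n y hρ).trans ?_
  have h1 : 2 * |y| * ((n : ℝ) / (q + |y|)) + ((n : ℝ) / (q + |y|)) ^ 2 ≤ n * 3 := by
    have a : |y| * ((n : ℝ) / (q + |y|)) ≤ n := by
      rw [mul_div_assoc', div_le_iff₀ (by positivity)]; nlinarith
    have b : (n : ℝ) / (q + |y|) ≤ q := by
      rw [div_le_iff₀ (by positivity)]; nlinarith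
    have c : ((n : ℝ) / (q + |y|)) ^ 2 ≤ q ^ 2 := by gcongr
    nlinarith
  have h2 : exp (2 * |y| * ((n : ℝ) / (q + |y|)) + ((n : ℝ) / (q + |y|)) ^ 2) ≤ exp 3 ^ n := by
    rw [← Real.exp_nat_mul]; exact Real.exp_le_exp.2 h1
  have hfac : (n ! : ℝ) ≤ (n : ℝ) ^ n := by exact_mod_cast Nat.factorial_le_pow n
  have h3 : sqrt (n ! : ℝ) ≤ q ^ n := by
    apply Real.sqrt_le_iff.2 ⟨by positivity, ?_⟩
    rw [← pow_mul, mul_comm, pow_mul, pow_two, hqq]; exact hfac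
  have hs0 : 0 < sqrt (n ! : ℝ) := by positivity
  have h4 : sqrt (n ! : ℝ) / ((n : ℝ) / (q + |y|)) ^ n ≤ 2 ^ n * (1 + |y| ^ n / sqrt (n ! : ℝ)) := by
    have e : sqrt (n ! : ℝ) / ((n : ℝ) / (q + |y|)) ^ n =
        sqrt (n ! : ℝ) * (q + |y|) ^ n / (q ^ n * q ^ n) := by
      rw [← hqq, ← mul_pow, div_pow, div_div_eq_mul_div]
    rw [e, div_le_iff₀ (by positivity)]
    have h5 : (q + |y|) ^ n ≤ 2 ^ n * (q ^ n + |y| ^ n) := by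
      rcases le_total q |y| with hle | hle
      · calc (q + |y|) ^ n ≤ (2 * |y|) ^ n := by gcongr; linarith
          _ = 2 ^ n * |y| ^ n := mul_pow _ _ _
          _ ≤ _ := by gcongr; linarith [pow_pos hq0 n]
      · calc (q + |y|) ^ n ≤ (2 * q) ^ n := by gcongr; linarith
          _ = 2 ^ n * q ^ n := mul_pow _ _ _
          _ ≤ _ := by gcongr; linarith [pow_nonneg hy n]
    have h6 : sqrt (n ! : ℝ) * |y| ^ n ≤ |y| ^ n / sqrt (n ! : ℝ) * (q ^ n * q ^ n) := by
      rw [div_mul_eq_mul_div, le_div_iff₀ hs0]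
      nlinarith [mul_le_mul h3 h3 hs0.le (by positivity), pow_nonneg hy n]
    have h7 : sqrt (n ! : ℝ) * q ^ n ≤ q ^ n * q ^ n := by gcongr
    calc sqrt (n ! : ℝ) * (q + |y|) ^ n ≤ sqrt (n ! : ℝ) * (2 ^ n * (q ^ n + |y| ^ n)) := by gcongr
      _ = 2 ^ n * (sqrt (n ! : ℝ) * q ^ n + sqrt (n ! : ℝ) * |y| ^ n) := by ring
      _ ≤ 2 ^ n * (q ^ n * q ^ n + |y| ^ n / sqrt (n ! : ℝ) * (q ^ n * q ^ n)) := by gcongr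
      _ = _ := by ring
  calc sqrt (n ! : ℝ) * exp (2 * |y| * ((n : ℝ) / (q + |y|)) + ((n : ℝ) / (q + |y|)) ^ 2) /
        ((n : ℝ) / (q + |y|)) ^ n
      = sqrt (n ! : ℝ) / ((n : ℝ) / (q + |y|)) ^ n *
        exp (2 * |y| * ((n : ℝ) / (q + |y|)) + ((n : ℝ) / (q + |y|)) ^ 2) := by ring
    _ ≤ 2 ^ n * (1 + |y| ^ n / sqrt (n ! : ℝ)) * exp 3 ^ n := by gcongr
    _ = _ := by rw [mul_pow]; ring

/-- Take `t^n/n! ≤ e^t` at `t = rγ|y|^γ` and raise it to the power `1/γ`. -/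
theorem pow_div_sqrt_factorial_le {γ r : ℝ} (hγ : 0 < γ) (hr : 0 < r) (n : ℕ) (y : ℝ) :
    |y| ^ n / sqrt (n ! : ℝ) ≤
      ((r * γ) ^ (-(1 / γ))) ^ n * (n ! : ℝ) ^ (1 / γ - 1 / 2) * exp (r * |y| ^ γ) := by
  have hf : (0 : ℝ) < n ! := by positivity
  have hrg : 0 < r * γ := by positivity
  have hy := abs_nonneg y
  have h := Real.pow_div_factorial_le_exp (x := r * γ * |y| ^ γ) (by positivity) n
  rw [div_le_iff₀ hf] at h
  have h1 := Real.rpow_le_rpow (by positivity) h (z := 1 / γ) (by positivity)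
  have e1 : ((r * γ * |y| ^ γ) ^ n) ^ (1 / γ) = ((r * γ) ^ (1 / γ)) ^ n * |y| ^ n := by
    rw [← Real.rpow_natCast, ← Real.rpow_mul (by positivity), mul_comm (n : ℝ),
      Real.rpow_mul (by positivity), Real.mul_rpow (by positivity) (by positivity),
      ← Real.rpow_mul hy, mul_one_div_cancel hγ.ne', Real.rpow_one, Real.rpow_natCast, mul_pow]
  have e2 : (exp (r * γ * |y| ^ γ) * n !) ^ (1 / γ) = exp (r * |y| ^ γ) * (n ! : ℝ) ^ (1 / γ) := by
    rw [Real.mul_rpow (by positivity) hf.le, ← Real.exp_mul]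
    congr 2; field_simp
  rw [e1, e2] at h1
  have hp : 0 < ((r * γ) ^ (1 / γ)) ^ n := by positivity
  have e3 : ((r * γ) ^ (-(1 / γ))) ^ n = (((r * γ) ^ (1 / γ)) ^ n)⁻¹ := by
    rw [Real.rpow_neg hrg.le, inv_pow]
  rw [div_le_iff₀ (by positivity), e3, Real.rpow_sub hf, ← Real.sqrt_eq_rpow]
  have hs : sqrt (n ! : ℝ) ≠ 0 := by positivity
  calc |y| ^ n = (((r * γ) ^ (1 / γ)) ^ n)⁻¹ * (((r * γ) ^ (1 / γ)) ^ n * |y| ^ n) := by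
        field_simp
    _ ≤ (((r * γ) ^ (1 / γ)) ^ n)⁻¹ * (exp (r * |y| ^ γ) * (n ! : ℝ) ^ (1 / γ)) := by gcongr
    _ = _ := by field_simp

/-- Bound of a Hermite function by a power-type exponential. -/
theorem exists_abs_hermiteFun1_le {γ r : ℝ} (hγ : 0 < γ) (hγ2 : γ ≤ 2) (hr : 0 < r) :
    ∃ A : ℝ, 1 ≤ A ∧ ∀ (n : ℕ) (y : ℝ), |hermiteFun1 n y| * exp (y ^ 2 / 2) ≤
      2 * A ^ n * (n ! : ℝ) ^ (1 / γ - 1 / 2) * exp (r * |y| ^ γ) := by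
  set B := (r * γ) ^ (-(1 / γ)) with hB
  have hB0 : 0 < B := by positivity
  have hC : 1 ≤ 2 * exp 3 := by linarith [Real.add_one_le_exp 3]
  refine ⟨2 * exp 3 * max 1 B, one_le_mul_of_one_le_of_one_le hC (le_max_left _ _), fun n y => ?_⟩
  refine (abs_hermiteFun1_le n y).trans ?_
  -- This is where `γ ≤ 2` is needed: with a nonnegative exponent the factorial factor is at least
  -- one and absorbs the constant term of `abs_hermiteFun1_le`.
  have hκ : 0 ≤ 1 / γ - 1 / 2 := by
    rw [sub_nonneg]; exact one_div_le_one_div_of_le hγ hγ2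
  have h1 : 1 ≤ (n ! : ℝ) ^ (1 / γ - 1 / 2) :=
    Real.one_le_rpow (by exact_mod_cast Nat.one_le_iff_ne_zero.2 (Nat.factorial_ne_zero n)) hκ
  have h2 : 1 ≤ exp (r * |y| ^ γ) := Real.one_le_exp (by positivity)
  have hm : 1 ≤ (max 1 B) ^ n := one_le_pow₀ (le_max_left _ _)
  have h3 := pow_div_sqrt_factorial_le hγ hr n y
  have h4 : B ^ n ≤ (max 1 B) ^ n := by gcongr; exact le_max_right _ _
  have h5 : 1 ≤ (max 1 B) ^ n * (n ! : ℝ) ^ (1 / γ - 1 / 2) * exp (r * |y| ^ γ) :=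
    one_le_mul_of_one_le_of_one_le (one_le_mul_of_one_le_of_one_le hm h1) h2
  have h6 : |y| ^ n / sqrt (n ! : ℝ) ≤
      (max 1 B) ^ n * (n ! : ℝ) ^ (1 / γ - 1 / 2) * exp (r * |y| ^ γ) := by
    refine h3.trans ?_
    gcongr
  calc (2 * exp 3) ^ n * (1 + |y| ^ n / sqrt (n ! : ℝ))
      ≤ (2 * exp 3) ^ n * (2 * ((max 1 B) ^ n * (n ! : ℝ) ^ (1 / γ - 1 / 2) *
        exp (r * |y| ^ γ))) := by gcongr; linarith
    _ = _ := by rw [mul_pow _ (max 1 B)]; ring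

/-- The case `γ = 2`, where the factorial disappears. This crude envelope serves integrability and
the exchange of sums with integrals. -/
theorem exists_abs_hermiteFun1_le_gaussian {r : ℝ} (hr : 0 < r) :
    ∃ A : ℝ, 1 ≤ A ∧ ∀ (n : ℕ) (y : ℝ), |hermiteFun1 n y| ≤ 2 * A ^ n * exp (-(1 / 2 - r) * y ^ 2) := by
  obtain ⟨A, hA, h⟩ := exists_abs_hermiteFun1_le (γ := 2) (by norm_num) le_rfl hr
  refine ⟨A, hA, fun n y => ?_⟩
  have := h n y
  norm_num at this
  rw [← le_div_iff₀ (by positivity)] at this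
  refine this.trans (le_of_eq ?_)
  rw [mul_div_assoc, ← Real.exp_sub]
  ring_nf

/-! ### Orthonormality in one variable -/

theorem integrable_hermiteFun1_mul (n m : ℕ) :
    Integrable (fun y => hermiteFun1 n y * hermiteFun1 m y) := by
  obtain ⟨A, hA, h⟩ := exists_abs_hermiteFun1_le_gaussian (r := 1 / 4) (by norm_num)
  refine ((integrable_exp_neg_mul_sq (b := 1 / 2) (by norm_num)).const_mul
    (2 * A ^ n * (2 * A ^ m))).mono'
    ((continuous_hermiteFun1 n).mul (continuous_hermiteFun1 m)).aestronglyMeasurable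
    (Filter.Eventually.of_forall fun y => ?_)
  rw [Real.norm_eq_abs, abs_mul]
  refine (mul_le_mul (h n y) (h m y) (abs_nonneg _) (by positivity)).trans (le_of_eq ?_)
  rw [mul_mul_mul_comm, ← Real.exp_add]
  ring_nf

theorem hermiteFun1_mul_eq (n m : ℕ) : ∃ c : ℝ, c ≠ 0 ∧ ∀ y,
    exp (y ^ 2) * gaussDeriv n y * gaussDeriv m y = c * (hermiteFun1 n y * hermiteFun1 m y) := by
  have hp : 0 < pi ^ (-(1 / 4) : ℝ) := Real.rpow_pos_of_pos Real.pi_pos _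
  have h1 : ∀ n : ℕ, pi ^ (-(1 / 4) : ℝ) * (-1) ^ n * ((2 : ℝ) ^ n * (n ! : ℝ)) ^ (-(1 / 2) : ℝ) ≠ 0 :=
    fun n => mul_ne_zero (mul_ne_zero hp.ne' (pow_ne_zero _ (by norm_num))) (by positivity)
  refine ⟨_, inv_ne_zero (mul_ne_zero (h1 n) (h1 m)), fun y => ?_⟩
  rw [eq_inv_mul_iff_mul_eq₀ (mul_ne_zero (h1 n) (h1 m)), hermiteFun1_eq, hermiteFun1_eq]
  have : exp (y ^ 2) = exp (y ^ 2 / 2) * exp (y ^ 2 / 2) := by rw [← Real.exp_add]; ring_nf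
  rw [this]; ring

theorem integrable_gaussDeriv_mul (n m : ℕ) :
    Integrable (fun y => exp (y ^ 2) * gaussDeriv n y * gaussDeriv m y) := by
  obtain ⟨c, -, h⟩ := hermiteFun1_mul_eq n m
  simp_rw [h]
  exact (integrable_hermiteFun1_mul n m).const_mul c

/-- Integration by parts: one derivative leaves the first factor, and on `e^{y²} g_{m+1}` it acts as
the lowering operator. Both indices drop, so orthogonality reduces to the case where one index is
zero. -/
theorem integral_gaussDeriv_succ (n m : ℕ) :
    ∫ y, exp (y ^ 2) * gaussDeriv (n + 1) y * gaussDeriv (m + 1) y =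
      2 * (m + 1) * ∫ y, exp (y ^ 2) * gaussDeriv n y * gaussDeriv m y := by
  have hv : ∀ y : ℝ, HasDerivAt (fun y => exp (y ^ 2) * gaussDeriv (m + 1) y)
      (-2 * (m + 1) * (exp (y ^ 2) * gaussDeriv m y)) y := by
    intro y
    have h1 : HasDerivAt (fun v : ℝ => exp (v ^ 2)) (exp (y ^ 2) * (2 * y)) y := by
      have := (hasDerivAt_pow 2 y).exp
      simpa using this
    have h2 := h1.mul (hasDerivAt_gaussDeriv (m + 1) y)
    rw [show m + 1 + 1 = m + 2 from rfl, gaussDeriv_recurrence] at h2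
    have e : -2 * ((m : ℝ) + 1) * (exp (y ^ 2) * gaussDeriv m y) =
      exp (y ^ 2) * (2 * y) * gaussDeriv (m + 1) y + exp (y ^ 2) *
      (-2 * y * gaussDeriv (m + 1) y - 2 * (m + 1) * gaussDeriv m y) := by ring
    rw [e]
    exact h2
  have h := integral_mul_deriv_eq_deriv_mul_of_integrable (u := gaussDeriv n)
    (v := fun y => exp (y ^ 2) * gaussDeriv (m + 1) y) (u' := gaussDeriv (n + 1))
    (v' := fun y => -2 * (m + 1) * (exp (y ^ 2) * gaussDeriv m y))
    (fun y _ => hasDerivAt_gaussDeriv n y) (fun y _ => hv y) ?_ ?_ ?_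
  · have e1 : ∀ y, gaussDeriv n y * (-2 * ((m : ℝ) + 1) * (exp (y ^ 2) * gaussDeriv m y)) =
      (-2 * ((m : ℝ) + 1)) * (exp (y ^ 2) * gaussDeriv n y * gaussDeriv m y) := fun y => by ring
    have e2 : ∀ y, gaussDeriv (n + 1) y * (exp (y ^ 2) * gaussDeriv (m + 1) y) =
      exp (y ^ 2) * gaussDeriv (n + 1) y * gaussDeriv (m + 1) y := fun y => by ring
    simp_rw [e1, e2, integral_const_mul] at h
    linarith
  · refine ((integrable_gaussDeriv_mul n m).const_mul (-2 * ((m : ℝ) + 1))).congr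
      (Filter.Eventually.of_forall fun y => ?_)
    simp only [Pi.mul_apply]; ring
  · refine ((integrable_gaussDeriv_mul (n + 1) (m + 1))).congr
      (Filter.Eventually.of_forall fun y => ?_)
    simp only [Pi.mul_apply]; ring
  · refine ((integrable_gaussDeriv_mul n (m + 1))).congr
      (Filter.Eventually.of_forall fun y => ?_)
    simp only [Pi.mul_apply]; ring

/-- Since `e^{y²} g_0 = 1`, the integrand is the derivative of the integrable function `g_m`. -/
theorem integral_gaussDeriv_zero_succ (m : ℕ) :
    ∫ y, exp (y ^ 2) * gaussDeriv 0 y * gaussDeriv (m + 1) y = 0 := by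
  have e : ∀ (k : ℕ) (y : ℝ), exp (y ^ 2) * gaussDeriv 0 y * gaussDeriv k y = gaussDeriv k y := by
    intro k y; rw [gaussDeriv_zero, ← Real.exp_add]; simp
  have hi : ∀ k : ℕ, Integrable (gaussDeriv k) := fun k => by
    have := integrable_gaussDeriv_mul 0 k
    simp_rw [e] at this; exact this
  simp_rw [e]
  exact integral_eq_zero_of_hasDerivAt_of_integrable (fun y => hasDerivAt_gaussDeriv m y)
    (hi (m + 1)) (hi m)

theorem integral_gaussDeriv_mul (n m : ℕ) :
    ∫ y, exp (y ^ 2) * gaussDeriv n y * gaussDeriv m y =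
      if n = m then sqrt pi * (2 ^ n * n !) else 0 := by
  induction n generalizing m with
  | zero =>
    rcases m with _ | m
    · have e : ∀ y : ℝ, exp (y ^ 2) * gaussDeriv 0 y * gaussDeriv 0 y = exp (-1 * y ^ 2) := by
        intro y; rw [gaussDeriv_zero, ← Real.exp_add, ← Real.exp_add]; ring_nf
      simp_rw [e, integral_gaussian]; simp
    · rw [integral_gaussDeriv_zero_succ]; simp
  | succ n ih =>
    rcases m with _ | m
    · have e : ∀ y, exp (y ^ 2) * gaussDeriv (n + 1) y * gaussDeriv 0 y =
        exp (y ^ 2) * gaussDeriv 0 y * gaussDeriv (n + 1) y := fun y => by ring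
      simp_rw [e, integral_gaussDeriv_zero_succ]; simp
    · rw [integral_gaussDeriv_succ, ih]
      rcases eq_or_ne n m with rfl | hnm
      · simp [pow_succ, Nat.factorial_succ]; ring
      · simp [hnm]

/-- Orthonormality of the one-dimensional Hermite functions. -/
theorem integral_hermiteFun1_mul (n m : ℕ) :
    ∫ y, hermiteFun1 n y * hermiteFun1 m y = if n = m then 1 else 0 := by
  have e : ∀ y, hermiteFun1 n y * hermiteFun1 m y =
      (pi ^ (-(1 / 4) : ℝ) * (-1) ^ n * ((2 : ℝ) ^ n * (n ! : ℝ)) ^ (-(1 / 2) : ℝ) *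
      (pi ^ (-(1 / 4) : ℝ) * (-1) ^ m * ((2 : ℝ) ^ m * (m ! : ℝ)) ^ (-(1 / 2) : ℝ))) *
      (exp (y ^ 2) * gaussDeriv n y * gaussDeriv m y) := by
    intro y
    rw [hermiteFun1_eq, hermiteFun1_eq]
    have : exp (y ^ 2) = exp (y ^ 2 / 2) * exp (y ^ 2 / 2) := by rw [← Real.exp_add]; ring_nf
    rw [this]; ring
  simp_rw [e, integral_const_mul, integral_gaussDeriv_mul]
  rcases eq_or_ne n m with rfl | hnm
  · rw [if_pos rfl, if_pos rfl]
    have hp : pi ^ (-(1 / 4) : ℝ) * pi ^ (-(1 / 4) : ℝ) * sqrt pi = 1 := by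
      rw [Real.sqrt_eq_rpow, ← Real.rpow_add Real.pi_pos, ← Real.rpow_add Real.pi_pos]; norm_num
    have hN : (0 : ℝ) < 2 ^ n * n ! := by positivity
    have hq : ((2 : ℝ) ^ n * (n ! : ℝ)) ^ (-(1 / 2) : ℝ) * ((2 : ℝ) ^ n * (n ! : ℝ)) ^ (-(1 / 2) : ℝ) *
        (2 ^ n * n !) = 1 := by
      rw [← Real.rpow_add hN, show -(1 / 2 : ℝ) + -(1 / 2) = -1 by norm_num, Real.rpow_neg_one,
        inv_mul_cancel₀ hN.ne']
    have hs : ((-1 : ℝ) ^ n) * (-1) ^ n = 1 := by rw [← mul_pow]; norm_num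
    linear_combination (exp := 1) ((-1 : ℝ) ^ n * (-1) ^ n) * (((2 : ℝ) ^ n * (n ! : ℝ)) ^ (-(1 / 2) : ℝ) *
      ((2 : ℝ) ^ n * (n ! : ℝ)) ^ (-(1 / 2) : ℝ) * (2 ^ n * n !)) * hp +
      ((-1 : ℝ) ^ n * (-1) ^ n) * hq + hs
  · simp [hnm]

/-! ### Products over coordinates and multi-indices -/

theorem hasSum_mul_prod {𝕜 : Type*} [RCLike 𝕜] {ι κ : Type*} {f : ι → 𝕜} {g : κ → 𝕜} {a b : 𝕜} (hf : HasSum f a) (hg : HasSum g b) :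
  HasSum (fun p : ι × κ => f p.1 * g p.2) (a * b) := by
  have hs := summable_mul_of_summable_norm (f := f) (g := g) hf.summable.norm hg.summable.norm
  exact hf.mul hg hs
theorem hasSum_pi_prod {𝕜 : Type*} [RCLike 𝕜] {d : ℕ} {f : Fin d → ℕ → 𝕜} {a : Fin d → 𝕜}
    (h : ∀ j, HasSum (f j) (a j)) :
    HasSum (fun α : Fin d → ℕ => ∏ j, f j (α j)) (∏ j, a j) := by
  induction d with
  | zero => simp
  | succ d ih =>
    have h2 := hasSum_mul_prod (h 0) (ih (f := fun j => f j.succ) (a := fun j => a j.succ) fun j => h j.succ)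
    rw [Fin.prod_univ_succ]
    refine ((Fin.consEquiv fun _ : Fin (d + 1) => ℕ).hasSum_iff).1 ?_
    refine h2.congr_fun ?_
    intro p
    simp [Fin.prod_univ_succ, Fin.consEquiv]

theorem summable_pi_prod {d : ℕ} {f : Fin d → ℕ → ℝ} (h : ∀ j, Summable (f j)) :
    Summable (fun α : Fin d → ℕ => ∏ j, f j (α j)) :=
  (hasSum_pi_prod fun j => (h j).hasSum).summable

theorem summable_half_pow_sum (d : ℕ) :
    Summable (fun α : Fin d → ℕ => ((1 / 2 : ℝ)) ^ (∑ j, α j)) := by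
  simp_rw [← Finset.prod_pow_eq_pow_sum]
  exact summable_pi_prod fun _ => summable_geometric_two

theorem summable_pow_div_sqrt_factorial (x : ℝ) (hx : 0 ≤ x) :
    Summable (fun n : ℕ => x ^ n / sqrt (n ! : ℝ)) := by
  have h := (summable_geometric_two).mul_left (exp ((2 * x) ^ 2 / 2))
  refine h.of_nonneg_of_le (fun n => by positivity) fun n => ?_
  -- At `γ = 2`, `r = 1/2` both prefactors equal one. Using `2x` in place of `x` gains the geometric
  -- factor `2^{-n}`.
  have h1 := pow_div_sqrt_factorial_le (γ := 2) (r := 1 / 2) (by norm_num) (by norm_num) n (2 * x)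
  norm_num at h1
  rw [abs_of_nonneg hx, mul_pow, mul_div_assoc] at h1
  have h2 : x ^ n / sqrt (n ! : ℝ) = (1 / 2) ^ n * (2 ^ n * (x ^ n / sqrt (n ! : ℝ))) := by
    rw [← mul_assoc, ← mul_pow]; norm_num
  rw [h2, mul_comm]
  gcongr
  refine h1.trans (le_of_eq ?_)
  congr 1; ring

theorem norm_sq_eq_sum {d : ℕ} (x : EuclideanSpace ℝ (Fin d)) : ‖x‖ ^ 2 = ∑ j, x j ^ 2 := by
  rw [EuclideanSpace.norm_sq_eq]; simp

theorem exp_norm_sq {d : ℕ} (c : ℝ) (x : EuclideanSpace ℝ (Fin d)) :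
    exp (c * ‖x‖ ^ 2) = ∏ j, exp (c * x j ^ 2) := by
  rw [norm_sq_eq_sum, Finset.mul_sum, Real.exp_sum]

/-- Integrability of a product function on Euclidean space. -/
theorem integrable_prod_euclidean {𝕜 : Type*} [RCLike 𝕜] {d : ℕ} {f : Fin d → ℝ → 𝕜}
    (h : ∀ j, Integrable (f j)) :
    Integrable (fun x : EuclideanSpace ℝ (Fin d) => ∏ j, f j (x j)) := by
  have := Integrable.fintype_prod (f := f) h
  exact (PiLp.volume_preserving_ofLp (Fin d)).integrable_comp_of_integrable this

theorem integral_prod_euclidean {𝕜 : Type*} [RCLike 𝕜] {d : ℕ} (f : Fin d → ℝ → 𝕜) :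
    ∫ x : EuclideanSpace ℝ (Fin d), ∏ j, f j (x j) = ∏ j, ∫ y, f j y := by
  rw [← integral_fintype_prod_volume_eq_prod]
  exact (PiLp.volume_preserving_ofLp (Fin d)).integral_comp
    (MeasurableEquiv.toLp 2 (Fin d → ℝ)).symm.measurableEmbedding (fun x : Fin d → ℝ => ∏ j, f j (x j))

theorem continuous_hermiteFun {d : ℕ} (α : Fin d → ℕ) : Continuous (hermiteFun α) := by
  unfold hermiteFun
  refine continuous_finsetProd _ fun j _ => (continuous_hermiteFun1 _).comp ?_
  fun_prop

theorem abs_hermiteFun_le_of {d : ℕ} {α : Fin d → ℕ} {x : EuclideanSpace ℝ (Fin d)}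
    {b : Fin d → ℝ} (h : ∀ j, |hermiteFun1 (α j) (x j)| ≤ b j) : |hermiteFun α x| ≤ ∏ j, b j := by
  unfold hermiteFun
  rw [Finset.abs_prod]
  exact Finset.prod_le_prod (fun _ _ => abs_nonneg _) fun j _ => h j

theorem exists_abs_hermiteFun_le_gaussian (d : ℕ) {r : ℝ} (hr : 0 < r) :
    ∃ A : ℝ, 1 ≤ A ∧ ∀ (α : Fin d → ℕ) (x : EuclideanSpace ℝ (Fin d)),
      |hermiteFun α x| ≤ 2 ^ d * A ^ (∑ j, α j) * exp (-(1 / 2 - r) * ‖x‖ ^ 2) := by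
  obtain ⟨A, hA, h⟩ := exists_abs_hermiteFun1_le_gaussian hr
  refine ⟨A, hA, fun α x => (abs_hermiteFun_le_of fun j => h (α j) (x j)).trans (le_of_eq ?_)⟩
  rw [Finset.prod_mul_distrib, Finset.prod_mul_distrib, exp_norm_sq, Finset.prod_pow_eq_pow_sum]
  simp

theorem integral_hermiteFun_mul {d : ℕ} (α β : Fin d → ℕ) :
    ∫ x, hermiteFun α x * hermiteFun β x = if α = β then 1 else 0 := by
  unfold hermiteFun
  simp_rw [← Finset.prod_mul_distrib]
  rw [integral_prod_euclidean (fun j y => hermiteFun1 (α j) y * hermiteFun1 (β j) y)]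
  simp_rw [integral_hermiteFun1_mul]
  rcases eq_or_ne α β with rfl | h
  · simp
  · obtain ⟨j, hj⟩ := Function.ne_iff.1 h
    rw [if_neg h]
    exact Finset.prod_eq_zero (Finset.mem_univ j) (if_neg hj)

theorem integrable_exp_neg_mul_norm_sq (d : ℕ) {c : ℝ} (hc : 0 < c) :
    Integrable (fun x : EuclideanSpace ℝ (Fin d) => exp (-c * ‖x‖ ^ 2)) := by
  simp_rw [exp_norm_sq]
  exact integrable_prod_euclidean fun j => integrable_exp_neg_mul_sq hc

/-! ### Phragmén–Lindelöf principles in sectors -/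

/-- Data for comparing `e^{r W(|z|)}` with the modulus of a holomorphic function on the sector
`|arg z| ≤ h`, written in the logarithmic coordinate `ζ = log z`. -/
structure IsSectorMajorant (W : ℝ → ℝ) (h r C D : ℝ) (E : ℂ → ℂ) : Prop where
  differentiableAt : ∀ ζ : ℂ, |ζ.im| ≤ h → DifferentiableAt ℂ E ζ
  lower : ∀ ζ : ℂ, |ζ.im| ≤ h → r * W (exp ζ.re) ≤ (E ζ).re
  upper : ∀ ζ : ℂ, |ζ.im| ≤ h → (E ζ).re ≤ C * r * W (exp ζ.re) + D

/-- In the coordinate `ζ = log z` the sector is a strip with midline `Im ζ = m`. Dividing `G(e^ζ)`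
by `e^E`, with `E` translated to that midline, gives a function bounded by `K` on both edges, hence
inside; multiplying back uses the upper bound for `Re E`. -/
theorem norm_le_of_sector {W : ℝ → ℝ} {h₀ r C D : ℝ} {E : ℂ → ℂ}
    (hE : IsSectorMajorant W h₀ r C D E) (hW : ∀ x, 0 ≤ x → 0 ≤ W x) (hr : 0 ≤ r)
    (hh₀ : h₀ < pi / 4) {G : ℂ → ℂ} (hG : Differentiable ℂ G)
    {B : ℝ} (hB : ∀ z, ‖G z‖ ≤ exp (B * (1 + ‖z‖ ^ 2))) {m h K : ℝ} (hh : 0 < h) (hhh : h ≤ h₀)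
    (hlo : ∀ ζ : ℂ, ζ.im = m - h → ‖G (Complex.exp ζ)‖ ≤ K * exp (r * W (exp ζ.re)))
    (hhi : ∀ ζ : ℂ, ζ.im = m + h → ‖G (Complex.exp ζ)‖ ≤ K * exp (r * W (exp ζ.re)))
    (ζ : ℂ) (hζ : |ζ.im - m| ≤ h) :
    ‖G (Complex.exp ζ)‖ ≤ K * exp (C * r * W (exp ζ.re) + D) := by
  set H : ℂ → ℂ := fun ζ => G (Complex.exp ζ) * Complex.exp (-E (ζ - m * Complex.I)) with hH
  have him : ∀ w : ℂ, (w - m * Complex.I).im = w.im - m := fun w => by simp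
  have hre : ∀ w : ℂ, (w - m * Complex.I).re = w.re := fun w => by simp
  have hnorm : ∀ w : ℂ, ‖H w‖ = ‖G (Complex.exp w)‖ * exp (-(E (w - m * Complex.I)).re) := by
    intro w; simp [hH, Complex.norm_exp]
  have hdH : ∀ w : ℂ, |w.im - m| ≤ h → DifferentiableAt ℂ H w := by
    intro w hw
    have h1 : DifferentiableAt ℂ E (w - m * Complex.I) :=
      hE.differentiableAt _ (by rw [him]; exact hw.trans hhh)
    have h2 : DifferentiableAt ℂ (fun w : ℂ => E (w - m * Complex.I)) w :=
      DifferentiableAt.comp w h1 (by fun_prop)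
    have h3 : DifferentiableAt ℂ (fun w : ℂ => G (Complex.exp w)) w :=
      (hG _).comp w (Complex.differentiable_exp w)
    exact h3.mul h2.neg.cexp
  have hlow : ∀ w : ℂ, |w.im - m| ≤ h → r * W (exp w.re) ≤ (E (w - m * Complex.I)).re := by
    intro w hw
    have := hE.lower (w - m * Complex.I) (by rw [him]; exact hw.trans hhh)
    rwa [hre] at this
  have hbd : ∀ w : ℂ, |w.im - m| ≤ h → ‖G (Complex.exp w)‖ ≤ K * exp (r * W (exp w.re)) →
      ‖H w‖ ≤ K := by
    intro w hw hb
    rw [hnorm]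
    have hK : 0 ≤ K := by
      by_contra hK
      have : K * exp (r * W (exp w.re)) < 0 := mul_neg_of_neg_of_pos (not_le.1 hK) (Real.exp_pos _)
      linarith [norm_nonneg (G (Complex.exp w))]
    calc ‖G (Complex.exp w)‖ * exp (-(E (w - m * Complex.I)).re)
        ≤ K * exp (r * W (exp w.re)) * exp (-(r * W (exp w.re))) := by
          gcongr; exact hlow w hw
      _ = K := by rw [mul_assoc, ← Real.exp_add]; simp
  have hpre : IsClosed (Complex.im ⁻¹' Set.Icc (m - h) (m + h)) :=
    isClosed_Icc.preimage Complex.continuous_im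
  have key : ‖H ζ‖ ≤ K := by
    refine PhragmenLindelof.horizontal_strip (a := m - h) (b := m + h) ?_ ?_ ?_ ?_ ?_ ?_
    · have hcl : closure (Complex.im ⁻¹' Set.Ioo (m - h) (m + h)) ⊆
          Complex.im ⁻¹' Set.Icc (m - h) (m + h) :=
        closure_minimal (Set.preimage_mono Set.Ioo_subset_Icc_self) hpre
      refine DifferentiableOn.diffContOnCl fun w hw => (hdH w ?_).differentiableWithinAt
      have := hcl hw
      rw [Set.mem_preimage, Set.mem_Icc] at this
      rw [abs_le]; constructor <;> linarith
    -- Gaussian growth in `z` is growth `exp(const · e^{2|Re ζ|})` in `ζ`. The exponent `2` is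
    -- admissible because the strip has width `2h < π/2`.
    · refine ⟨2, ?_, 2 * |B|, ?_⟩
      · rw [lt_div_iff₀ (by linarith)]
        nlinarith
      · refine Asymptotics.IsBigO.of_bound 1 ?_
        refine Filter.Eventually.filter_mono inf_le_right ?_
        rw [Filter.eventually_principal]
        intro w hw
        rw [Set.mem_preimage, Set.mem_Ioo] at hw
        have hw' : |w.im - m| ≤ h := by rw [abs_le]; constructor <;> linarith
        rw [hnorm, one_mul, Real.norm_eq_abs, Real.abs_exp]
        have h1 : exp (-(E (w - m * Complex.I)).re) ≤ 1 := by
          rw [Real.exp_le_one_iff]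
          have := hlow w hw'
          have := mul_nonneg hr (hW (exp w.re) (Real.exp_pos _).le)
          linarith
        have h2 := hB (Complex.exp w)
        rw [Complex.norm_exp, ← Real.exp_nat_mul] at h2
        have h3 : (1 : ℝ) ≤ exp (2 * |w.re|) := Real.one_le_exp (by positivity)
        have h4 : exp ((2 : ℕ) * w.re) ≤ exp (2 * |w.re|) := by
          apply Real.exp_le_exp.2; push_cast; linarith [le_abs_self w.re]
        calc ‖G (Complex.exp w)‖ * exp (-(E (w - m * Complex.I)).re)
            ≤ exp (B * (1 + exp ((2 : ℕ) * w.re))) * 1 := by gcongr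
          _ = exp (B * (1 + exp ((2 : ℕ) * w.re))) := mul_one _
          _ ≤ exp (2 * |B| * exp (2 * |w.re|)) := by
            apply Real.exp_le_exp.2
            calc B * (1 + exp ((2 : ℕ) * w.re)) ≤ |B| * (1 + exp ((2 : ℕ) * w.re)) := by
                  gcongr; exact le_abs_self B
              _ ≤ |B| * (exp (2 * |w.re|) + exp (2 * |w.re|)) := by gcongr
              _ = _ := by ring
    · intro w hw
      exact hbd w (by rw [hw, abs_le]; constructor <;> linarith) (hlo w hw)
    · intro w hw
      exact hbd w (by rw [hw, abs_le]; constructor <;> linarith) (hhi w hw)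
    · rw [abs_le] at hζ; linarith
    · rw [abs_le] at hζ; linarith
  rw [hnorm] at key
  have hup := hE.upper (ζ - m * Complex.I) (by rw [him]; exact hζ.trans hhh)
  rw [hre] at hup
  have hK : 0 ≤ K := le_trans (by positivity) key
  calc ‖G (Complex.exp ζ)‖ = ‖G (Complex.exp ζ)‖ * exp (-(E (ζ - m * Complex.I)).re) *
        exp ((E (ζ - m * Complex.I)).re) := by rw [mul_assoc, ← Real.exp_add]; simp
    _ ≤ K * exp (C * r * W (exp ζ.re) + D) := by gcongr

/-- The set `A` of directions meets every interval of length `h`, in the sense that every angle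
lies between two directions of `A` that are at most `h` apart. -/
def AngleDense (A : Set ℝ) (h : ℝ) : Prop :=
  ∀ θ : ℝ, ∃ a ∈ A, ∃ b ∈ A, a ≤ θ ∧ θ ≤ b ∧ a < b ∧ b - a ≤ h

/-- The Phragmén–Lindelöf property of a growth function `W`: entire functions with Gaussian
growth off finitely many directions and growth `e^{r W}` along them have growth `e^{r' W}`. -/
def PhragmenLindelofProperty (W : ℝ → ℝ) (h : ℝ) : Prop :=
  ∀ r' : ℝ, 0 < r' → ∃ r : ℝ, 0 < r ∧ r ≤ r' ∧ ∃ M : ℝ, 1 ≤ M ∧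
    ∀ A : Set ℝ, AngleDense A h → ∀ G : ℂ → ℂ, Differentiable ℂ G →
    (∃ B : ℝ, ∀ z, ‖G z‖ ≤ exp (B * (1 + ‖z‖ ^ 2))) → ∀ K : ℝ,
    (∀ a ∈ A, ∀ z : ℂ, ‖G z‖ ≤
      K * exp ((Complex.exp (-(a * Complex.I)) * z).im ^ 2 / 2 + r * W ‖z‖)) →
    ∀ z, ‖G z‖ ≤ K * M * exp (r' * W ‖z‖)

theorem im_exp_rotate (a : ℝ) (ζ : ℂ) :
    (Complex.exp (-(a * Complex.I)) * Complex.exp ζ).im = exp ζ.re * Real.sin (ζ.im - a) := by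
  rw [← Complex.exp_add, Complex.exp_im]
  congr 2 <;> simp
  ring

theorem nonneg_of_norm_le_mul_exp {x : ℂ} {K y : ℝ} (h : ‖x‖ ≤ K * exp y) : 0 ≤ K := by
  by_contra hK
  have : K * exp y < 0 := mul_neg_of_neg_of_pos (not_le.1 hK) (Real.exp_pos _)
  linarith [norm_nonneg x]

/-- On the rays themselves the term in `Im²` vanishes, so two neighbouring rays bound a sector of
half-opening at most `h/2 < π/4` to which `norm_le_of_sector` applies. The constant `C` must not
depend on `r`, so that `r = r'/C` is a legitimate choice; `D` may depend on `r` and only enters `M`.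
The origin has no logarithm and is treated separately. -/
theorem phragmenLindelofProperty_of_majorant {W : ℝ → ℝ} {h : ℝ} (hh : h < pi / 2)
    (hW : ∀ x, 0 ≤ x → 0 ≤ W x)
    (hmaj : ∃ C : ℝ, 1 ≤ C ∧ ∀ r : ℝ, 0 < r → ∃ (D : ℝ) (E : ℂ → ℂ),
      IsSectorMajorant W (h / 2) r C D E) : PhragmenLindelofProperty W h := by
  obtain ⟨C, hC, hmaj⟩ := hmaj
  intro r' hr'
  have hC0 : 0 < C := by linarith
  obtain ⟨D, E, hE⟩ := hmaj (r' / C) (by positivity)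
  have hrr : r' / C ≤ r' := div_le_self hr'.le hC
  refine ⟨r' / C, by positivity, hrr, exp |D|, Real.one_le_exp (abs_nonneg _), ?_⟩
  intro A hA G hG ⟨B, hB⟩ K hK z
  obtain ⟨a, ha, -⟩ := hA 0
  have hK0 : 0 ≤ K := nonneg_of_norm_le_mul_exp (hK a ha 0)
  rcases eq_or_ne z 0 with rfl | hz
  · refine (hK a ha 0).trans ?_
    have hW0 := hW 0 le_rfl
    have : (1 : ℝ) ≤ exp |D| := Real.one_le_exp (abs_nonneg _)
    simp only [mul_zero, Complex.zero_im, norm_zero]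
    calc K * exp (0 ^ 2 / 2 + r' / C * W 0) ≤ K * exp (r' * W 0) := by
          gcongr; norm_num; gcongr
      _ ≤ K * exp |D| * exp (r' * W 0) := by
          gcongr; exact le_mul_of_one_le_right hK0 this
  · obtain ⟨a, ha, b, hb, haθ, hθb, hab, hba⟩ := hA (Complex.log z).im
    have hray : ∀ c ∈ A, ∀ ζ : ℂ, ζ.im = c →
        ‖G (Complex.exp ζ)‖ ≤ K * exp (r' / C * W (exp ζ.re)) := by
      intro c hc ζ hζ
      have := hK c hc (Complex.exp ζ)
      rw [im_exp_rotate, hζ] at this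
      simpa [Complex.norm_exp] using this
    have key := norm_le_of_sector hE hW (by positivity) (by linarith) hG hB
      (m := (a + b) / 2) (h := (b - a) / 2) (K := K) (by linarith) (by linarith)
      (fun ζ hζ => hray a ha ζ (by rw [hζ]; ring)) (fun ζ hζ => hray b hb ζ (by rw [hζ]; ring))
      (Complex.log z) (by rw [abs_le]; constructor <;> linarith)
    rw [Complex.exp_log hz, Complex.log_re, Real.exp_log (norm_pos_iff.2 hz),
      mul_div_cancel₀ _ hC0.ne'] at key
    refine key.trans ?_
    rw [mul_assoc, ← Real.exp_add, add_comm |D|]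
    gcongr
    exact le_abs_self D

/-- The majorant is a multiple of `z^γ`, whose real part `|z|^γ cos(γ arg z)` lies between
`cos(γh)|z|^γ` and `|z|^γ` on the sector. -/
theorem isSectorMajorant_rpow {γ h r : ℝ} (hγ : 0 < γ) (hh : 0 < h) (hγh : γ * h < pi / 2)
    (hr : 0 < r) : IsSectorMajorant (fun x => x ^ γ) h r (1 / Real.cos (γ * h)) 0
      (fun ζ => ((1 / Real.cos (γ * h) * r : ℝ) : ℂ) * Complex.exp (γ * ζ)) := by
  have hc : 0 < Real.cos (γ * h) :=
    Real.cos_pos_of_mem_Ioo ⟨by nlinarith [Real.pi_pos, mul_pos hγ hh], hγh⟩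
  have hre : ∀ ζ : ℂ, (((1 / Real.cos (γ * h) * r : ℝ) : ℂ) * Complex.exp (γ * ζ)).re =
      1 / Real.cos (γ * h) * r * (exp (γ * ζ.re) * Real.cos (γ * ζ.im)) := by
    intro ζ
    rw [Complex.re_ofReal_mul, Complex.exp_re]; simp
  have hpow : ∀ ζ : ℂ, (exp ζ.re) ^ γ = exp (γ * ζ.re) := fun ζ => by
    rw [← Real.exp_mul, mul_comm]
  refine ⟨fun ζ _ => by fun_prop, fun ζ hζ => ?_, fun ζ hζ => ?_⟩
  · rw [hre]
    simp only [hpow]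
    have h1 : Real.cos (γ * h) ≤ Real.cos (γ * ζ.im) := by
      rw [← Real.cos_abs (γ * ζ.im)]
      apply Real.cos_le_cos_of_nonneg_of_le_pi (abs_nonneg _)
      · linarith [Real.pi_pos]
      · rw [abs_mul, abs_of_pos hγ]; gcongr
    calc r * exp (γ * ζ.re) = 1 / Real.cos (γ * h) * r * (exp (γ * ζ.re) * Real.cos (γ * h)) := by
          field_simp
      _ ≤ _ := by gcongr
  · rw [hre]
    simp only [hpow, add_zero]
    gcongr
    exact mul_le_of_le_one_right (Real.exp_pos _).le (Real.cos_le_one _)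

theorem phragmenLindelofProperty_rpow {γ h : ℝ} (hγ : 0 < γ) (hγ2 : γ ≤ 2) (hh : 0 < h)
    (hh2 : h < pi / 2) : PhragmenLindelofProperty (fun x => x ^ γ) h := by
  have hγh : γ * (h / 2) < pi / 2 := by nlinarith
  have hc : 0 < Real.cos (γ * (h / 2)) :=
    Real.cos_pos_of_mem_Ioo ⟨by nlinarith [Real.pi_pos, mul_pos hγ hh], hγh⟩
  refine phragmenLindelofProperty_of_majorant hh2 (fun x hx => by positivity)
    ⟨1 / Real.cos (γ * (h / 2)), ?_, fun r hr =>
      ⟨0, _, isSectorMajorant_rpow hγ (by linarith) hγh hr⟩⟩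
  rw [le_div_iff₀ hc, one_mul]; exact Real.cos_le_one _

theorem abs_sin_le_sin {x ε : ℝ} (hε : ε ≤ pi / 2) (hx : |x| ≤ ε) : |Real.sin x| ≤ Real.sin ε := by
  rw [abs_le] at hx
  have h1 : Real.sin x ≤ Real.sin ε := Real.sin_le_sin_of_le_of_le_pi_div_two (by linarith) hε hx.2
  have h2 : Real.sin (-x) ≤ Real.sin ε :=
    Real.sin_le_sin_of_le_of_le_pi_div_two (by linarith) hε (by linarith)
  rw [Real.sin_neg] at h2
  rw [abs_le]; constructor <;> linarith

/-- The critical case of order two and right-angled sectors. -/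
theorem phragmenLindelofProperty_sq : PhragmenLindelofProperty (fun x => x ^ (2 : ℝ)) (pi / 2) := by
  intro δ hδ
  have hpi := Real.pi_pos
  -- For half-opening `π/4` the majorant `z²` fails, since `cos(2·π/4) = 0`. Removing an angle `ε`
  -- at each side leaves `cos(2(π/4 - ε)) = sin 2ε > 0`; in the removed parts the hypothesis still
  -- gives `exp((sin²ε/2 + r)|z|²)`.
  set ε := min δ (pi / 8) with hε
  have hε0 : 0 < ε := lt_min hδ (by linarith)
  have hεδ : ε ≤ δ := min_le_left _ _
  have hεpi : ε ≤ pi / 8 := min_le_right _ _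
  have hs2 : 0 < Real.sin (2 * ε) := Real.sin_pos_of_pos_of_lt_pi (by linarith) (by linarith)
  have hs : 0 < Real.sin ε := Real.sin_pos_of_pos_of_lt_pi (by linarith) (by linarith)
  have hsle : Real.sin ε ≤ ε := Real.sin_le hε0.le
  have hcos : 1 / 2 ≤ Real.cos ε := by
    rw [← Real.cos_pi_div_three]
    exact Real.cos_le_cos_of_nonneg_of_le_pi hε0.le (by linarith) (by linarith)
  set r := δ * Real.sin (2 * ε) / 2 with hr
  have hr0 : 0 < r := by positivity
  have hs21 : Real.sin (2 * ε) ≤ 1 := Real.sin_le_one _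
  -- The loss `1/sin 2ε` is affordable because `sin²ε` is of second order in `ε` and `sin 2ε` of
  -- first order; `r` takes up half of the budget.
  have hkey : Real.sin ε ^ 2 / 2 + r ≤ δ * Real.sin (2 * ε) := by
    have : Real.sin ε ^ 2 ≤ δ * Real.sin (2 * ε) := by
      rw [Real.sin_two_mul]
      have h1 : Real.sin ε ≤ δ := hsle.trans hεδ
      have h2 : δ * Real.sin ε ≤ δ * (2 * Real.sin ε * Real.cos ε) := by
        gcongr; nlinarith
      nlinarith
    rw [hr]; linarith
  have hrδ : r ≤ δ := by rw [hr]; nlinarith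
  refine ⟨r, hr0, hrδ, 1, le_rfl, ?_⟩
  intro A hA G hG ⟨B, hB⟩ K hK z
  obtain ⟨a, ha, -⟩ := hA 0
  have hK0 : 0 ≤ K := nonneg_of_norm_le_mul_exp (hK a ha 0)
  rw [mul_one]
  rcases eq_or_ne z 0 with rfl | hz
  · refine (hK a ha 0).trans ?_
    norm_num
  · have hnear : ∀ c ∈ A, ∀ ζ : ℂ, |ζ.im - c| ≤ ε →
        ‖G (Complex.exp ζ)‖ ≤ K * exp ((Real.sin ε ^ 2 / 2 + r) * (exp ζ.re) ^ (2 : ℝ)) := by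
      intro c hc ζ hζ
      refine (hK c hc (Complex.exp ζ)).trans ?_
      have h1 := abs_sin_le_sin (by linarith) hζ
      have h2 : Real.sin (ζ.im - c) ^ 2 ≤ Real.sin ε ^ 2 := by
        rw [← sq_abs]; gcongr
      rw [im_exp_rotate, Complex.norm_exp]
      gcongr
      simp only [Real.rpow_two]
      rw [mul_pow]
      nlinarith [sq_nonneg (exp ζ.re)]
    obtain ⟨a, ha, b, hb, haθ, hθb, hab, hba⟩ := hA (Complex.log z).im
    have hlog : Complex.exp (Complex.log z) = z := Complex.exp_log hz
    have hre : exp (Complex.log z).re = ‖z‖ := by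
      rw [Complex.log_re, Real.exp_log (norm_pos_iff.2 hz)]
    have hclose : ∀ c ∈ A, |(Complex.log z).im - c| ≤ ε →
        ‖G z‖ ≤ K * exp (δ * ‖z‖ ^ (2 : ℝ)) := by
      intro c hc hd
      have := hnear c hc _ hd
      rw [hlog, hre] at this
      refine this.trans ?_
      gcongr
      nlinarith
    by_cases h1 : |(Complex.log z).im - a| ≤ ε
    · exact hclose a ha h1
    by_cases h2 : |(Complex.log z).im - b| ≤ ε
    · exact hclose b hb h2
    rw [abs_of_nonneg (by linarith)] at h1
    rw [abs_of_nonpos (by linarith)] at h2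
    push Not at h1 h2
    have hr1 : 0 < Real.sin ε ^ 2 / 2 + r := by positivity
    -- Here the direction is more than `ε` away from both rays, so the shrunken sector is
    -- nondegenerate and its edges lie in the region covered by `hnear`.
    have hmaj := isSectorMajorant_rpow (γ := 2) (h := pi / 4 - ε) (r := Real.sin ε ^ 2 / 2 + r)
      (by norm_num) (by linarith) (by linarith) hr1
    have key := norm_le_of_sector hmaj (fun x hx => by positivity) hr1.le (by linarith) hG hB
      (m := (a + b) / 2) (h := (b - a) / 2 - ε) (K := K) (by linarith) (by linarith)
      (fun ζ hζ => hnear a ha ζ (by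
        rw [hζ, show (a + b) / 2 - ((b - a) / 2 - ε) - a = ε by ring, abs_of_pos hε0]))
      (fun ζ hζ => hnear b hb ζ (by
        rw [hζ, show (a + b) / 2 + ((b - a) / 2 - ε) - b = -ε by ring, abs_neg, abs_of_pos hε0]))
      (Complex.log z) (by rw [abs_le]; constructor <;> linarith)
    rw [hlog, hre] at key
    refine key.trans ?_
    have hcs : Real.cos (2 * (pi / 4 - ε)) = Real.sin (2 * ε) := by
      rw [← Real.cos_pi_div_two_sub]; congr 1; ring
    rw [hcs, add_zero]
    gcongr
    rw [one_div, inv_mul_le_iff₀ hs2, mul_comm]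
    exact hkey

/-! ### A holomorphic majorant for the logarithmic growth -/

/-- The growth function `(log ⟨x⟩)^q`. -/
def logGrowth (q : ℝ) (x : ℝ) : ℝ := Real.log (sqrt (1 + x ^ 2)) ^ q

theorem one_le_sqrt_one_add_sq (x : ℝ) : 1 ≤ sqrt (1 + x ^ 2) := by
  rw [Real.one_le_sqrt]; nlinarith [sq_nonneg x]

theorem log_sqrt_nonneg (x : ℝ) : 0 ≤ Real.log (sqrt (1 + x ^ 2)) :=
  Real.log_nonneg (one_le_sqrt_one_add_sq x)

theorem logGrowth_nonneg (q x : ℝ) : 0 ≤ logGrowth q x :=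
  Real.rpow_nonneg (log_sqrt_nonneg x) q

theorem add_rpow_le {a b q : ℝ} (ha : 0 ≤ a) (hb : 0 ≤ b) (hq : 0 ≤ q) :
    (a + b) ^ q ≤ 2 ^ q * (a ^ q + b ^ q) := by
  have ha' := Real.rpow_nonneg ha q
  have hb' := Real.rpow_nonneg hb q
  rcases le_total a b with h | h
  · calc (a + b) ^ q ≤ (2 * b) ^ q := by gcongr; linarith
      _ = 2 ^ q * b ^ q := Real.mul_rpow (by norm_num) hb
      _ ≤ _ := by gcongr; linarith
  · calc (a + b) ^ q ≤ (2 * a) ^ q := by gcongr; linarith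
      _ = 2 ^ q * a ^ q := Real.mul_rpow (by norm_num) ha
      _ ≤ _ := by gcongr; linarith

/-- Jordan's inequality applied to `|sin arg v| = |Im v|/‖v‖`. -/
theorem abs_arg_le_of_re_pos {v : ℂ} (hv : 0 < v.re) : |v.arg| ≤ pi / 2 * (|v.im| / v.re) := by
  have hv0 : v ≠ 0 := by rintro rfl; simp at hv
  have hn : 0 < ‖v‖ := norm_pos_iff.2 hv0
  have h1 : |v.arg| ≤ pi / 2 := Complex.abs_arg_le_pi_div_two_iff.2 hv.le
  have h2 : 2 / pi * |v.arg| ≤ Real.sin |v.arg| := Real.mul_le_sin (abs_nonneg _) h1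
  have h3 : Real.sin |v.arg| = |v.im| / ‖v‖ := by
    rcases le_total 0 v.arg with h | h
    · rw [abs_of_nonneg h, Complex.sin_arg, abs_of_nonneg (Complex.arg_nonneg_iff.1 h)]
    · rw [abs_of_nonpos h, Real.sin_neg, Complex.sin_arg]
      rcases h.eq_or_lt with h | h
      · rw [Complex.arg_eq_zero_iff] at h; simp [h.2]
      · rw [abs_of_neg (Complex.arg_neg_iff.1 h)]; ring
  have h4 : |v.im| / ‖v‖ ≤ |v.im| / v.re := by
    gcongr; exact Complex.re_le_norm v
  have h5 : 2 / pi * |v.arg| ≤ |v.im| / v.re := by linarith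
  calc |v.arg| = pi / 2 * (2 / pi * |v.arg|) := by field_simp
    _ ≤ _ := by gcongr

/-- The majorant is `2r (log(e^{3q} + z))^q`. The shift `e^{3q}` forces the real part of the
logarithm above `3q` while its imaginary part stays within `π/2`; hence the `q`-th power has
argument at most `π²/12 ≤ π/3` and cosine at least `1/2`, which the factor `2` compensates. As `Re z
≥ 0`, the shift also makes `|e^{3q} + z| ≥ ⟨z⟩`. -/
theorem isSectorMajorant_logGrowth {q h r : ℝ} (hq : 1 < q) (hh : h < pi / 2) (hr : 0 < r) :
    IsSectorMajorant (logGrowth q) h r (2 ^ (q + 1)) (2 ^ (q + 1) * r * (3 * q + 3) ^ q)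
      (fun ζ => (2 * r : ℝ) * (Complex.log (exp (3 * q) + Complex.exp ζ)) ^ (q : ℂ)) := by
  have hpi := Real.pi_pos
  have hpi4 := Real.pi_lt_d2
  have hA : 1 ≤ exp (3 * q) := Real.one_le_exp (by linarith)
  have hA0 := Real.exp_pos (3 * q)
  have hre : ∀ ζ : ℂ, |ζ.im| ≤ h → 0 ≤ (Complex.exp ζ).re := by
    intro ζ hζ
    rw [Complex.exp_re]
    have := Real.cos_nonneg_of_mem_Icc (x := ζ.im)
      ⟨by linarith [(abs_le.1 hζ).1], by linarith [(abs_le.1 hζ).2]⟩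
    positivity
  have hw : ∀ ζ : ℂ, |ζ.im| ≤ h → exp (3 * q) ≤ ((exp (3 * q) : ℂ) + Complex.exp ζ).re := by
    intro ζ hζ
    have := hre ζ hζ
    have e : ((Complex.exp ((3 * q : ℝ) : ℂ)) + Complex.exp ζ).re =
      exp (3 * q) + (Complex.exp ζ).re := by
      rw [Complex.add_re, ← Complex.ofReal_exp, Complex.ofReal_re]
    rw [Complex.ofReal_exp, e]; linarith
  have hv : ∀ ζ : ℂ, |ζ.im| ≤ h →
      3 * q ≤ (Complex.log ((exp (3 * q) : ℂ) + Complex.exp ζ)).re := by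
    intro ζ hζ
    rw [Complex.log_re]
    have := (hw ζ hζ).trans (Complex.re_le_norm _)
    calc 3 * q = Real.log (exp (3 * q)) := (Real.log_exp _).symm
      _ ≤ _ := Real.log_le_log hA0 this
  have hlow : ∀ ζ : ℂ, |ζ.im| ≤ h → Real.log (sqrt (1 + exp ζ.re ^ 2)) ≤
      (Complex.log ((exp (3 * q) : ℂ) + Complex.exp ζ)).re := by
    intro ζ hζ
    rw [Complex.log_re]
    apply Real.log_le_log (by linarith [one_le_sqrt_one_add_sq (exp ζ.re)])
    apply Real.sqrt_le_iff.2 ⟨norm_nonneg _, ?_⟩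
    rw [← Complex.normSq_eq_norm_sq, Complex.normSq_add, Complex.normSq_ofReal,
      Complex.normSq_eq_norm_sq (Complex.exp ζ), Complex.norm_exp]
    have : (((exp (3 * q) : ℝ) : ℂ) * (starRingEnd ℂ) (Complex.exp ζ)).re =
        exp (3 * q) * (Complex.exp ζ).re := by
      rw [Complex.re_ofReal_mul, Complex.conj_re]
    rw [this]
    have := hre ζ hζ
    nlinarith [mul_nonneg hA0.le this]
  have harg : ∀ ζ : ℂ, |ζ.im| ≤ h →
      |(Complex.log ((exp (3 * q) : ℂ) + Complex.exp ζ)).im| ≤ pi / 2 := by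
    intro ζ hζ
    rw [Complex.log_im]
    exact Complex.abs_arg_le_pi_div_two_iff.2 (by linarith [hw ζ hζ])
  have hup : ∀ ζ : ℂ, |ζ.im| ≤ h → ‖Complex.log ((exp (3 * q) : ℂ) + Complex.exp ζ)‖ ≤
      Real.log (sqrt (1 + exp ζ.re ^ 2)) + (3 * q + 3) := by
    intro ζ hζ
    refine (Complex.norm_le_abs_re_add_abs_im _).trans ?_
    have h1 := harg ζ hζ
    rw [abs_of_nonneg (by linarith [hv ζ hζ]), Complex.log_re]
    have h2 : ‖(exp (3 * q) : ℂ) + Complex.exp ζ‖ ≤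
        exp (3 * q) * (exp 1 * sqrt (1 + exp ζ.re ^ 2)) := by
      refine (norm_add_le _ _).trans ?_
      rw [Complex.norm_real, Complex.norm_exp, Real.norm_eq_abs, Real.abs_exp]
      have h3 : exp ζ.re ≤ sqrt (1 + exp ζ.re ^ 2) := Real.le_sqrt_of_sq_le (by linarith)
      have h4 := one_le_sqrt_one_add_sq (exp ζ.re)
      have h5 : 2 ≤ exp 1 := by linarith [Real.add_one_le_exp 1]
      have h6 := Real.exp_pos ζ.re
      calc exp (3 * q) + exp ζ.re ≤ exp (3 * q) * (1 + exp ζ.re) := by nlinarith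
        _ ≤ exp (3 * q) * (2 * sqrt (1 + exp ζ.re ^ 2)) := by gcongr; linarith
        _ ≤ _ := by gcongr
    have h3 : 0 < ‖(exp (3 * q) : ℂ) + Complex.exp ζ‖ := by
      have := (hw ζ hζ).trans (Complex.re_le_norm _); linarith
    have h4 := Real.log_le_log h3 h2
    have h5 : 0 < sqrt (1 + exp ζ.re ^ 2) := by linarith [one_le_sqrt_one_add_sq (exp ζ.re)]
    rw [Real.log_mul (by positivity) (by positivity), Real.log_exp,
      Real.log_mul (by positivity) (by positivity), Real.log_exp] at h4
    linarith
  have hcpow : ∀ ζ : ℂ, |ζ.im| ≤ h →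
      (((2 * r : ℝ) : ℂ) * (Complex.log ((exp (3 * q) : ℂ) + Complex.exp ζ)) ^ (q : ℂ)).re =
      2 * r * (‖Complex.log ((exp (3 * q) : ℂ) + Complex.exp ζ)‖ ^ q *
        Real.cos (q * (Complex.log ((exp (3 * q) : ℂ) + Complex.exp ζ)).arg)) := by
    intro ζ hζ
    set v := Complex.log ((exp (3 * q) : ℂ) + Complex.exp ζ) with hvdef
    have hv0 : v ≠ 0 := by
      intro h0; have := hv ζ hζ; rw [← hvdef, h0] at this; simp at this; linarith
    rw [Complex.re_ofReal_mul, Complex.cpow_def_of_ne_zero hv0, Complex.exp_re]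
    have e1 : (Complex.log v * (q : ℂ)).re = Real.log ‖v‖ * q := by
      rw [mul_comm, Complex.re_ofReal_mul, Complex.log_re, mul_comm]
    have e2 : (Complex.log v * (q : ℂ)).im = q * v.arg := by
      rw [mul_comm, Complex.im_ofReal_mul, Complex.log_im]
    rw [e1, e2, Real.rpow_def_of_pos (norm_pos_iff.2 hv0)]
  refine ⟨fun ζ hζ => ?_, fun ζ hζ => ?_, fun ζ hζ => ?_⟩
  · have h1 : ((exp (3 * q) : ℂ) + Complex.exp ζ) ∈ Complex.slitPlane :=
      Or.inl (by linarith [hw ζ hζ])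
    have h2 : Complex.log ((exp (3 * q) : ℂ) + Complex.exp ζ) ∈ Complex.slitPlane :=
      Or.inl (by linarith [hv ζ hζ])
    have h3 : DifferentiableAt ℂ (fun ζ => Complex.log ((exp (3 * q) : ℂ) + Complex.exp ζ)) ζ :=
      DifferentiableAt.clog (by fun_prop) h1
    exact (h3.cpow (differentiableAt_const _) h2).const_mul _
  · rw [hcpow ζ hζ]
    set v := Complex.log ((exp (3 * q) : ℂ) + Complex.exp ζ) with hvdef
    have hv1 : 3 * q ≤ v.re := hv ζ hζ
    have hv2 : |v.im| ≤ pi / 2 := harg ζ hζ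
    have hcos : 1 / 2 ≤ Real.cos (q * v.arg) := by
      rw [← Real.cos_pi_div_three, ← Real.cos_abs (q * v.arg)]
      apply Real.cos_le_cos_of_nonneg_of_le_pi (abs_nonneg _) (by linarith)
      have h1 := abs_arg_le_of_re_pos (v := v) (by linarith)
      rw [abs_mul, abs_of_pos (by linarith : 0 < q)]
      have h2 : |v.im| / v.re ≤ pi / 2 / (3 * q) := by gcongr
      calc q * |v.arg| ≤ q * (pi / 2 * (pi / 2 / (3 * q))) := by
            gcongr; exact h1.trans (by gcongr)
        _ = pi * (pi / 12) := by field_simp; ring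
        _ ≤ pi * (1 / 3) := mul_le_mul_of_nonneg_left (by linarith) hpi.le
        _ = pi / 3 := by ring
    have hW : logGrowth q (exp ζ.re) ≤ ‖v‖ ^ q := by
      unfold logGrowth
      have := log_sqrt_nonneg (exp ζ.re)
      gcongr
      exact (hlow ζ hζ).trans (Complex.re_le_norm v)
    have hWn := logGrowth_nonneg q (exp ζ.re)
    calc r * logGrowth q (exp ζ.re) = 2 * r * (logGrowth q (exp ζ.re) * (1 / 2)) := by ring
      _ ≤ _ := by gcongr
  · rw [hcpow ζ hζ]
    set v := Complex.log ((exp (3 * q) : ℂ) + Complex.exp ζ) with hvdef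
    have h1 : ‖v‖ ^ q ≤ 2 ^ q * (logGrowth q (exp ζ.re) + (3 * q + 3) ^ q) := by
      unfold logGrowth
      have := log_sqrt_nonneg (exp ζ.re)
      refine le_trans ?_ (add_rpow_le this (by linarith) (by linarith))
      gcongr
      exact hup ζ hζ
    have h2 : (2 : ℝ) ^ (q + 1) = 2 ^ q * 2 := by rw [Real.rpow_add (by norm_num), Real.rpow_one]
    calc 2 * r * (‖v‖ ^ q * Real.cos (q * v.arg)) ≤ 2 * r * (‖v‖ ^ q * 1) := by
          gcongr; exact Real.cos_le_one _
      _ ≤ 2 * r * ((2 ^ q * (logGrowth q (exp ζ.re) + (3 * q + 3) ^ q)) * 1) := by gcongr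
      _ = _ := by rw [h2]; ring

theorem phragmenLindelofProperty_logGrowth {q h : ℝ} (hq : 1 < q) (hh : h < pi / 2) :
    PhragmenLindelofProperty (logGrowth q) h :=
  phragmenLindelofProperty_of_majorant hh (fun x _ => logGrowth_nonneg q x)
    ⟨2 ^ (q + 1), Real.one_le_rpow (by norm_num) (by linarith), fun _ hr =>
      ⟨_, _, isSectorMajorant_logGrowth hq (by linarith [Real.pi_pos]) hr⟩⟩

/-! ### Regularity of the growth functions -/

/-- Regularity of the growth functions `W` with `ω_{d,r,s}(x) = e^{-r W(|x|)}`. -/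
structure IsGrowth (W : ℝ → ℝ) : Prop where
  continuous : Continuous W
  nonneg : ∀ x, 0 ≤ x → 0 ≤ W x
  mono : ∀ x y, 0 ≤ x → x ≤ y → W x ≤ W y
  add_le : ∃ C : ℝ, 0 ≤ C ∧ ∀ a b, 0 ≤ a → 0 ≤ b → W (a + b) ≤ C * (W a + W b + 1)
  le_quadratic : ∃ C : ℝ, 0 ≤ C ∧ ∀ a, 0 ≤ a → W a ≤ C * (1 + a ^ 2)

theorem isGrowth_rpow {γ : ℝ} (hγ : 0 < γ) (hγ2 : γ ≤ 2) : IsGrowth (fun x => x ^ γ) where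
  continuous := Real.continuous_rpow_const hγ.le
  nonneg := fun x hx => by positivity
  mono := fun x y hx hxy => by gcongr
  add_le := ⟨2 ^ γ, by positivity, fun a b ha hb => (add_rpow_le ha hb hγ.le).trans 
    (mul_le_mul_of_nonneg_left (by simp) (by positivity))⟩
  le_quadratic := ⟨1, zero_le_one, fun a ha => by
    rw [one_mul]
    rcases le_total a 1 with h | h
    · have := Real.rpow_le_one ha h hγ.le
      nlinarith [sq_nonneg a]
    · have := Real.rpow_le_rpow_of_exponent_le h hγ2
      rw [Real.rpow_two] at this
      linarith⟩

theorem isGrowth_logGrowth {q : ℝ} (hq : 1 < q) : IsGrowth (logGrowth q) where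
  continuous := by
    unfold logGrowth
    refine Continuous.rpow_const ?_ (fun _ => Or.inr (by linarith))
    exact Continuous.log (by fun_prop) fun x => by linarith [one_le_sqrt_one_add_sq x]
  nonneg := fun x _ => logGrowth_nonneg q x
  mono := fun x y hx hxy => by
    unfold logGrowth
    have := one_le_sqrt_one_add_sq x
    have := log_sqrt_nonneg x
    gcongr
  add_le := by
    refine ⟨2 ^ q * 2 ^ q, by positivity, fun a b ha hb => ?_⟩
    unfold logGrowth
    have ha' := log_sqrt_nonneg a
    have hb' := log_sqrt_nonneg b
    have hA := one_le_sqrt_one_add_sq a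
    have hB := one_le_sqrt_one_add_sq b
    have h1 : Real.log (sqrt (1 + (a + b) ^ 2)) ≤
        (Real.log (sqrt (1 + a ^ 2)) + Real.log (sqrt (1 + b ^ 2))) + 1 := by
      -- Peetre-type inequality `⟨a+b⟩ ≤ 2⟨a⟩⟨b⟩`, with `e` in place of `2` so that the logarithm of
      -- the constant is `1`.
      have h2 : sqrt (1 + (a + b) ^ 2) ≤ sqrt (1 + a ^ 2) * sqrt (1 + b ^ 2) * exp 1 := by
        have h5 : 2 ≤ exp 1 := by linarith [Real.add_one_le_exp 1]
        apply Real.sqrt_le_iff.2 ⟨by positivity, ?_⟩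
        rw [mul_pow, mul_pow, Real.sq_sqrt (by positivity), Real.sq_sqrt (by positivity)]
        have h6 : (4 : ℝ) ≤ exp 1 ^ 2 := by nlinarith
        calc 1 + (a + b) ^ 2 ≤ (1 + a ^ 2) * (1 + b ^ 2) * 4 := by
              nlinarith [sq_nonneg (a - b), sq_nonneg (a * b), sq_nonneg a, sq_nonneg b]
          _ ≤ _ := by gcongr
      have h3 := Real.log_le_log (by linarith [one_le_sqrt_one_add_sq (a + b)]) h2
      rwa [Real.log_mul (by positivity) (by positivity),
        Real.log_mul (by positivity) (by positivity), Real.log_exp] at h3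
    have hq0 : 0 ≤ q := by linarith
    have h1q : (1 : ℝ) ≤ 2 ^ q := Real.one_le_rpow (by norm_num) hq0
    calc Real.log (sqrt (1 + (a + b) ^ 2)) ^ q
        ≤ ((Real.log (sqrt (1 + a ^ 2)) + Real.log (sqrt (1 + b ^ 2))) + 1) ^ q := by
          have := log_sqrt_nonneg (a + b)
          gcongr
      _ ≤ 2 ^ q * ((Real.log (sqrt (1 + a ^ 2)) + Real.log (sqrt (1 + b ^ 2))) ^ q + 1 ^ q) :=
          add_rpow_le (by positivity) zero_le_one hq0
      _ ≤ 2 ^ q * (2 ^ q * (Real.log (sqrt (1 + a ^ 2)) ^ q + Real.log (sqrt (1 + b ^ 2)) ^ q)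
            + 2 ^ q * 1) := by
          rw [Real.one_rpow]
          gcongr
          · exact add_rpow_le ha' hb' hq0
          · linarith
      _ = _ := by ring
  le_quadratic := by
    have hq0 : 0 < q := by linarith
    refine ⟨q ^ q, by positivity, fun a ha => ?_⟩
    unfold logGrowth
    have h1 := one_le_sqrt_one_add_sq a
    -- The exponent `1/q` makes the `q`-th power linear in `⟨a⟩`.
    have h2 := Real.log_le_rpow_div (x := sqrt (1 + a ^ 2)) (ε := 1 / q) (by linarith)
      (by positivity)
    have h3 : sqrt (1 + a ^ 2) ≤ 1 + a ^ 2 := by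
      apply Real.sqrt_le_iff.2 ⟨by positivity, ?_⟩
      nlinarith [sq_nonneg a, sq_nonneg (a ^ 2)]
    calc Real.log (sqrt (1 + a ^ 2)) ^ q ≤ (sqrt (1 + a ^ 2) ^ (1 / q) / (1 / q)) ^ q := by
          have := log_sqrt_nonneg a
          gcongr
      _ = q ^ q * sqrt (1 + a ^ 2) := by
          rw [div_div_eq_mul_div, div_one, Real.mul_rpow (by positivity) hq0.le,
            ← Real.rpow_mul (by positivity), one_div_mul_cancel hq0.ne', Real.rpow_one, mul_comm]
      _ ≤ _ := by gcongr

/-! ### Matching sequence weights with growth functions -/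

/-- Hermite functions are controlled by the sequence weight and the growth function. -/
def HermiteBound (d : ℕ) (s : RFlat) (W : ℝ → ℝ) : Prop :=
  ∀ r : ℝ, 0 < r → ∃ R : ℝ, 0 < R ∧ ∃ M : ℝ, 0 ≤ M ∧
    ∀ (α : Fin d → ℕ) (x : EuclideanSpace ℝ (Fin d)),
      |hermiteFun α x| * exp (‖x‖ ^ 2 / 2) ≤ M * seqWeight R s α * exp (r * W ‖x‖)

/-- Cauchy's estimates for a power series of growth `e^{rW}` give coefficients that are controlled
by the sequence weight. -/
def CauchyBound (d : ℕ) (s : RFlat) (W : ℝ → ℝ) : Prop :=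
  ∀ R : ℝ, 0 < R → ∃ r : ℝ, 0 < r ∧ ∃ M : ℝ, ∀ α : Fin d → ℕ, ∃ ρ : Fin d → ℝ, (∀ j, 0 < ρ j) ∧
    (∏ j, (sqrt ((α j)! : ℝ) * exp (r * W (ρ j)) / ρ j ^ α j)) * seqWeight R s α ≤ M

theorem abs_coord_le_norm {d : ℕ} (x : EuclideanSpace ℝ (Fin d)) (j : Fin d) : |x j| ≤ ‖x‖ := by
  simpa using PiLp.norm_apply_le x j

theorem exp_norm_sq_div_two {d : ℕ} (x : EuclideanSpace ℝ (Fin d)) :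
    exp (‖x‖ ^ 2 / 2) = ∏ j, exp (x j ^ 2 / 2) := by
  have := exp_norm_sq (1 / 2) x
  simpa only [one_div, inv_mul_eq_div] using this

theorem abs_hermiteFun_mul_exp_le {d : ℕ} {α : Fin d → ℕ} {x : EuclideanSpace ℝ (Fin d)}
    {b : Fin d → ℝ} (h : ∀ j, |hermiteFun1 (α j) (x j)| * exp (x j ^ 2 / 2) ≤ b j) :
    |hermiteFun α x| * exp (‖x‖ ^ 2 / 2) ≤ ∏ j, b j := by
  unfold hermiteFun
  rw [Finset.abs_prod, exp_norm_sq_div_two, ← Finset.prod_mul_distrib]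
  exact Finset.prod_le_prod (fun _ _ => by positivity) fun j _ => h j

theorem exists_abs_hermiteFun_le_rpow (d : ℕ) {γ r : ℝ} (hγ : 0 < γ) (hγ2 : γ ≤ 2) (hr : 0 < r) :
    ∃ A : ℝ, 1 ≤ A ∧ ∀ (α : Fin d → ℕ) (x : EuclideanSpace ℝ (Fin d)),
      |hermiteFun α x| * exp (‖x‖ ^ 2 / 2) ≤ 2 ^ d * (A ^ (∑ j, α j) *
        ((∏ j, (α j)! : ℕ) : ℝ) ^ (1 / γ - 1 / 2)) * exp (r * ‖x‖ ^ γ) := by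
  -- The allowance `r` is shared among the `d` coordinates; `d + 1` keeps the quotient positive when
  -- `d = 0`.
  obtain ⟨A, hA, h⟩ := exists_abs_hermiteFun1_le hγ hγ2 (r := r / (d + 1)) (by positivity)
  refine ⟨A, hA, fun α x => (abs_hermiteFun_mul_exp_le fun j => h (α j) (x j)).trans ?_⟩
  rw [Finset.prod_mul_distrib, Finset.prod_mul_distrib, Finset.prod_mul_distrib,
    Finset.prod_pow_eq_pow_sum, Real.finsetProd_rpow _ _ (fun _ _ => by positivity),
    ← Real.exp_sum, Finset.prod_const, Finset.card_univ, Fintype.card_fin, Nat.cast_prod,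
    mul_assoc (2 ^ d)]
  gcongr
  calc ∑ j, r / (d + 1) * |x j| ^ γ ≤ ∑ _j : Fin d, r / (d + 1) * ‖x‖ ^ γ := by
        gcongr with j; exact abs_coord_le_norm x j
    _ = (d / (d + 1)) * (r * ‖x‖ ^ γ) := by simp; ring
    _ ≤ 1 * (r * ‖x‖ ^ γ) := by
        gcongr
        rw [div_le_one (by positivity)]; linarith
    _ = _ := one_mul _

theorem exists_cauchy_rpow {γ A : ℝ} (hγ : 0 < γ) (hA : 0 < A) :
    ∃ r : ℝ, 0 < r ∧ ∃ M : ℝ, 0 ≤ M ∧ ∀ n : ℕ, ∃ ρ : ℝ, 0 < ρ ∧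
      sqrt (n ! : ℝ) * exp (r * ρ ^ γ) / ρ ^ n * (A ^ n * (n ! : ℝ) ^ (1 / γ - 1 / 2)) ≤ M := by
  -- Chosen so that the radius below equals `A n^{1/γ} e^{1/γ}`, which exactly cancels the weight,
  -- the exponential and the bound `n! ≤ n^n`.
  set r := A ^ (-γ) / (γ * exp 1) with hr
  have hr0 : 0 < r := by positivity
  refine ⟨r, hr0, exp r, (Real.exp_pos _).le, fun n => ?_⟩
  rcases Nat.eq_zero_or_pos n with rfl | hn
  · exact ⟨1, one_pos, by simp⟩
  have hn' : (0 : ℝ) < n := by exact_mod_cast hn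
  have hf : (0 : ℝ) < n ! := by positivity
  -- The minimiser of `e^{rρ^γ}/ρ^n`.
  refine ⟨(n / (γ * r)) ^ (1 / γ), by positivity, ?_⟩
  have e1 : ((n / (γ * r)) ^ (1 / γ)) ^ γ = n / (γ * r) := by
    rw [← Real.rpow_mul (by positivity), one_div_mul_cancel hγ.ne', Real.rpow_one]
  have e2 : sqrt (n ! : ℝ) * (n ! : ℝ) ^ (1 / γ - 1 / 2) = (n ! : ℝ) ^ (1 / γ) := by
    rw [Real.sqrt_eq_rpow, ← Real.rpow_add hf]; congr 1; ring
  have e3 : (n ! : ℝ) ^ (1 / γ) ≤ ((n : ℝ) ^ (1 / γ)) ^ n := by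
    have : (n ! : ℝ) ≤ (n : ℝ) ^ n := by exact_mod_cast Nat.factorial_le_pow n
    calc (n ! : ℝ) ^ (1 / γ) ≤ ((n : ℝ) ^ n) ^ (1 / γ) := by gcongr
      _ = _ := by
        rw [← Real.rpow_natCast, ← Real.rpow_natCast, ← Real.rpow_mul hn'.le,
          ← Real.rpow_mul hn'.le, mul_comm]
  have e4 : exp (r * (n / (γ * r))) = exp (1 / γ) ^ n := by
    rw [← Real.exp_nat_mul]; congr 1; field_simp
  have e5 : A * (n : ℝ) ^ (1 / γ) * exp (1 / γ) = (n / (γ * r)) ^ (1 / γ) := by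
    have : (n : ℝ) / (γ * r) = A ^ γ * n * exp 1 := by
      rw [hr, Real.rpow_neg hA.le]; field_simp
    rw [this, Real.mul_rpow (by positivity) (by positivity),
      Real.mul_rpow (by positivity) (by positivity), ← Real.rpow_mul hA.le,
      mul_one_div_cancel hγ.ne', Real.rpow_one, ← Real.exp_mul, one_mul]
  rw [e1, e4]
  have hρ : 0 < ((n : ℝ) / (γ * r)) ^ (1 / γ) := by positivity
  calc sqrt (n ! : ℝ) * exp (1 / γ) ^ n / ((n / (γ * r)) ^ (1 / γ)) ^ n *
        (A ^ n * (n ! : ℝ) ^ (1 / γ - 1 / 2))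
      = (sqrt (n ! : ℝ) * (n ! : ℝ) ^ (1 / γ - 1 / 2)) * (A ^ n * exp (1 / γ) ^ n) /
        ((n / (γ * r)) ^ (1 / γ)) ^ n := by ring
    _ ≤ ((n : ℝ) ^ (1 / γ)) ^ n * (A ^ n * exp (1 / γ) ^ n) / ((n / (γ * r)) ^ (1 / γ)) ^ n := by
        rw [e2]; gcongr
    _ = (A * (n : ℝ) ^ (1 / γ) * exp (1 / γ)) ^ n / ((n / (γ * r)) ^ (1 / γ)) ^ n := by
        rw [mul_pow, mul_pow]; ring
    _ = 1 := by rw [e5, div_self (by positivity)]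
    _ ≤ exp r := Real.one_le_exp hr0.le

theorem exists_cauchy_rpow_prod (d : ℕ) {γ A : ℝ} (hγ : 0 < γ) (hA : 0 < A) :
    ∃ r : ℝ, 0 < r ∧ ∃ M : ℝ, ∀ α : Fin d → ℕ, ∃ ρ : Fin d → ℝ, (∀ j, 0 < ρ j) ∧
      (∏ j, (sqrt ((α j)! : ℝ) * exp (r * ρ j ^ γ) / ρ j ^ α j)) * (A ^ (∑ j, α j) *
        ((∏ j, (α j)! : ℕ) : ℝ) ^ (1 / γ - 1 / 2)) ≤ M := by
  obtain ⟨r, hr, M, hM, h⟩ := exists_cauchy_rpow hγ hA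
  refine ⟨r, hr, M ^ d, fun α => ?_⟩
  choose ρ hρ hb using h
  refine ⟨fun j => ρ (α j), fun j => hρ _, ?_⟩
  rw [← Finset.prod_pow_eq_pow_sum, Nat.cast_prod,
    ← Real.finsetProd_rpow _ _ (fun _ _ => by positivity), ← Finset.prod_mul_distrib,
    ← Finset.prod_mul_distrib]
  calc _ ≤ ∏ _j : Fin d, M := Finset.prod_le_prod
        (fun j _ => by have := hρ (α j); positivity) fun j _ => hb (α j)
    _ = M ^ d := by simp

theorem seqWeight_half {d : ℕ} (R : ℝ) (α : Fin d → ℕ) :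
    seqWeight R RFlat.half α = exp R ^ (∑ j, α j) := by
  simp only [RFlat.half, seqWeight]
  rw [← Real.exp_nat_mul]
  norm_num
  ring

/-- With `γ = 2σ/(σ+1)` one has `1/γ - 1/2 = 1/(2σ)`; this identity determines the exponent in
`omega` for `♭_σ`. -/
theorem seqWeight_flat {d : ℕ} (R σ : ℝ) (hσ : 0 < σ) (α : Fin d → ℕ) :
    seqWeight R (RFlat.flat σ hσ) α =
      R ^ (∑ j, α j) * ((∏ j, (α j)! : ℕ) : ℝ) ^ (1 / (2 * σ / (σ + 1)) - 1 / 2) := by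
  simp only [seqWeight]
  congr 2
  field_simp; ring

theorem hermiteBound_half (d : ℕ) : HermiteBound d RFlat.half (fun x => x ^ (2 : ℝ)) := by
  intro r hr
  obtain ⟨A, hA, h⟩ := exists_abs_hermiteFun_le_rpow d (γ := 2) (by norm_num) le_rfl hr
  refine ⟨Real.log A + 1, by linarith [Real.log_nonneg hA], 2 ^ d, by positivity, fun α x =>
    (h α x).trans ?_⟩
  rw [seqWeight_half, sub_self, Real.rpow_zero, mul_one, Real.exp_add, Real.exp_log (by linarith)]
  gcongr
  nlinarith [Real.add_one_le_exp 1]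

theorem hermiteBound_flat (d : ℕ) {σ : ℝ} (hσ : 0 < σ) :
    HermiteBound d (RFlat.flat σ hσ) (fun x => x ^ (2 * σ / (σ + 1))) := by
  intro r hr
  obtain ⟨A, hA, h⟩ := exists_abs_hermiteFun_le_rpow d (γ := 2 * σ / (σ + 1)) (by positivity)
    (by rw [div_le_iff₀ (by positivity)]; linarith) hr
  refine ⟨A, by linarith, 2 ^ d, by positivity, fun α x => ?_⟩
  rw [seqWeight_flat]
  exact h α x

theorem cauchyBound_half (d : ℕ) : CauchyBound d RFlat.half (fun x => x ^ (2 : ℝ)) := by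
  intro R hR
  obtain ⟨r, hr, M, h⟩ := exists_cauchy_rpow_prod d (γ := 2) (by norm_num) (Real.exp_pos R)
  refine ⟨r, hr, M, fun α => ?_⟩
  obtain ⟨ρ, hρ, hb⟩ := h α
  refine ⟨ρ, hρ, ?_⟩
  rw [sub_self, Real.rpow_zero, mul_one] at hb
  rw [seqWeight_half]
  exact hb

theorem cauchyBound_flat (d : ℕ) {σ : ℝ} (hσ : 0 < σ) :
    CauchyBound d (RFlat.flat σ hσ) (fun x => x ^ (2 * σ / (σ + 1))) := by
  intro R hR
  obtain ⟨r, hr, M, h⟩ := exists_cauchy_rpow_prod d (γ := 2 * σ / (σ + 1)) (by positivity) hR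
  refine ⟨r, hr, M, fun α => ?_⟩
  obtain ⟨ρ, hρ, hb⟩ := h α
  refine ⟨ρ, hρ, ?_⟩
  rw [seqWeight_flat]
  exact hb

theorem abs_le_sqrt_one_add_sq {y : ℝ} : |y| ≤ sqrt (1 + y ^ 2) :=
  Real.abs_le_sqrt (by linarith)

/-- For real `s < 1/2` the factor `1/√n!` is not needed and is discarded. The free `b` allows the
bracket of a coordinate to be replaced by that of the full vector. -/
theorem abs_hermiteFun1_le_bracket (n : ℕ) (y b : ℝ) (hb : sqrt (1 + y ^ 2) ≤ b) :
    |hermiteFun1 n y| * exp (y ^ 2 / 2) ≤ 2 * (2 * exp 3 * b) ^ n := by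
  have h1 := one_le_sqrt_one_add_sq y
  have hb1 : 1 ≤ b := h1.trans hb
  refine (abs_hermiteFun1_le n y).trans ?_
  have h2 : |y| ^ n / sqrt (n ! : ℝ) ≤ b ^ n := by
    have hf : (1 : ℝ) ≤ sqrt (n ! : ℝ) := by
      rw [Real.one_le_sqrt]; exact_mod_cast Nat.one_le_iff_ne_zero.2 (Nat.factorial_ne_zero n)
    refine (div_le_self (by positivity) hf).trans ?_
    gcongr
    exact abs_le_sqrt_one_add_sq.trans hb
  have h3 : 1 ≤ b ^ n := one_le_pow₀ hb1
  calc (2 * exp 3) ^ n * (1 + |y| ^ n / sqrt (n ! : ℝ)) ≤ (2 * exp 3) ^ n * (b ^ n + b ^ n) := by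
        gcongr
    _ = _ := by rw [mul_pow (2 * exp 3)]; ring

/-- With `n = |α|`, the Hermite functions contribute `exp(n log⟨x⟩)` up to geometric factors. The
exponents `1/(2s)` and `1/(1-2s)` are conjugate, so Young's inequality splits `n log⟨x⟩` into the
exponent of the sequence weight and that of the growth function. -/
theorem hermiteBound_real (d : ℕ) {s : ℝ} (hs : 0 < s) (hs2 : s < 1 / 2) :
    HermiteBound d (RFlat.real s hs) (logGrowth (1 / (1 - 2 * s))) := by
  intro r hr
  set q := 1 / (1 - 2 * s) with hq
  set p := 1 / (2 * s) with hp
  have h2s : 0 < 1 - 2 * s := by linarith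
  have hq0 : 0 < q := by positivity
  have hp1 : 1 < p := by rw [hp, lt_div_iff₀ (by positivity)]; linarith
  have hpq : p.HolderConjugate q := by
    rw [Real.holderConjugate_iff]
    refine ⟨hp1, ?_⟩
    rw [hp, hq]; simp only [one_div, inv_inv]; ring
  have hq1 : 1 < q := hpq.symm.lt
  set B := 2 * exp 3 with hB
  have hB1 : 1 ≤ B := by rw [hB]; linarith [Real.add_one_le_exp 3]
  have hlogB : 0 ≤ Real.log B := Real.log_nonneg hB1
  -- The balance in Young's inequality that puts the coefficient `r` in front of `(log⟨x⟩)^q`.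
  set κ := r ^ (1 / q) with hκ
  have hκ0 : 0 < κ := by positivity
  refine ⟨Real.log B + (κ⁻¹) ^ p, by positivity, 2 ^ d, by positivity, fun α x => ?_⟩
  set b := sqrt (1 + ‖x‖ ^ 2) with hb
  have hb1 : 1 ≤ b := one_le_sqrt_one_add_sq _
  have hL : 0 ≤ Real.log b := log_sqrt_nonneg _
  refine (abs_hermiteFun_mul_exp_le (b := fun j => 2 * (B * b) ^ α j) fun j =>
    abs_hermiteFun1_le_bracket _ _ _ ?_).trans ?_
  · apply Real.sqrt_le_sqrt
    have := abs_coord_le_norm x j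
    have h2 : x j ^ 2 ≤ ‖x‖ ^ 2 := by rw [← sq_abs]; gcongr
    linarith
  rw [Finset.prod_mul_distrib, Finset.prod_pow_eq_pow_sum, Finset.prod_const, Finset.card_univ,
    Fintype.card_fin]
  set n := ∑ j, α j with hn
  have hw : seqWeight (Real.log B + (κ⁻¹) ^ p) (RFlat.real s hs) α =
      exp ((Real.log B + (κ⁻¹) ^ p) * (n : ℝ) ^ p) := by
    simp only [seqWeight, hp, hn]
  rw [hw, logGrowth, ← hb, mul_assoc (2 ^ d), ← Real.exp_add]
  gcongr
  have e : (B * b) ^ n = exp (n * (Real.log B + Real.log b)) := by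
    rw [Real.exp_nat_mul, ← Real.log_mul (by positivity) (by positivity),
      Real.exp_log (by positivity)]
  rw [e]
  apply Real.exp_le_exp.2
  have h1 : (n : ℝ) ≤ (n : ℝ) ^ p := by
    rcases Nat.eq_zero_or_pos n with h0 | h0
    · rw [h0, Nat.cast_zero, Real.zero_rpow (by linarith)]
    · exact Real.self_le_rpow_of_one_le (by exact_mod_cast h0) hp1.le
  have hy := Real.young_inequality_of_nonneg (a := n * κ⁻¹) (b := Real.log b * κ)
    (by positivity) (by positivity) hpq
  have e1 : ((n : ℝ) * κ⁻¹) ^ p = (n : ℝ) ^ p * (κ⁻¹) ^ p :=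
    Real.mul_rpow (by positivity) (by positivity)
  have e2 : (Real.log b * κ) ^ q = Real.log b ^ q * r := by
    rw [Real.mul_rpow hL hκ0.le, hκ, ← Real.rpow_mul hr.le, one_div_mul_cancel hq0.ne',
      Real.rpow_one]
  rw [e1, e2] at hy
  have hy1 : (n : ℝ) ^ p * (κ⁻¹) ^ p / p ≤ (n : ℝ) ^ p * (κ⁻¹) ^ p :=
    div_le_self (by positivity) hp1.le
  have hy2 : Real.log b ^ q * r / q ≤ Real.log b ^ q * r := div_le_self (by positivity) hq1.le
  have hy3 : (n : ℝ) * κ⁻¹ * (Real.log b * κ) = n * Real.log b := by field_simp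
  nlinarith

theorem sqrt_factorial_le_exp {ε : ℝ} (hε : 0 < ε) (n : ℕ) :
    sqrt (n ! : ℝ) ≤ exp (1 / ε * (n : ℝ) ^ (1 + ε)) := by
  rcases Nat.eq_zero_or_pos n with rfl | hn
  · simp; positivity
  have hn' : (0 : ℝ) < n := by exact_mod_cast hn
  have hf : (1 : ℝ) ≤ n ! := by exact_mod_cast Nat.one_le_iff_ne_zero.2 (Nat.factorial_ne_zero n)
  have h1 : sqrt (n ! : ℝ) ≤ n ! := by
    apply Real.sqrt_le_iff.2 ⟨by positivity, by nlinarith⟩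
  have h2 : (n ! : ℝ) ≤ (n : ℝ) ^ n := by exact_mod_cast Nat.factorial_le_pow n
  have h3 : (n : ℝ) ^ n = exp (n * Real.log n) := by
    rw [Real.exp_nat_mul, Real.exp_log hn']
  have h4 := Real.log_le_rpow_div hn'.le hε
  refine (h1.trans h2).trans ?_
  rw [h3, Real.rpow_add hn', Real.rpow_one]
  apply Real.exp_le_exp.2
  calc n * Real.log n ≤ n * ((n : ℝ) ^ ε / ε) := by gcongr
    _ = _ := by ring

theorem exists_cauchy_logGrowth {p q R : ℝ} (hpq : p.HolderConjugate q) (hR : 0 ≤ R) :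
    ∃ r : ℝ, 0 < r ∧ ∃ M : ℝ, 0 ≤ M ∧ ∀ n : ℕ, ∃ ρ : ℝ, 0 < ρ ∧
      sqrt (n ! : ℝ) * exp (r * logGrowth q ρ) / ρ ^ n * exp (R * (n : ℝ) ^ p) ≤ M := by
  have hp := hpq.lt
  have hq := hpq.symm.lt
  have hp1 : 0 < p - 1 := by linarith
  -- With `ρ = exp(T n^{p-1})`, the divisor `ρ^n = exp(T n^p)` has to pay for three factors: `R` for
  -- the weight, `1/(p-1)` for `√n!`, and `1` for `e^{rW(ρ)}`. The last is kept below `e^{n^p}` by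
  -- the choice of `r` and `(p-1)q = p`.
  set T := R + 1 / (p - 1) + 1 with hT
  have hT1 : 1 ≤ T := by
    have : 0 < 1 / (p - 1) := by positivity
    linarith
  have hT0 : 0 < T := by linarith
  set r := 1 / (2 ^ q * T ^ q) with hr
  have hr0 : 0 < r := by positivity
  refine ⟨r, hr0, exp (r * logGrowth q 1), (Real.exp_pos _).le, fun n => ?_⟩
  rcases Nat.eq_zero_or_pos n with rfl | hn
  · refine ⟨1, one_pos, ?_⟩
    rw [Nat.cast_zero, Real.zero_rpow (by linarith)]
    simp
  have hn' : (1 : ℝ) ≤ n := by exact_mod_cast hn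
  have hn0 : (0 : ℝ) < n := by linarith
  set l := T * (n : ℝ) ^ (p - 1) with hl
  have hl1 : 1 ≤ l := one_le_mul_of_one_le_of_one_le hT1 (Real.one_le_rpow hn' hp1.le)
  refine ⟨exp l, Real.exp_pos l, ?_⟩
  have h1 : logGrowth q (exp l) ≤ 2 ^ q * T ^ q * (n : ℝ) ^ p := by
    unfold logGrowth
    have h2 : Real.log (sqrt (1 + exp l ^ 2)) ≤ 2 * l := by
      have h3 : sqrt (1 + exp l ^ 2) ≤ exp (2 * l) := by
        apply Real.sqrt_le_iff.2 ⟨(Real.exp_pos _).le, ?_⟩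
        have e : exp (2 * l) = exp l ^ 2 := by rw [← Real.exp_nat_mul]; norm_num
        have h4 : 2 ≤ exp l := by linarith [Real.add_one_le_exp l]
        rw [e]
        have h5 : 4 ≤ exp l ^ 2 := by nlinarith
        nlinarith
      have := Real.log_le_log (by linarith [one_le_sqrt_one_add_sq (exp l)]) h3
      rwa [Real.log_exp] at this
    have h0 := log_sqrt_nonneg (exp l)
    calc Real.log (sqrt (1 + exp l ^ 2)) ^ q ≤ (2 * l) ^ q := by gcongr
      _ = 2 ^ q * T ^ q * ((n : ℝ) ^ (p - 1)) ^ q := by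
        rw [Real.mul_rpow (by norm_num) (by linarith), hl,
          Real.mul_rpow hT0.le (by positivity), mul_assoc]
      _ = _ := by rw [← Real.rpow_mul hn0.le, hpq.sub_one_mul_conj]
  have h2 : r * logGrowth q (exp l) ≤ (n : ℝ) ^ p := by
    calc r * logGrowth q (exp l) ≤ r * (2 ^ q * T ^ q * (n : ℝ) ^ p) := by gcongr
      _ = _ := by rw [hr]; field_simp
  have h3 := sqrt_factorial_le_exp hp1 n
  rw [show 1 + (p - 1) = p by ring] at h3
  have e1 : exp l ^ n = exp (T * (n : ℝ) ^ p) := by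
    rw [← Real.exp_nat_mul, hl]
    congr 1
    have : (n : ℝ) ^ p = n ^ (p - 1) * n := by
      rw [← Real.rpow_add_one hn0.ne']; congr 1; ring
    rw [this]; ring
  calc sqrt (n ! : ℝ) * exp (r * logGrowth q (exp l)) / exp l ^ n * exp (R * (n : ℝ) ^ p)
      ≤ exp (1 / (p - 1) * (n : ℝ) ^ p) * exp ((n : ℝ) ^ p) / exp (T * (n : ℝ) ^ p) *
        exp (R * (n : ℝ) ^ p) := by rw [e1]; gcongr
    _ = 1 := by
        rw [← Real.exp_add, ← Real.exp_sub, ← Real.exp_add, Real.exp_eq_one_iff, hT]; ring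
    _ ≤ _ := Real.one_le_exp (mul_nonneg hr0.le (logGrowth_nonneg _ _))

theorem cauchyBound_real (d : ℕ) {s : ℝ} (hs : 0 < s) (hs2 : s < 1 / 2) :
    CauchyBound d (RFlat.real s hs) (logGrowth (1 / (1 - 2 * s))) := by
  intro R hR
  set q := 1 / (1 - 2 * s) with hq
  set p := 1 / (2 * s) with hp
  have hp1 : 1 < p := by rw [hp, lt_div_iff₀ (by positivity)]; linarith
  have hpq : p.HolderConjugate q := by
    rw [Real.holderConjugate_iff]
    refine ⟨hp1, ?_⟩
    rw [hp, hq]; simp only [one_div, inv_inv]; ring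
  -- The weight is not a product over coordinates; `d^{p-1}` comes from `(∑ α_j)^p ≤ d^{p-1} ∑
  -- α_j^p`.
  obtain ⟨r, hr, M, hM, h⟩ := exists_cauchy_logGrowth hpq (R := R * (d : ℝ) ^ (p - 1))
    (by positivity)
  refine ⟨r, hr, M ^ d, fun α => ?_⟩
  choose ρ hρ hb using h
  refine ⟨fun j => ρ (α j), fun j => hρ _, ?_⟩
  have h1 : (((∑ j, α j : ℕ) : ℝ)) ^ p ≤ (d : ℝ) ^ (p - 1) * ∑ j, (α j : ℝ) ^ p := by
    have := Real.rpow_sum_le_const_mul_sum_rpow_of_nonneg (s := Finset.univ)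
      (f := fun j => (α j : ℝ)) hp1.le (fun j _ => by positivity)
    simpa using this
  have h2 : seqWeight R (RFlat.real s hs) α ≤
      ∏ j, exp (R * (d : ℝ) ^ (p - 1) * (α j : ℝ) ^ p) := by
    rw [← Real.exp_sum, ← Finset.mul_sum]
    simp only [seqWeight]
    apply Real.exp_le_exp.2
    rw [mul_assoc]
    exact mul_le_mul_of_nonneg_left h1 hR.le
  calc _ ≤ (∏ j, (sqrt ((α j)! : ℝ) * exp (r * logGrowth q (ρ (α j))) / ρ (α j) ^ α j)) *
        ∏ j, exp (R * (d : ℝ) ^ (p - 1) * (α j : ℝ) ^ p) := by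
        gcongr
        exact Finset.prod_nonneg fun j _ => by have := hρ (α j); positivity
    _ ≤ ∏ _j : Fin d, M := by
        rw [← Finset.prod_mul_distrib]
        exact Finset.prod_le_prod
          (fun j _ => by have := hρ (α j); positivity) fun j _ => hb (α j)
    _ = M ^ d := by simp

/-! ### The coefficient condition and its independence of `p` -/

theorem seqWeight_pos {d : ℕ} {R : ℝ} (hR : 0 < R) (s : RFlat) (α : Fin d → ℕ) :
    0 < seqWeight R s α := by
  cases s with
  | real s hs => exact Real.exp_pos _
  | flat σ hσ =>
    simp only [seqWeight]
    have : (0 : ℝ) < ((∏ j, (α j)! : ℕ) : ℝ) := by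
      exact_mod_cast Finset.prod_pos fun j _ => Nat.factorial_pos _
    positivity

theorem one_le_seqWeight_one {d : ℕ} (s : RFlat) (α : Fin d → ℕ) : 1 ≤ seqWeight 1 s α := by
  cases s with
  | real s hs => exact Real.one_le_exp (by positivity)
  | flat σ hσ =>
    simp only [seqWeight, one_pow, one_mul]
    refine Real.one_le_rpow ?_ (by positivity)
    exact_mod_cast Finset.prod_pos fun j _ => Nat.factorial_pos (α j)

/-- Here `s ≤ 1/2` is used: for real `s` it gives `n ≤ n^{1/(2s)}`, so a geometric factor is
absorbed by enlarging the parameter of the weight. -/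
theorem exists_seqWeight_mul_pow_le (d : ℕ) {s : RFlat} (hs : s ≤ RFlat.half) {R A : ℝ} (hR : 0 < R)
    (hA : 1 ≤ A) : ∃ R' : ℝ, 0 < R' ∧ ∀ α : Fin d → ℕ,
      seqWeight R s α * A ^ (∑ j, α j) ≤ seqWeight R' s α := by
  cases s with
  | real s hs0 =>
    rw [RFlat.half, RFlat.real_le_real] at hs
    have hl := Real.log_nonneg hA
    refine ⟨R + Real.log A, by positivity, fun α => ?_⟩
    simp only [seqWeight]
    set n := ∑ j, α j
    have hp : 1 ≤ 1 / (2 * s) := by rw [le_div_iff₀ (by positivity)]; linarith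
    have h1 : (n : ℝ) ≤ (n : ℝ) ^ (1 / (2 * s)) := by
      rcases Nat.eq_zero_or_pos n with h0 | h0
      · rw [h0, Nat.cast_zero, Real.zero_rpow (by linarith)]
      · exact Real.self_le_rpow_of_one_le (by exact_mod_cast h0) hp
    have e : A ^ n = exp (n * Real.log A) := by
      rw [Real.exp_nat_mul, Real.exp_log (by linarith)]
    rw [e, ← Real.exp_add]
    apply Real.exp_le_exp.2
    rw [add_mul]
    have := mul_le_mul_of_nonneg_right h1 hl
    linarith
  | flat σ hσ =>
    refine ⟨R * A, by positivity, fun α => ?_⟩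
    simp only [seqWeight]
    rw [mul_pow]
    exact le_of_eq (by ring)

theorem summable_of_bounded_seqWeight {d : ℕ} {s : RFlat} (hs : s ≤ RFlat.half)
    {f : HermiteSeries d} (h : ∀ R : ℝ, 0 < R → ∃ C : ℝ, ∀ α, ‖f α‖ * seqWeight R s α ≤ C)
    {R : ℝ} (hR : 0 < R) : Summable fun α => ‖f α‖ * seqWeight R s α := by
  obtain ⟨R', hR', hle⟩ := exists_seqWeight_mul_pow_le d hs hR (A := 2) (by norm_num)
  obtain ⟨C, hC⟩ := h R' hR'
  refine ((summable_half_pow_sum d).mul_left C).of_nonneg_of_le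
    (fun α => mul_nonneg (norm_nonneg _) (seqWeight_pos hR s α).le) fun α => ?_
  have h2 : (0 : ℝ) < 2 ^ (∑ j, α j) := by positivity
  have h3 : ‖f α‖ * (seqWeight R s α * 2 ^ (∑ j, α j)) ≤ C :=
    (mul_le_mul_of_nonneg_left (hle α) (norm_nonneg _)).trans (hC α)
  rw [one_div, inv_pow, ← div_eq_mul_inv, le_div_iff₀ h2, mul_assoc]
  exact h3

/-- Every `ℓ^p` lies between `ℓ^1` and `ℓ^∞`. Boundedness for a larger parameter gains `2^{-|α|}`,
hence summability for the given one. -/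
theorem mem_beurlingSpace_iff {d : ℕ} {p : ℝ≥0∞} (hp : 1 ≤ p) {s : RFlat} (hs : s ≤ RFlat.half)
    (f : HermiteSeries d) : f ∈ beurlingSpace d p s ↔
      ∀ R : ℝ, 0 < R → ∃ C : ℝ, ∀ α, ‖f α‖ * seqWeight R s α ≤ C := by
  have hn : ∀ (R : ℝ), 0 < R → ∀ α, ‖f α * (seqWeight R s α : ℂ)‖ = ‖f α‖ * seqWeight R s α := by
    intro R hR α
    rw [norm_mul, Complex.norm_real, Real.norm_eq_abs, abs_of_pos (seqWeight_pos hR s α)]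
  constructor
  · intro h R hR
    have := memℓp_infty_iff.1 ((h R hR).of_exponent_ge (le_top : p ≤ ∞))
    obtain ⟨C, hC⟩ := this
    refine ⟨C, fun α => ?_⟩
    rw [← hn R hR]
    exact hC ⟨α, rfl⟩
  · intro h R hR
    refine Memℓp.of_exponent_ge (q := 1) ?_ hp
    refine memℓp_gen ?_
    simp only [ENNReal.toReal_one, Real.rpow_one, hn R hR]
    exact summable_of_bounded_seqWeight hs h hR

/-! ### From decaying coefficients to functions -/

theorem norm_fracFourier {d : ℕ} (t : Fin d → ℝ) (f : HermiteSeries d) (α : Fin d → ℕ) :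
    ‖fracFourier t f α‖ = ‖f α‖ := by
  unfold fracFourier
  rw [norm_mul, Complex.norm_exp]
  simp

/-- The terms are dominated by a summable sequence times a fixed Gaussian, so the sum is continuous
and integrable, and termwise integration with orthonormality recovers the coefficients. -/
theorem isFunction_tsum {d : ℕ} {A : ℝ} (hA : 1 ≤ A)
    (hA' : ∀ (α : Fin d → ℕ) (x : EuclideanSpace ℝ (Fin d)),
      |hermiteFun α x| ≤ 2 ^ d * A ^ (∑ j, α j) * exp (-(1 / 2 - 1 / 4) * ‖x‖ ^ 2))
    {c : HermiteSeries d} (hc : Summable fun α => ‖c α‖ * A ^ (∑ j, α j)) :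
    IsFunction c (fun x => ∑' α, c α * (hermiteFun α x : ℂ)) := by
  have hS : Summable fun α => ‖c α‖ * A ^ (∑ j, α j) * 2 ^ d := hc.mul_right _
  have hterm : ∀ (α : Fin d → ℕ) x, ‖c α * (hermiteFun α x : ℂ)‖ ≤
      ‖c α‖ * A ^ (∑ j, α j) * 2 ^ d * exp (-(1 / 4) * ‖x‖ ^ 2) := by
    intro α x
    rw [norm_mul, Complex.norm_real, Real.norm_eq_abs]
    calc ‖c α‖ * |hermiteFun α x|
        ≤ ‖c α‖ * (2 ^ d * A ^ (∑ j, α j) * exp (-(1 / 2 - 1 / 4) * ‖x‖ ^ 2)) := by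
          gcongr; exact hA' α x
      _ = _ := by norm_num; ring
  have he1 : ∀ x : EuclideanSpace ℝ (Fin d), exp (-(1 / 4) * ‖x‖ ^ 2) ≤ 1 := fun x => by
    rw [Real.exp_le_one_iff]; nlinarith [sq_nonneg ‖x‖]
  have hterm' : ∀ (α : Fin d → ℕ) x, ‖c α * (hermiteFun α x : ℂ)‖ ≤
      ‖c α‖ * A ^ (∑ j, α j) * 2 ^ d := fun α x =>
    (hterm α x).trans (mul_le_of_le_one_right (by positivity) (he1 x))
  have hcont : Continuous (fun x => ∑' α, c α * (hermiteFun α x : ℂ)) :=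
    continuous_tsum (fun α => continuous_const.mul
      (Complex.continuous_ofReal.comp (continuous_hermiteFun α))) hS hterm'
  have hint := integrable_exp_neg_mul_norm_sq d (c := 1 / 4) (by norm_num)
  refine ⟨hcont.aestronglyMeasurable, ⟨0, by norm_num, ?_⟩, fun α => ?_⟩
  · simp only [neg_zero, zero_mul, Real.exp_zero, Complex.ofReal_one, mul_one]
    refine (hint.const_mul (∑' α, ‖c α‖ * A ^ (∑ j, α j) * 2 ^ d)).mono'
      hcont.aestronglyMeasurable (Filter.Eventually.of_forall fun x => ?_)
    rw [← tsum_mul_right]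
    exact tsum_of_norm_bounded (hS.mul_right _).hasSum fun α => hterm α x
  · have hcts : ∀ β : Fin d → ℕ, Continuous fun x => c β * (hermiteFun β x : ℂ) * (hermiteFun α x : ℂ) :=
      fun β => (continuous_const.mul (Complex.continuous_ofReal.comp (continuous_hermiteFun β))).mul
        (Complex.continuous_ofReal.comp (continuous_hermiteFun α))
    have hbd : ∀ (β : Fin d → ℕ) x, ‖c β * (hermiteFun β x : ℂ) * (hermiteFun α x : ℂ)‖ ≤
        ‖c β‖ * A ^ (∑ j, β j) * 2 ^ d * (2 ^ d * A ^ (∑ j, α j)) * exp (-(1 / 4) * ‖x‖ ^ 2) := by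
      intro β x
      have h1 : ‖(hermiteFun α x : ℂ)‖ ≤ 2 ^ d * A ^ (∑ j, α j) := by
        rw [Complex.norm_real, Real.norm_eq_abs]
        refine (hA' α x).trans (mul_le_of_le_one_right (by positivity) ?_)
        have := he1 x
        norm_num at this ⊢
      rw [norm_mul]
      calc _ ≤ ‖c β‖ * A ^ (∑ j, β j) * 2 ^ d * exp (-(1 / 4) * ‖x‖ ^ 2) *
            (2 ^ d * A ^ (∑ j, α j)) := by gcongr; exact hterm β x
        _ = _ := by ring
    have hF : ∀ β : Fin d → ℕ, Integrable
        (fun x => c β * (hermiteFun β x : ℂ) * (hermiteFun α x : ℂ)) := fun β =>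
      (hint.const_mul _).mono' (hcts β).aestronglyMeasurable
        (Filter.Eventually.of_forall (hbd β))
    have hsum := hasSum_integral_of_summable_integral_norm hF (by
      refine ((hS.mul_right (2 ^ d * A ^ (∑ j, α j))).mul_right
        (∫ x : EuclideanSpace ℝ (Fin d), exp (-(1 / 4) * ‖x‖ ^ 2))).of_nonneg_of_le
        (fun β => integral_nonneg fun x => norm_nonneg _) fun β => ?_
      rw [← integral_const_mul]
      exact integral_mono (hF β).norm (hint.const_mul _) (hbd β))
    have hval : ∀ β : Fin d → ℕ,
        ∫ x, c β * (hermiteFun β x : ℂ) * (hermiteFun α x : ℂ) = if β = α then c α else 0 := by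
      intro β
      have : ∀ x, c β * (hermiteFun β x : ℂ) * (hermiteFun α x : ℂ) =
          c β * ((hermiteFun β x * hermiteFun α x : ℝ) : ℂ) := fun x => by push_cast; ring
      simp_rw [this]
      rw [integral_const_mul, integral_complex_ofReal, integral_hermiteFun_mul]
      rcases eq_or_ne β α with rfl | h
      · simp
      · simp [h]
    simp_rw [hval] at hsum
    have h2 := hsum.unique (hasSum_ite_eq α (c α))
    rw [← h2]
    congr 1
    ext x
    rw [tsum_mul_right]

/-- Decay of the Hermite coefficients gives uniform bounds for all fractional Fourier transforms. -/
theorem exists_fracFourierNorm_le {d : ℕ} {s : RFlat} (hs : s ≤ RFlat.half) {W : ℝ → ℝ}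
    (hom : ∀ (r : ℝ) (x : EuclideanSpace ℝ (Fin d)), omega r s x = exp (-r * W ‖x‖))
    (hH : HermiteBound d s W) {f : HermiteSeries d}
    (h : ∀ R : ℝ, 0 < R → ∃ C : ℝ, ∀ α, ‖f α‖ * seqWeight R s α ≤ C) {r : ℝ} (hr : 0 < r) :
    ∃ C : ℝ, ∀ t : Fin d → ℝ, fracFourierNorm r s f t ≤ ENNReal.ofReal C := by
  obtain ⟨A, hA, hA'⟩ := exists_abs_hermiteFun_le_gaussian d (r := 1 / 4) (by norm_num)
  obtain ⟨R, hR, M, hM, hMb⟩ := hH r hr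
  have hsum := summable_of_bounded_seqWeight hs h hR
  obtain ⟨R', hR', hle⟩ := exists_seqWeight_mul_pow_le d hs one_pos hA
  have hsum' := summable_of_bounded_seqWeight hs h hR'
  -- The constant involves only the moduli of the coefficients, hence is the same for all `t`.
  refine ⟨∑' α, ‖f α‖ * seqWeight R s α * M, fun t => ?_⟩
  have hc : Summable fun α => ‖fracFourier t f α‖ * A ^ (∑ j, α j) := by
    refine hsum'.of_nonneg_of_le (fun α => by positivity) fun α => ?_
    rw [norm_fracFourier]
    gcongr
    refine le_trans ?_ (hle α)
    exact le_mul_of_one_le_left (by positivity) (one_le_seqWeight_one s α)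
  refine (iInf₂_le _ (isFunction_tsum hA hA' hc)).trans ?_
  rw [eLpNorm_exponent_top]
  refine eLpNormEssSup_le_of_ae_bound (Filter.Eventually.of_forall fun x => ?_)
  rw [← tsum_mul_right]
  refine tsum_of_norm_bounded (hsum.mul_right M).hasSum fun α => ?_
  simp only [hom]
  rw [norm_mul, norm_mul, norm_fracFourier, Complex.norm_real, Complex.norm_real,
    Real.norm_eq_abs, Real.norm_eq_abs, abs_of_pos (by positivity :
      0 < exp (‖x‖ ^ 2 / 2) * exp (-r * W ‖x‖))]
  calc ‖f α‖ * |hermiteFun α x| * (exp (‖x‖ ^ 2 / 2) * exp (-r * W ‖x‖))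
      = ‖f α‖ * ((|hermiteFun α x| * exp (‖x‖ ^ 2 / 2)) * exp (-r * W ‖x‖)) := by ring
    _ ≤ ‖f α‖ * ((M * seqWeight R s α * exp (r * W ‖x‖)) * exp (-r * W ‖x‖)) :=
        mul_le_mul_of_nonneg_left (mul_le_mul_of_nonneg_right (hMb α x) (Real.exp_pos _).le)
          (norm_nonneg _)
    _ = ‖f α‖ * seqWeight R s α * M * (exp (r * W ‖x‖) * exp (-r * W ‖x‖)) := by ring
    _ = _ := by rw [← Real.exp_add]; simp

/-! ### The Bargmann transform and Cauchy's estimates -/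

/-- The normalised monomial `z^α / √α!`. -/
def monomialC {d : ℕ} (α : Fin d → ℕ) (z : Fin d → ℂ) : ℂ :=
  ∏ j, (z j ^ α j / (sqrt ((α j)! : ℝ) : ℂ))

/-- The Bargmann transform `∑_α c(α) z^α / √α!` of a formal Hermite series. -/
def bargmann {d : ℕ} (c : HermiteSeries d) (z : Fin d → ℂ) : ℂ := ∑' α, c α * monomialC α z

theorem norm_monomialC {d : ℕ} (α : Fin d → ℕ) (z : Fin d → ℂ) :
    ‖monomialC α z‖ = ∏ j, (‖z j‖ ^ α j / sqrt ((α j)! : ℝ)) := by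
  unfold monomialC
  rw [norm_prod]
  refine Finset.prod_congr rfl fun j _ => ?_
  rw [norm_div, norm_pow, Complex.norm_real, Real.norm_eq_abs, abs_of_nonneg (Real.sqrt_nonneg _)]

/-- Coefficients of at most exponential growth. -/
def ExpGrowth {d : ℕ} (c : HermiteSeries d) : Prop :=
  ∃ M A : ℝ, 0 ≤ M ∧ 0 ≤ A ∧ ∀ α, ‖c α‖ ≤ M * A ^ (∑ j, α j)

theorem summable_pow_mul_monomial {d : ℕ} {A : ℝ} (hA : 0 ≤ A) {b : Fin d → ℝ} (hb : ∀ j, 0 ≤ b j) :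
    Summable fun α : Fin d → ℕ => A ^ (∑ j, α j) * ∏ j, (b j ^ α j / sqrt ((α j)! : ℝ)) := by
  have h := summable_pi_prod (f := fun (j : Fin d) n => (A * b j) ^ n / sqrt (n ! : ℝ))
    fun j => summable_pow_div_sqrt_factorial _ (mul_nonneg hA (hb j))
  refine h.congr fun α => ?_
  rw [← Finset.prod_pow_eq_pow_sum, ← Finset.prod_mul_distrib]
  refine Finset.prod_congr rfl fun j _ => ?_
  rw [mul_pow]; ring

theorem ExpGrowth.summable {d : ℕ} {c : HermiteSeries d} (hc : ExpGrowth c) {b : Fin d → ℝ}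
    (hb : ∀ j, 0 ≤ b j) :
    Summable fun α : Fin d → ℕ => ‖c α‖ * ∏ j, (b j ^ α j / sqrt ((α j)! : ℝ)) := by
  obtain ⟨M, A, hM, hA, h⟩ := hc
  have hp : ∀ α : Fin d → ℕ, 0 ≤ ∏ j, (b j ^ α j / sqrt ((α j)! : ℝ)) := fun α =>
    Finset.prod_nonneg fun j _ => by have := hb j; positivity
  refine ((summable_pow_mul_monomial hA hb).mul_left M).of_nonneg_of_le
    (fun α => mul_nonneg (norm_nonneg _) (hp α)) fun α => ?_
  rw [← mul_assoc]
  exact mul_le_mul_of_nonneg_right (h α) (hp α)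

theorem differentiable_monomialC_update {d : ℕ} (α : Fin d → ℕ) (z : Fin d → ℂ) (j : Fin d) :
    Differentiable ℂ fun ζ => monomialC α (Function.update z j ζ) := by
  unfold monomialC
  refine Differentiable.fun_finsetProd fun i _ => ?_
  rcases eq_or_ne i j with rfl | h
  · simp only [Function.update_self]; fun_prop
  · simp only [Function.update_of_ne h]; fun_prop

/-- Separate holomorphy is enough, since Phragmén–Lindelöf is applied in one variable at a time. It
follows from normal convergence on a ball in the moving variable. -/
theorem differentiable_bargmann_update {d : ℕ} {c : HermiteSeries d} (hc : ExpGrowth c)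
    (z : Fin d → ℂ) (j : Fin d) : Differentiable ℂ fun ζ => bargmann c (Function.update z j ζ) := by
  intro ζ₀
  have hmem : Metric.ball (0 : ℂ) (‖ζ₀‖ + 1) ∈ nhds ζ₀ :=
    Metric.isOpen_ball.mem_nhds (by simp)
  refine DifferentiableOn.differentiableAt (s := Metric.ball (0 : ℂ) (‖ζ₀‖ + 1)) ?_ hmem
  unfold bargmann
  refine Complex.differentiableOn_tsum_of_summable_norm
    (hc.summable (b := fun i => ‖z i‖ + ‖ζ₀‖ + 1) fun i => by positivity)
    (fun α => ((differentiable_monomialC_update α z j).const_mul _).differentiableOn)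
    Metric.isOpen_ball fun α w hw => ?_
  rw [norm_mul, norm_monomialC]
  gcongr with i
  rw [mem_ball_zero_iff] at hw
  rcases eq_or_ne i j with rfl | h
  · rw [Function.update_self]; linarith [norm_nonneg (z i)]
  · rw [Function.update_of_ne h]; linarith [norm_nonneg ζ₀]

/-- The phase `e^{-iπ⟨t,α⟩/2}` is a product of powers, so it can be moved into the monomial as a
rotation of each variable. -/
theorem bargmann_fracFourier {d : ℕ} (t : Fin d → ℝ) (f : HermiteSeries d) (z : Fin d → ℂ) :
    bargmann (fracFourier t f) z =
      bargmann f fun j => Complex.exp (-((pi / 2 * t j : ℝ) * Complex.I)) * z j := by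
  unfold bargmann fracFourier monomialC
  refine tsum_congr fun α => ?_
  have : Complex.exp (-Complex.I * (pi / 2 : ℝ) * ((∑ j, t j * (α j : ℝ) : ℝ) : ℂ)) =
      ∏ j, Complex.exp (-((pi / 2 * t j : ℝ) * Complex.I)) ^ α j := by
    rw [show -Complex.I * (pi / 2 : ℝ) * ((∑ j, t j * (α j : ℝ) : ℝ) : ℂ) =
      ∑ j, (α j : ℂ) * (-((pi / 2 * t j : ℝ) * Complex.I)) by
        push_cast; rw [Finset.mul_sum]; exact Finset.sum_congr rfl fun j _ => by ring,
      Complex.exp_sum]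
    exact Finset.prod_congr rfl fun j _ => Complex.exp_nat_mul _ _
  rw [this, mul_comm (∏ j, _) (f α), mul_assoc, ← Finset.prod_mul_distrib]
  congr 1
  refine Finset.prod_congr rfl fun j _ => ?_
  rw [mul_pow]; ring

theorem integral_fourier_neg_mul (m n : ℕ) :
    ∫ x : AddCircle (1 : ℝ), fourier (-(m : ℤ)) x * fourier (n : ℤ) x ∂AddCircle.haarAddCircle =
      if n = m then 1 else 0 := by
  have h := congrFun (fourierCoeff_fourier (T := 1) (n : ℤ)) (m : ℤ)
  unfold fourierCoeff at h
  simp only [smul_eq_mul] at h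
  rw [h, Pi.single_apply]
  simp [eq_comm]

/-- Cauchy's estimate for the coefficients of the Bargmann transform on a polydisc. -/
theorem norm_coeff_mul_le_of_torus {d : ℕ} {c : HermiteSeries d} (hc : ExpGrowth c) {ρ : Fin d → ℝ}
    (hρ : ∀ j, 0 < ρ j) {K : ℝ} (hK : ∀ z : Fin d → ℂ, (∀ j, ‖z j‖ = ρ j) → ‖bargmann c z‖ ≤ K)
    (α : Fin d → ℕ) : ‖c α‖ * ∏ j, (ρ j ^ α j / sqrt ((α j)! : ℝ)) ≤ K := by
  set μ : Measure (Fin d → AddCircle (1 : ℝ)) := Measure.pi fun _ => AddCircle.haarAddCircle with hμ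
  set z : (Fin d → AddCircle (1 : ℝ)) → Fin d → ℂ := fun x j => ρ j * fourier 1 (x j) with hz
  -- Integration over the torus against this character isolates the coefficient of index `α`.
  set e : (Fin d → AddCircle (1 : ℝ)) → ℂ := fun x => ∏ j, fourier (-(α j : ℤ)) (x j) with he
  have hznorm : ∀ x j, ‖z x j‖ = ρ j := fun x j => by
    simp only [hz, norm_mul, Complex.norm_real, Real.norm_eq_abs, abs_of_pos (hρ j)]
    rw [fourier_apply, Circle.norm_coe, mul_one]
  have henorm : ∀ x, ‖e x‖ = 1 := fun x => by
    simp only [he, norm_prod, fourier_apply, Circle.norm_coe, Finset.prod_const_one]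
  have hpow : ∀ (n : ℕ) (y : AddCircle (1 : ℝ)), (fourier 1 y : ℂ) ^ n = fourier (n : ℤ) y := by
    intro n y
    induction n with
    | zero => simp
    | succ n ih => rw [pow_succ, ih, Nat.cast_succ, fourier_add]
  have hmon : ∀ (β : Fin d → ℕ) x, e x * (c β * monomialC β (z x)) =
      (c β * (∏ j, (ρ j ^ β j / sqrt ((β j)! : ℝ)) : ℝ)) *
        ∏ j, (fourier (-(α j : ℤ)) (x j) * fourier (β j : ℤ) (x j)) := by
    intro β x
    rw [Finset.prod_mul_distrib]
    simp only [he, hz, monomialC, mul_pow, hpow]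
    push_cast
    simp only [Finset.prod_div_distrib, Finset.prod_mul_distrib]
    ring
  have hcont : ∀ β : Fin d → ℕ, Continuous fun x => e x * (c β * monomialC β (z x)) := by
    intro β
    simp_rw [hmon]
    refine continuous_const.mul (continuous_finsetProd _ fun j _ => ?_)
    exact ((fourier _).continuous.comp (continuous_apply j)).mul
      ((fourier _).continuous.comp (continuous_apply j))
  have hS := hc.summable fun j => (hρ j).le
  have hnorm : ∀ (β : Fin d → ℕ) x, ‖e x * (c β * monomialC β (z x))‖ =
      ‖c β‖ * ∏ j, (ρ j ^ β j / sqrt ((β j)! : ℝ)) := by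
    intro β x
    rw [norm_mul, henorm, one_mul, norm_mul, norm_monomialC]
    simp only [hznorm]
  have hint : ∀ β : Fin d → ℕ, Integrable (fun x => e x * (c β * monomialC β (z x))) μ :=
    fun β => (integrable_const (‖c β‖ * ∏ j, (ρ j ^ β j / sqrt ((β j)! : ℝ)))).mono'
      (hcont β).aestronglyMeasurable (Filter.Eventually.of_forall fun x => (hnorm β x).le)
  have hsum := hasSum_integral_of_summable_integral_norm hint (by
    simp_rw [hnorm]
    simpa using hS)
  have hval : ∀ β : Fin d → ℕ, ∫ x, e x * (c β * monomialC β (z x)) ∂μ =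
      if β = α then c α * (∏ j, (ρ j ^ α j / sqrt ((α j)! : ℝ)) : ℝ) else 0 := by
    intro β
    simp_rw [hmon]
    rw [integral_const_mul, integral_fintype_prod_eq_prod (fun j (y : AddCircle (1 : ℝ)) =>
      (fourier (-(α j : ℤ)) y * fourier (β j : ℤ) y : ℂ))]
    simp_rw [integral_fourier_neg_mul]
    rcases eq_or_ne β α with rfl | h
    · simp
    · obtain ⟨j, hj⟩ := Function.ne_iff.1 h
      have h0 : ∏ j, (if β j = α j then (1 : ℂ) else 0) = 0 :=
        Finset.prod_eq_zero (Finset.mem_univ j) (if_neg hj)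
      rw [if_neg h, h0, mul_zero]
  simp_rw [hval] at hsum
  have h2 := hsum.unique (hasSum_ite_eq α _)
  have h3 : ∀ x, ∑' β, e x * (c β * monomialC β (z x)) = e x * bargmann c (z x) := fun x =>
    tsum_mul_left
  simp_rw [h3] at h2
  have h4 : ‖∫ x, e x * bargmann c (z x) ∂μ‖ ≤ K := by
    have := norm_integral_le_of_norm_le_const (μ := μ) (f := fun x => e x * bargmann c (z x)) (C := K)
      (Filter.Eventually.of_forall fun x => by
        rw [norm_mul, henorm, one_mul]; exact hK _ (hznorm x))
    simpa using this
  rw [h2, norm_mul, Complex.norm_real, Real.norm_eq_abs, abs_of_nonneg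
    (Finset.prod_nonneg fun j _ => by have := hρ j; positivity)] at h4
  exact h4

/-! ### Phragmén–Lindelöf in several variables -/

/-- Propagation of the Phragmén–Lindelöf bound to all coordinates. -/
theorem norm_le_of_separate {d : ℕ} {W : ℝ → ℝ} (hW : IsGrowth W) {h : ℝ}
    (hPL : PhragmenLindelofProperty W h) {r' : ℝ} (hr' : 0 < r') :
    ∃ r : ℝ, 0 < r ∧ ∃ M : ℝ, 0 ≤ M ∧ ∀ A : Fin d → Set ℝ, (∀ j, AngleDense (A j) h) →
      ∀ F : (Fin d → ℂ) → ℂ, (∀ z j, Differentiable ℂ fun ζ => F (Function.update z j ζ)) →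
      ∀ K : ℝ, 0 ≤ K → (∀ a : Fin d → ℝ, (∀ j, a j ∈ A j) → ∀ z, ‖F z‖ ≤ K * ∏ j,
        exp ((Complex.exp (-(a j * Complex.I)) * z j).im ^ 2 / 2 + r * W ‖z j‖)) →
      ∀ z, ‖F z‖ ≤ K * M * ∏ j, exp (r' * W ‖z j‖) := by
  obtain ⟨r, hr, hrr, M, hM, hmain⟩ := hPL r' hr'
  refine ⟨r, hr, M ^ d, by positivity, fun A hA F hF K hK hbound => ?_⟩
  have hM0 : 0 ≤ M := by linarith
  -- `J` is the set of coordinates already freed from the Gaussian factor. The claim ranges over all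
  -- directions `a`, so the direction of the next coordinate can vary while the others stay fixed,
  -- as the one-variable property requires.
  have key : ∀ J : Finset (Fin d), ∀ a : Fin d → ℝ, (∀ j, a j ∈ A j) → ∀ z, ‖F z‖ ≤
      K * M ^ J.card * ∏ j, (if j ∈ J then exp (r' * W ‖z j‖) else
        exp ((Complex.exp (-(a j * Complex.I)) * z j).im ^ 2 / 2 + r * W ‖z j‖)) := by
    intro J
    induction J using Finset.induction_on with
    | empty => intro a ha z; simpa using hbound a ha z
    | insert i J hi ih =>
      intro a ha z
      set P : ℝ := ∏ j ∈ Finset.univ.erase i, (if j ∈ J then exp (r' * W ‖z j‖) else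
        exp ((Complex.exp (-(a j * Complex.I)) * z j).im ^ 2 / 2 + r * W ‖z j‖)) with hP
      have hP0 : 0 ≤ P := Finset.prod_nonneg fun j _ => by split_ifs <;> positivity
      have hslice : ∀ b ∈ A i, ∀ ζ : ℂ, ‖F (Function.update z i ζ)‖ ≤ K * M ^ J.card * P *
          exp ((Complex.exp (-(b * Complex.I)) * ζ).im ^ 2 / 2 + r * W ‖ζ‖) := by
        intro b hb ζ
        have := ih (Function.update a i b) (fun j => by
          rcases eq_or_ne j i with rfl | h
          · rwa [Function.update_self]
          · rw [Function.update_of_ne h]; exact ha j) (Function.update z i ζ)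
        rw [← Finset.mul_prod_erase _ _ (Finset.mem_univ i), if_neg hi, Function.update_self,
          Function.update_self] at this
        refine this.trans (le_of_eq ?_)
        have e : ∏ j ∈ Finset.univ.erase i, (if j ∈ J then exp (r' * W ‖Function.update z i ζ j‖) else
            exp ((Complex.exp (-((Function.update a i b j : ℝ) * Complex.I)) *
              Function.update z i ζ j).im ^ 2 / 2 + r * W ‖Function.update z i ζ j‖)) = P := by
          refine Finset.prod_congr rfl fun j hj => ?_
          have hji := Finset.ne_of_mem_erase hj
          rw [Function.update_of_ne hji, Function.update_of_ne hji]
        rw [e]; ring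
      -- A single direction suffices here: `Im² ≤ |ζ|²`, and `W` is at most quadratic.
      have hgrow : ∃ B : ℝ, ∀ ζ, ‖F (Function.update z i ζ)‖ ≤ exp (B * (1 + ‖ζ‖ ^ 2)) := by
        obtain ⟨C, hC, hq⟩ := hW.le_quadratic
        refine ⟨K * M ^ J.card * P + (1 / 2 + r * C), fun ζ => (hslice _ (ha i) ζ).trans ?_⟩
        have hK' : 0 ≤ K * M ^ J.card * P := by positivity
        have h1 : K * M ^ J.card * P ≤ exp (K * M ^ J.card * P) := by
          linarith [Real.add_one_le_exp (K * M ^ J.card * P)]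
        have h2 : (Complex.exp (-(a i * Complex.I)) * ζ).im ^ 2 ≤ ‖ζ‖ ^ 2 := by
          have : |(Complex.exp (-(a i * Complex.I)) * ζ).im| ≤ ‖ζ‖ := by
            refine (Complex.abs_im_le_norm _).trans (le_of_eq ?_)
            rw [norm_mul, Complex.norm_exp]; simp
          rw [← sq_abs]; gcongr
        have h3 := mul_le_mul_of_nonneg_left (hq ‖ζ‖ (norm_nonneg _)) hr.le
        calc _ ≤ exp (K * M ^ J.card * P) * exp (‖ζ‖ ^ 2 / 2 + r * (C * (1 + ‖ζ‖ ^ 2))) := by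
              gcongr
          _ ≤ _ := by
              rw [← Real.exp_add]
              apply Real.exp_le_exp.2
              nlinarith [mul_nonneg hK' (sq_nonneg ‖ζ‖)]
      have := hmain (A i) (hA i) _ (hF z i) hgrow (K * M ^ J.card * P) hslice (z i)
      rw [Function.update_eq_self] at this
      refine this.trans (le_of_eq ?_)
      rw [← Finset.mul_prod_erase _ _ (Finset.mem_univ i), if_pos (Finset.mem_insert_self i J),
        Finset.card_insert_of_notMem hi]
      have e : ∏ j ∈ Finset.univ.erase i, (if j ∈ insert i J then exp (r' * W ‖z j‖) else
          exp ((Complex.exp (-(a j * Complex.I)) * z j).im ^ 2 / 2 + r * W ‖z j‖)) = P := by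
        refine Finset.prod_congr rfl fun j hj => ?_
        have hji := Finset.ne_of_mem_erase hj
        simp only [Finset.mem_insert, hji, false_or]
      rw [e, pow_succ]; ring
  intro z
  choose a ha _ using fun j => hA j 0
  have := key Finset.univ a ha z
  simpa using this

/-! ### Growth of the Bargmann transform of a function -/

/-- The one-dimensional Bargmann kernel. -/
def bargmannKernel (z : ℂ) (y : ℝ) : ℂ :=
  ((pi ^ (-(1 / 4) : ℝ) : ℝ) : ℂ) * Complex.exp (-(z ^ 2 + y ^ 2) / 2 + (sqrt 2 : ℂ) * z * y)

theorem hasSum_bargmannKernel {d : ℕ} (x : EuclideanSpace ℝ (Fin d)) (z : Fin d → ℂ) :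
    HasSum (fun α : Fin d → ℕ => (hermiteFun α x : ℂ) * monomialC α z)
      (∏ j, bargmannKernel (z j) (x j)) := by
  have := hasSum_pi_prod fun j => hasSum_hermiteFun1 (x j) (z j)
  refine this.congr_fun fun α => ?_
  rw [hermiteFun, monomialC, Finset.prod_mul_distrib]
  push_cast
  rfl

/-- Completing the square: against `e^{-y²/2}` the kernel is a Gaussian in `y` centred at `Re z/√2`,
and the only growth left in `z` comes from its imaginary part. -/
theorem norm_bargmannKernel_mul_exp_le (z : ℂ) (y : ℝ) :
    exp (-y ^ 2 / 2) * ‖bargmannKernel z y‖ ≤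
      exp (z.im ^ 2 / 2) * exp (-(y - z.re / sqrt 2) ^ 2) := by
  have h2 : sqrt 2 * sqrt 2 = 2 := Real.mul_self_sqrt (by norm_num)
  have hs : sqrt 2 ≠ 0 := by positivity
  unfold bargmannKernel
  rw [norm_mul, Complex.norm_real, Real.norm_eq_abs,
    abs_of_nonneg (Real.rpow_nonneg Real.pi_pos.le _), Complex.norm_exp]
  have hre : (-(z ^ 2 + (y : ℂ) ^ 2) / 2 + (sqrt 2 : ℂ) * z * y).re =
      -(z.re ^ 2 - z.im ^ 2 + y ^ 2) / 2 + sqrt 2 * z.re * y := by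
    have e : (-(z ^ 2 + (y : ℂ) ^ 2) / 2 + (sqrt 2 : ℂ) * z * y) =
      ((-(1 / 2) : ℝ) : ℂ) * (z * z) + ((-(y ^ 2) / 2 : ℝ) : ℂ) + ((sqrt 2 * y : ℝ) : ℂ) * z := by
      push_cast; ring
    rw [e, Complex.add_re, Complex.add_re, Complex.re_ofReal_mul, Complex.re_ofReal_mul,
      Complex.mul_re, Complex.ofReal_re]
    ring
  rw [hre]
  have hd : z.re / sqrt 2 = z.re * sqrt 2 / 2 := by
    rw [div_eq_div_iff hs (by norm_num)]; linear_combination -z.re * h2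
  calc exp (-y ^ 2 / 2) * (pi ^ (-(1 / 4) : ℝ) *
        exp (-(z.re ^ 2 - z.im ^ 2 + y ^ 2) / 2 + sqrt 2 * z.re * y))
      ≤ exp (-y ^ 2 / 2) * (1 *
        exp (-(z.re ^ 2 - z.im ^ 2 + y ^ 2) / 2 + sqrt 2 * z.re * y)) := by
        gcongr; exact pi_rpow_le_one
    _ = exp (z.im ^ 2 / 2) * exp (-(y - z.re / sqrt 2) ^ 2) := by
        rw [one_mul, ← Real.exp_add, ← Real.exp_add, hd]
        congr 1
        linear_combination (z.re ^ 2 / 4) * h2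

theorem IsGrowth.sum_le {W : ℝ → ℝ} (hW : IsGrowth W) {ι : Type*} (J : Finset ι) :
    ∃ C : ℝ, 0 ≤ C ∧ ∀ a : ι → ℝ, (∀ j, 0 ≤ a j) → W (∑ j ∈ J, a j) ≤ C * (1 + ∑ j ∈ J, W (a j)) := by
  classical
  obtain ⟨C₁, hC₁, hadd⟩ := hW.add_le
  induction J using Finset.induction_on with
  | empty => exact ⟨W 0, hW.nonneg 0 le_rfl, fun a ha => by simp⟩
  | insert i J hi ih =>
    obtain ⟨C, hC, h⟩ := ih
    refine ⟨C₁ * (C + 1), by positivity, fun a ha => ?_⟩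
    rw [Finset.sum_insert hi, Finset.sum_insert hi]
    have h1 := hadd (a i) (∑ j ∈ J, a j) (ha i) (Finset.sum_nonneg fun j _ => ha j)
    have h2 := h a ha
    have h3 : 0 ≤ ∑ j ∈ J, W (a j) := Finset.sum_nonneg fun j _ => hW.nonneg _ (ha j)
    have h4 := hW.nonneg _ (ha i)
    refine h1.trans ?_
    rw [mul_assoc]
    apply mul_le_mul_of_nonneg_left _ hC₁
    nlinarith [mul_nonneg hC h4]

/-- Separates the variables, so that bounds on `ℝ^d` factor into one-dimensional integrals; it rests
on `|x| ≤ ∑ |x_j|`. -/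
theorem IsGrowth.norm_le {W : ℝ → ℝ} (hW : IsGrowth W) (d : ℕ) :
    ∃ C : ℝ, 0 ≤ C ∧ ∀ x : EuclideanSpace ℝ (Fin d), W ‖x‖ ≤ C * (1 + ∑ j, W |x j|) := by
  obtain ⟨C, hC, h⟩ := hW.sum_le (Finset.univ : Finset (Fin d))
  refine ⟨C, hC, fun x => (hW.mono _ _ (norm_nonneg _) ?_).trans (h _ fun j => abs_nonneg (x j))⟩
  rw [EuclideanSpace.norm_eq]
  apply Real.sqrt_le_iff.2 ⟨Finset.sum_nonneg fun j _ => abs_nonneg _, ?_⟩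
  simp only [Real.norm_eq_abs]
  exact Finset.sum_sq_le_sq_sum_of_nonneg fun j _ => abs_nonneg _

theorem integral_exp_neg_sub_sq (m : ℝ) : ∫ y : ℝ, exp (-(y - m) ^ 2 / 2) = sqrt (2 * pi) := by
  have e : ∀ y : ℝ, exp (-(y - m) ^ 2 / 2) = (fun v : ℝ => exp (-(1 / 2) * v ^ 2)) (y - m) := by
    intro y; simp only; congr 1; ring
  simp_rw [e]
  rw [integral_sub_right_eq_self (fun v : ℝ => exp (-(1 / 2) * v ^ 2)) m, integral_gaussian]
  congr 1; ring

theorem integrable_exp_neg_sub_sq (m : ℝ) : Integrable fun y : ℝ => exp (-(y - m) ^ 2 / 2) := by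
  have h := (integrable_exp_neg_mul_sq (b := 1 / 2) (by norm_num)).comp_sub_right m
  refine h.congr (Filter.Eventually.of_forall fun y => ?_)
  simp only; congr 1; ring

/-- A function bounded by `e^{-|x|²/2 + rW}` has a Bargmann transform which is bounded by
`e^{|Im z|²/2 + CrW}`. -/
theorem exists_norm_bargmann_le {W : ℝ → ℝ} (hW : IsGrowth W) (d : ℕ) :
    ∃ r₀ : ℝ, 0 < r₀ ∧ ∃ C : ℝ, 0 ≤ C ∧ ∀ r : ℝ, 0 < r → r ≤ r₀ → ∃ N : ℝ, 0 ≤ N ∧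
      ∀ (c : HermiteSeries d) (g : EuclideanSpace ℝ (Fin d) → ℂ) (M : ℝ), 0 ≤ M → IsFunction c g →
      (∀ᵐ x, ‖g x‖ ≤ M * exp (-‖x‖ ^ 2 / 2 + r * W ‖x‖)) →
      ExpGrowth c ∧ ∀ z, ‖bargmann c z‖ ≤
        M * N * ∏ j, exp ((z j).im ^ 2 / 2 + C * r * W ‖z j‖) := by
  obtain ⟨C₁, hC₁, hadd⟩ := hW.add_le
  obtain ⟨C₂, hC₂, hquad⟩ := hW.le_quadratic
  obtain ⟨C₃, hC₃, hnorm⟩ := hW.norm_le d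
  obtain ⟨A, hA, hA'⟩ := exists_abs_hermiteFun_le_gaussian d (r := 1 / 4) (by norm_num)
  -- The first threshold makes `g h_α` integrable with a Gaussian majorant. The second ensures that
  -- the growth factor uses up at most half of the Gaussian exponent of the kernel.
  refine ⟨min (1 / (4 * (C₂ + 1))) (1 / (2 * (C₃ * C₁ * C₂ + 1))), by positivity, C₃ * C₁,
    by positivity, fun r hr hrr => ?_⟩
  have hr1 : r * C₂ ≤ 1 / 4 := by
    have := hrr.trans (min_le_left _ _)
    rw [le_div_iff₀ (by positivity)] at this
    nlinarith
  have hr2 : r * C₃ * C₁ * C₂ ≤ 1 / 2 := by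
    have := hrr.trans (min_le_right _ _)
    rw [le_div_iff₀ (by positivity)] at this
    nlinarith
  refine ⟨exp (r * C₃) * (exp (1 / 2 + C₃ * C₁ * r) * sqrt (2 * pi)) ^ d, by positivity, ?_⟩
  intro c g M hM ⟨hmeas, _, hcoef⟩ hg
  have hgauss := integrable_exp_neg_mul_norm_sq d (c := 1 / 4) (by norm_num)
  set I : ℝ := ∫ x : EuclideanSpace ℝ (Fin d), exp (-(1 / 4) * ‖x‖ ^ 2) with hI
  have hI0 : 0 ≤ I := integral_nonneg fun x => (Real.exp_pos _).le
  have hgh : ∀ α : Fin d → ℕ, ∀ᵐ x, ‖g x * (hermiteFun α x : ℂ)‖ ≤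
      M * exp (1 / 4) * 2 ^ d * A ^ (∑ j, α j) * exp (-(1 / 4) * ‖x‖ ^ 2) := by
    intro α
    filter_upwards [hg] with x hx
    rw [norm_mul, Complex.norm_real, Real.norm_eq_abs]
    calc ‖g x‖ * |hermiteFun α x| ≤ M * exp (-‖x‖ ^ 2 / 2 + r * W ‖x‖) *
          (2 ^ d * A ^ (∑ j, α j) * exp (-(1 / 2 - 1 / 4) * ‖x‖ ^ 2)) := by
          gcongr; exact hA' α x
      _ = M * 2 ^ d * A ^ (∑ j, α j) * (exp (-‖x‖ ^ 2 / 2 + r * W ‖x‖) *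
          exp (-(1 / 2 - 1 / 4) * ‖x‖ ^ 2)) := by ring
      _ ≤ M * 2 ^ d * A ^ (∑ j, α j) * (exp (1 / 4) * exp (-(1 / 4) * ‖x‖ ^ 2)) := by
          rw [← Real.exp_add, ← Real.exp_add]
          refine mul_le_mul_of_nonneg_left (Real.exp_le_exp.2 ?_) (by positivity)
          have h1 := mul_le_mul_of_nonneg_left (hquad ‖x‖ (norm_nonneg _)) hr.le
          have h2 := mul_le_mul_of_nonneg_right hr1 (by positivity : 0 ≤ 1 + ‖x‖ ^ 2)
          nlinarith [sq_nonneg ‖x‖]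
      _ = _ := by ring
  have hghint : ∀ α : Fin d → ℕ, Integrable fun x => g x * (hermiteFun α x : ℂ) := fun α =>
    (hgauss.const_mul _).mono' (hmeas.mul
      (Complex.continuous_ofReal.comp (continuous_hermiteFun α)).aestronglyMeasurable) (hgh α)
  have hghL1 : ∀ α : Fin d → ℕ, ∫ x, ‖g x * (hermiteFun α x : ℂ)‖ ≤
      M * exp (1 / 4) * 2 ^ d * I * A ^ (∑ j, α j) := by
    intro α
    refine (integral_mono_ae (hghint α).norm (hgauss.const_mul _) (hgh α)).trans (le_of_eq ?_)
    rw [integral_const_mul, ← hI]; ring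
  refine ⟨⟨M * exp (1 / 4) * 2 ^ d * I, A, by positivity, by linarith, fun α => ?_⟩, fun z => ?_⟩
  · rw [← hcoef α]
    exact (norm_integral_le_integral_norm _).trans (hghL1 α)
  have hFint : ∀ α : Fin d → ℕ, Integrable fun x => g x * (hermiteFun α x : ℂ) * monomialC α z :=
    fun α => (hghint α).mul_const _
  have hFn : ∀ α : Fin d → ℕ, ∫ x, ‖g x * (hermiteFun α x : ℂ) * monomialC α z‖ =
      (∫ x, ‖g x * (hermiteFun α x : ℂ)‖) * ‖monomialC α z‖ := by
    intro α
    simp_rw [norm_mul _ (monomialC α z)]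
    rw [integral_mul_const]
  have hsum := hasSum_integral_of_summable_integral_norm hFint (by
    simp_rw [hFn]
    refine ((summable_pow_mul_monomial (A := A) (by linarith) (b := fun j => ‖z j‖)
      fun j => norm_nonneg _).mul_left (M * exp (1 / 4) * 2 ^ d * I)).of_nonneg_of_le
      (fun α => by positivity) fun α => ?_
    rw [norm_monomialC, ← mul_assoc]
    exact mul_le_mul_of_nonneg_right (hghL1 α) (Finset.prod_nonneg fun j _ => by positivity))
  -- Sum and integral are exchanged, and the generating function turns the series under the integral
  -- into the kernel.
  have hrep : bargmann c z = ∫ x, g x * ∏ j, bargmannKernel (z j) (x j) := by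
    have h1 : ∀ α : Fin d → ℕ, ∫ x, g x * (hermiteFun α x : ℂ) * monomialC α z =
        c α * monomialC α z := fun α => by rw [integral_mul_const, hcoef]
    simp_rw [h1] at hsum
    rw [bargmann, hsum.tsum_eq]
    congr 1
    ext x
    rw [← (hasSum_bargmannKernel x z).tsum_eq, ← tsum_mul_left]
    exact tsum_congr fun α => by ring
  -- With `v` the distance of `y` from the centre of the Gaussian, `|y| ≤ |v| + |w|`;
  -- quasi-subadditivity moves the growth to `W(|w|)`, and the remaining `v²/2` is absorbed by
  -- `e^{-v²}`.
  have hpt : ∀ (w : ℂ) (y : ℝ), exp (-y ^ 2 / 2 + r * C₃ * W |y|) * ‖bargmannKernel w y‖ ≤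
      exp (1 / 2 + C₃ * C₁ * r) * exp (w.im ^ 2 / 2 + C₃ * C₁ * r * W ‖w‖) *
        exp (-(y - w.re / sqrt 2) ^ 2 / 2) := by
    intro w y
    set v := y - w.re / sqrt 2 with hv
    have hy : |y| ≤ |v| + ‖w‖ := by
      have h1 : y = v + w.re / sqrt 2 := by rw [hv]; ring
      have h2 : |w.re / sqrt 2| ≤ ‖w‖ := by
        rw [abs_div, abs_of_nonneg (Real.sqrt_nonneg _)]
        refine (div_le_self (abs_nonneg _) ?_).trans (Complex.abs_re_le_norm w)
        rw [Real.one_le_sqrt]; norm_num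
      calc |y| = |v + w.re / sqrt 2| := by rw [← h1]
        _ ≤ |v| + |w.re / sqrt 2| := abs_add_le _ _
        _ ≤ _ := by gcongr
    have hWy : W |y| ≤ C₁ * (C₂ * (1 + v ^ 2) + W ‖w‖ + 1) := by
      refine (hW.mono _ _ (abs_nonneg _) hy).trans
        ((hadd _ _ (abs_nonneg _) (norm_nonneg _)).trans ?_)
      have := hquad |v| (abs_nonneg _)
      rw [sq_abs] at this
      gcongr
    have h1 : r * C₃ * W |y| ≤ 1 / 2 + v ^ 2 / 2 + C₃ * C₁ * r + C₃ * C₁ * r * W ‖w‖ := by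
      have h2 := mul_le_mul_of_nonneg_left hWy (by positivity : 0 ≤ r * C₃)
      have h3 := mul_le_mul_of_nonneg_right hr2 (by positivity : 0 ≤ 1 + v ^ 2)
      nlinarith
    calc exp (-y ^ 2 / 2 + r * C₃ * W |y|) * ‖bargmannKernel w y‖
        = exp (r * C₃ * W |y|) * (exp (-y ^ 2 / 2) * ‖bargmannKernel w y‖) := by
          rw [Real.exp_add]; ring
      _ ≤ exp (1 / 2 + v ^ 2 / 2 + C₃ * C₁ * r + C₃ * C₁ * r * W ‖w‖) *
          (exp (w.im ^ 2 / 2) * exp (-v ^ 2)) := by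
          exact mul_le_mul (Real.exp_le_exp.2 h1) (norm_bargmannKernel_mul_exp_le w y)
            (by positivity) (Real.exp_pos _).le
      _ = _ := by
          rw [← Real.exp_add, ← Real.exp_add, ← Real.exp_add, ← Real.exp_add]
          congr 1; ring
  have hgK : ∀ᵐ x : EuclideanSpace ℝ (Fin d), ‖g x * ∏ j, bargmannKernel (z j) (x j)‖ ≤
      M * exp (r * C₃) * ∏ j, (exp (1 / 2 + C₃ * C₁ * r) *
        exp ((z j).im ^ 2 / 2 + C₃ * C₁ * r * W ‖z j‖) * exp (-(x j - (z j).re / sqrt 2) ^ 2 / 2)) := by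
    filter_upwards [hg] with x hx
    rw [norm_mul, norm_prod]
    have h1 : exp (-‖x‖ ^ 2 / 2 + r * W ‖x‖) ≤
        exp (r * C₃) * ∏ j, exp (-x j ^ 2 / 2 + r * C₃ * W |x j|) := by
      rw [← Real.exp_sum, ← Real.exp_add]
      apply Real.exp_le_exp.2
      rw [Finset.sum_add_distrib, ← Finset.mul_sum, ← Finset.sum_div, Finset.sum_neg_distrib,
        ← norm_sq_eq_sum]
      nlinarith [mul_le_mul_of_nonneg_left (hnorm x) hr.le]
    calc ‖g x‖ * ∏ j, ‖bargmannKernel (z j) (x j)‖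
        ≤ M * (exp (r * C₃) * ∏ j, exp (-x j ^ 2 / 2 + r * C₃ * W |x j|)) *
          ∏ j, ‖bargmannKernel (z j) (x j)‖ := by
          apply mul_le_mul_of_nonneg_right _ (Finset.prod_nonneg fun j _ => norm_nonneg _)
          exact hx.trans (mul_le_mul_of_nonneg_left h1 hM)
      _ = M * exp (r * C₃) * ∏ j, (exp (-x j ^ 2 / 2 + r * C₃ * W |x j|) *
          ‖bargmannKernel (z j) (x j)‖) := by rw [Finset.prod_mul_distrib]; ring
      _ ≤ _ := by
          refine mul_le_mul_of_nonneg_left (Finset.prod_le_prod (fun j _ => by positivity)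
            fun j _ => hpt (z j) (x j)) (by positivity)
  have hprodint : Integrable fun x : EuclideanSpace ℝ (Fin d) =>
      M * exp (r * C₃) * ∏ j, (exp (1 / 2 + C₃ * C₁ * r) *
        exp ((z j).im ^ 2 / 2 + C₃ * C₁ * r * W ‖z j‖) * exp (-(x j - (z j).re / sqrt 2) ^ 2 / 2)) :=
    (integrable_prod_euclidean (f := fun j y => exp (1 / 2 + C₃ * C₁ * r) *
      exp ((z j).im ^ 2 / 2 + C₃ * C₁ * r * W ‖z j‖) * exp (-(y - (z j).re / sqrt 2) ^ 2 / 2))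
      fun j => (integrable_exp_neg_sub_sq _).const_mul _).const_mul _
  rw [hrep]
  refine (norm_integral_le_of_norm_le hprodint hgK).trans (le_of_eq ?_)
  rw [integral_const_mul, integral_prod_euclidean (fun j y => exp (1 / 2 + C₃ * C₁ * r) *
      exp ((z j).im ^ 2 / 2 + C₃ * C₁ * r * W ‖z j‖) * exp (-(y - (z j).re / sqrt 2) ^ 2 / 2))]
  simp_rw [integral_const_mul, integral_exp_neg_sub_sq]
  have : ∀ j, exp (1 / 2 + C₃ * C₁ * r) * exp ((z j).im ^ 2 / 2 + C₃ * C₁ * r * W ‖z j‖) *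
      sqrt (2 * pi) = (exp (1 / 2 + C₃ * C₁ * r) * sqrt (2 * pi)) *
      exp ((z j).im ^ 2 / 2 + C₃ * C₁ * r * W ‖z j‖) := fun j => by ring
  simp_rw [this]
  rw [Finset.prod_mul_distrib, Finset.prod_const, Finset.card_univ, Fintype.card_fin]
  ring

/-! ### Directions provided by the lattice -/

theorem AngleDense.mono {A : Set ℝ} {h h' : ℝ} (hA : AngleDense A h) (hh : h ≤ h') :
    AngleDense A h' := fun θ => by
  obtain ⟨a, ha, b, hb, h1, h2, h3, h4⟩ := hA θ
  exact ⟨a, ha, b, hb, h1, h2, h3, h4.trans hh⟩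

/-- The directions, modulo `π`, along which one coordinate of the lattice gives information. -/
def latticeAngles (t₀ u : ℝ) : Set ℝ :=
  {a | ∃ k n : ℤ, (0 ≤ (k : ℝ) * u ∧ (k : ℝ) * u < 2) ∧ a = -(pi / 2 * (t₀ + k * u)) + n * pi}

theorem angleDense_latticeAngles (t₀ : ℝ) {u : ℝ} (hu : 0 < u) :
    AngleDense (latticeAngles t₀ u) (pi / 2 * u) := by
  intro θ
  have hpi := Real.pi_pos
  set τ : ℝ := -(2 * θ / pi) - t₀ with hτ
  have hθ : θ = -(pi / 2 * (t₀ + τ)) := by rw [hτ]; field_simp; ring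
  set m : ℤ := ⌊τ / 2⌋ with hm
  have hm1 : (m : ℝ) ≤ τ / 2 := Int.floor_le _
  have hm2 : τ / 2 < m + 1 := Int.lt_floor_add_one _
  set k : ℤ := ⌊(τ - 2 * m) / u⌋ with hk
  have hk0 : 0 ≤ k := Int.floor_nonneg.2 (div_nonneg (by linarith) hu.le)
  have hk1 : (k : ℝ) * u ≤ τ - 2 * m := (le_div_iff₀ hu).1 (Int.floor_le _)
  have hk2 : τ - 2 * m < (k + 1) * u := (div_lt_iff₀ hu).1 (Int.lt_floor_add_one _)
  have hku : (0 : ℝ) ≤ k * u := mul_nonneg (by exact_mod_cast hk0) hu.le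
  have hb : -(pi / 2 * (t₀ + k * u)) + ((-m : ℤ) : ℝ) * pi ∈ latticeAngles t₀ u :=
    ⟨k, -m, ⟨hku, by linarith⟩, rfl⟩
  have hbeq : -(pi / 2 * (t₀ + k * u)) + ((-m : ℤ) : ℝ) * pi =
      -(pi / 2 * (t₀ + (k * u + 2 * m))) := by push_cast; ring
  -- The next point above `τ`. When `(k+1)u` leaves `[0, 2)`, the point `2`, a translate of the
  -- lattice point `0` by one period, takes its place, so the wrap-around gap is also at most `u`.
  -- Larger parameters give smaller angles, which is why `x` yields the left endpoint.
  obtain ⟨x, hx, hx1, hx2⟩ : ∃ x : ℝ, -(pi / 2 * (t₀ + x)) ∈ latticeAngles t₀ u ∧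
      τ < x ∧ x ≤ (k + 1) * u + 2 * m := by
    rcases lt_or_ge (((k : ℝ) + 1) * u) 2 with h | h
    · refine ⟨(k + 1) * u + 2 * m, ⟨k + 1, -m, ⟨?_, ?_⟩, ?_⟩, by linarith, le_rfl⟩
      · push_cast; linarith
      · push_cast; exact h
      · push_cast; ring
    · refine ⟨2 + 2 * m, ⟨0, -(m + 1), ⟨by simp, by simp⟩, ?_⟩, by linarith, by linarith⟩
      push_cast; ring
  refine ⟨_, hx, _, hb, ?_, ?_, ?_, ?_⟩
  · rw [hθ]
    have := mul_le_mul_of_nonneg_left hx1.le (by positivity : 0 ≤ pi / 2)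
    linarith
  · rw [hbeq, hθ]
    have := mul_le_mul_of_nonneg_left (by linarith : k * u + 2 * m ≤ τ) (by positivity : 0 ≤ pi / 2)
    linarith
  · rw [hbeq]
    have := mul_lt_mul_of_pos_left (by linarith : k * u + 2 * m < x) (by positivity : 0 < pi / 2)
    linarith
  · rw [hbeq]
    have := mul_le_mul_of_nonneg_left hx2 (by positivity : 0 ≤ pi / 2)
    linarith

/-- Rotation by a multiple of `π` only changes a sign, so a ray gives information on the whole line
and directions count modulo `π`. -/
theorem im_exp_mul_sq (x : ℝ) (n : ℤ) (z : ℂ) :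
    (Complex.exp (-(((-x + n * pi : ℝ) : ℂ) * Complex.I)) * z).im ^ 2 =
      (Complex.exp ((x : ℂ) * Complex.I) * z).im ^ 2 := by
  have him : ∀ y : ℝ, (Complex.exp ((y : ℂ) * Complex.I) * z).im =
      Real.cos y * z.im + Real.sin y * z.re := fun y => by
    rw [Complex.mul_im, Complex.exp_ofReal_mul_I_re, Complex.exp_ofReal_mul_I_im]
  have e : -(((-x + n * pi : ℝ) : ℂ) * Complex.I) = ((x - n * pi : ℝ) : ℂ) * Complex.I := by
    push_cast; ring
  have h1 : ((-1 : ℝ) ^ n) ^ 2 = 1 := by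
    rcases Int.even_or_odd n with h | h
    · rw [h.neg_one_zpow]; norm_num
    · rw [h.neg_one_zpow]; norm_num
  rw [e, him, him, Real.cos_sub_int_mul_pi, Real.sin_sub_int_mul_pi]
  linear_combination (Real.cos x * z.im + Real.sin x * z.re) ^ 2 * h1

/-! ### Assembling the equivalence -/

/-- The growth function attached to an index `s ≤ 1/2`. -/
theorem exists_growth {s : RFlat} (hs : s ≤ RFlat.half) (d : ℕ) :
    ∃ W : ℝ → ℝ, IsGrowth W ∧
      (∀ (r : ℝ) (x : EuclideanSpace ℝ (Fin d)), omega r s x = exp (-r * W ‖x‖)) ∧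
      HermiteBound d s W ∧ CauchyBound d s W ∧
      (∀ h : ℝ, 0 < h → h < pi / 2 → PhragmenLindelofProperty W h) ∧
      (s = RFlat.half → PhragmenLindelofProperty W (pi / 2)) := by
  cases s with
  | real s hs0 =>
    rw [RFlat.half, RFlat.real_le_real] at hs
    rcases hs.lt_or_eq with hlt | rfl
    · have hq : 1 < 1 / (1 - 2 * s) := by
        rw [lt_div_iff₀ (by linarith)]; linarith
      refine ⟨logGrowth (1 / (1 - 2 * s)), isGrowth_logGrowth hq, fun r x => ?_,
        hermiteBound_real d hs0 hlt, cauchyBound_real d hs0 hlt,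
        fun h _ hh => phragmenLindelofProperty_logGrowth hq hh, fun he => ?_⟩
      · simp only [omega, if_pos hlt, logGrowth]
      · simp only [RFlat.half, RFlat.real.injEq] at he
        linarith
    · refine ⟨fun x => x ^ (2 : ℝ), isGrowth_rpow (by norm_num) le_rfl, fun r x => ?_,
        hermiteBound_half d, cauchyBound_half d,
        fun h hh0 hh => phragmenLindelofProperty_rpow (by norm_num) le_rfl hh0 hh,
        fun _ => phragmenLindelofProperty_sq⟩
      simp [omega]
  | flat σ hσ =>
    have h2 : 2 * σ / (σ + 1) ≤ 2 := by rw [div_le_iff₀ (by positivity)]; linarith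
    refine ⟨fun x => x ^ (2 * σ / (σ + 1)), isGrowth_rpow (by positivity) h2, fun r x => rfl,
      hermiteBound_flat d hσ, cauchyBound_flat d hσ,
      fun h hh0 hh => phragmenLindelofProperty_rpow (by positivity) h2 hh0 hh, fun he => ?_⟩
    simp [RFlat.half] at he

theorem exists_isFunction_of_weightedSupNorm_lt {d : ℕ} {c : HermiteSeries d} {W : ℝ → ℝ} {r : ℝ}
    {S : ℝ≥0∞} (hS : S ≠ ∞)
    (h : weightedSupNorm c (fun x => exp (‖x‖ ^ 2 / 2) * exp (-r * W ‖x‖)) < S) :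
    ∃ g, IsFunction c g ∧ ∀ᵐ x, ‖g x‖ ≤ S.toReal * exp (-‖x‖ ^ 2 / 2 + r * W ‖x‖) := by
  unfold weightedSupNorm at h
  simp only [iInf_lt_iff] at h
  obtain ⟨g, hg, hlt⟩ := h
  refine ⟨g, hg, ?_⟩
  rw [eLpNorm_exponent_top] at hlt
  filter_upwards [enorm_ae_le_eLpNormEssSup (μ := volume)
    (fun x => g x * ((exp (‖x‖ ^ 2 / 2) * exp (-r * W ‖x‖) : ℝ) : ℂ))] with x hx
  have h1 := ENNReal.toReal_mono hS (hx.trans hlt.le)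
  rw [toReal_enorm, norm_mul, Complex.norm_real, Real.norm_eq_abs,
    abs_of_pos (by positivity), ← Real.exp_add] at h1
  calc ‖g x‖ = ‖g x‖ * exp (‖x‖ ^ 2 / 2 + -r * W ‖x‖) * exp (-‖x‖ ^ 2 / 2 + r * W ‖x‖) := by
        rw [mul_assoc, ← Real.exp_add]; ring_nf; simp
    _ ≤ _ := by gcongr

/-- Bounds of finitely many fractional Fourier transforms give decay of the Hermite coefficients. -/
theorem bounded_seqWeight_of_lattice {d : ℕ} {s : RFlat} {W : ℝ → ℝ} (hW : IsGrowth W)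
    (hom : ∀ (r : ℝ) (x : EuclideanSpace ℝ (Fin d)), omega r s x = exp (-r * W ‖x‖))
    (hC : CauchyBound d s W) {h : ℝ} (hPL : PhragmenLindelofProperty W h) {t₀ u : Fin d → ℝ}
    (hu : ∀ j, 0 < u j) (huh : ∀ j, pi / 2 * u j ≤ h) {f : HermiteSeries d}
    (hf : ∀ r : ℝ, 0 < r → (⨆ t ∈ lattice t₀ u, fracFourierNorm r s f t) < ⊤) {R : ℝ} (hR : 0 < R) :
    ∃ C : ℝ, ∀ α, ‖f α‖ * seqWeight R s α ≤ C := by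
  -- The parameters are chosen backwards: `R` fixes `r'` through Cauchy's estimates, `r'` fixes `r₁`
  -- through Phragmén–Lindelöf, and `r` is then taken with `C r ≤ r₁` and below the threshold of the
  -- Bargmann estimate.
  obtain ⟨r', hr', M₁, hM₁⟩ := hC R hR
  obtain ⟨r₁, hr₁, M₂, hM₂, hsep⟩ := norm_le_of_separate (d := d) hW hPL hr'
  obtain ⟨r₀, hr₀, C, hC0, hbarg⟩ := exists_norm_bargmann_le hW d
  set r := min r₀ (r₁ / (C + 1)) with hr
  have hrpos : 0 < r := by positivity
  have hCr : C * r ≤ r₁ := by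
    have : r ≤ r₁ / (C + 1) := min_le_right _ _
    rw [le_div_iff₀ (by positivity)] at this
    nlinarith
  obtain ⟨N, hN, hbarg⟩ := hbarg r hrpos (min_le_left _ _)
  set S := ⨆ t ∈ lattice t₀ u, fracFourierNorm r s f t with hS
  have hStop : S < ⊤ := hf r hrpos
  -- `S + 1` lies strictly above all the norms, so an actual function can be extracted from the
  -- infimum in `weightedSupNorm`.
  have hS1 : S + 1 ≠ ∞ := ENNReal.add_ne_top.2 ⟨hStop.ne, ENNReal.one_ne_top⟩
  set M := (S + 1).toReal with hM
  have hM0 : 0 ≤ M := ENNReal.toReal_nonneg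
  have hlat : ∀ t ∈ lattice t₀ u, ExpGrowth (fracFourier t f) ∧ ∀ z,
      ‖bargmann (fracFourier t f) z‖ ≤ M * N * ∏ j, exp ((z j).im ^ 2 / 2 + C * r * W ‖z j‖) := by
    intro t ht
    have h1 : fracFourierNorm r s f t < S + 1 :=
      lt_of_le_of_lt (le_iSup₂ (f := fun t _ => fracFourierNorm r s f t) t ht)
        (ENNReal.lt_add_right hStop.ne one_ne_zero)
    unfold fracFourierNorm at h1
    simp only [hom] at h1
    obtain ⟨g, hg, hgb⟩ := exists_isFunction_of_weightedSupNorm_lt hS1 h1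
    exact hbarg _ g M hM0 hg hgb
  have hexp : ExpGrowth f := by
    obtain ⟨M', A, hM', hA, hb⟩ := (hlat t₀ ⟨fun _ => 0, by simp, by simp⟩).1
    exact ⟨M', A, hM', hA, fun α => by rw [← norm_fracFourier t₀]; exact hb α⟩
  have hF : ∀ z, ‖bargmann f z‖ ≤ M * N * M₂ * ∏ j, exp (r' * W ‖z j‖) := by
    refine hsep (fun j => latticeAngles (t₀ j) (u j))
      (fun j => (angleDense_latticeAngles (t₀ j) (hu j)).mono (huh j)) (bargmann f)
      (fun z j => differentiable_bargmann_update hexp z j) (M * N) (by positivity) fun a ha z => ?_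
    choose k n hk hkn using ha
    have ht : (fun j => t₀ j + k j * u j) ∈ lattice t₀ u := ⟨k, hk, fun j => rfl⟩
    -- The transform of `𝓕_t f` is evaluated at the point whose rotation is `z`.
    have hb := (hlat _ ht).2 fun j =>
      Complex.exp (((pi / 2 * (t₀ j + k j * u j) : ℝ) : ℂ) * Complex.I) * z j
    rw [bargmann_fracFourier] at hb
    have hz : (fun j => Complex.exp (-((pi / 2 * (t₀ j + k j * u j) : ℝ) * Complex.I)) *
        (Complex.exp (((pi / 2 * (t₀ j + k j * u j) : ℝ) : ℂ) * Complex.I) * z j)) = z := by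
      funext j
      rw [← mul_assoc, ← Complex.exp_add]; simp
    rw [hz] at hb
    refine hb.trans ?_
    refine mul_le_mul_of_nonneg_left (Finset.prod_le_prod (fun j _ => by positivity)
      fun j _ => Real.exp_le_exp.2 ?_) (by positivity)
    rw [hkn j, im_exp_mul_sq, norm_mul, Complex.norm_exp_ofReal_mul_I, one_mul]
    have := mul_le_mul_of_nonneg_right hCr (hW.nonneg _ (norm_nonneg (z j)))
    linarith
  refine ⟨M * N * M₂ * M₁, fun α => ?_⟩
  obtain ⟨ρ, hρ, hρb⟩ := hM₁ α
  have hcoef := norm_coeff_mul_le_of_torus hexp hρ (K := M * N * M₂ * ∏ j, exp (r' * W (ρ j)))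
    (fun z hz => (hF z).trans (le_of_eq (by simp only [hz]))) α
  have hw := seqWeight_pos hR s α
  have hprod : (∏ j, (ρ j ^ α j / sqrt ((α j)! : ℝ))) *
      ∏ j, (sqrt ((α j)! : ℝ) / ρ j ^ α j) = 1 := by
    rw [← Finset.prod_mul_distrib]
    refine Finset.prod_eq_one fun j _ => ?_
    have h1 : sqrt ((α j)! : ℝ) ≠ 0 := by positivity
    have h2 : ρ j ^ α j ≠ 0 := pow_ne_zero _ (hρ j).ne'
    field_simp
  have hq : 0 ≤ ∏ j, (sqrt ((α j)! : ℝ) / ρ j ^ α j) :=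
    Finset.prod_nonneg fun j _ => by have := hρ j; positivity
  calc ‖f α‖ * seqWeight R s α = ‖f α‖ * (∏ j, (ρ j ^ α j / sqrt ((α j)! : ℝ))) *
        (∏ j, (sqrt ((α j)! : ℝ) / ρ j ^ α j)) * seqWeight R s α := by
        rw [mul_assoc ‖f α‖, hprod, mul_one]
    _ ≤ (M * N * M₂ * ∏ j, exp (r' * W (ρ j))) * (∏ j, (sqrt ((α j)! : ℝ) / ρ j ^ α j)) *
        seqWeight R s α := by gcongr
    _ = M * N * M₂ * ((∏ j, (sqrt ((α j)! : ℝ) * exp (r' * W (ρ j)) / ρ j ^ α j)) *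
        seqWeight R s α) := by
        have : ∀ j, sqrt ((α j)! : ℝ) * exp (r' * W (ρ j)) / ρ j ^ α j =
          exp (r' * W (ρ j)) * (sqrt ((α j)! : ℝ) / ρ j ^ α j) := fun j => by ring
        simp_rw [this]
        rw [Finset.prod_mul_distrib]; ring
    _ ≤ _ := by gcongr

theorem exists_lt_pi_div_two {d : ℕ} {u : Fin d → ℝ} (hu : ∀ j, u j < 1) :
    ∃ h : ℝ, 0 < h ∧ h < pi / 2 ∧ ∀ j, pi / 2 * u j ≤ h := by
  have hpi := Real.pi_pos
  -- The extra element makes the maximum exist also for `d = 0`.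
  set S : Finset ℝ := insert (1 / 2) (Finset.univ.image u) with hS
  have hne : S.Nonempty := Finset.insert_nonempty _ _
  have h1 : S.max' hne < 1 := by
    rw [Finset.max'_lt_iff]
    intro y hy
    rw [hS, Finset.mem_insert, Finset.mem_image] at hy
    rcases hy with rfl | ⟨j, -, rfl⟩
    · norm_num
    · exact hu j
  have h2 : 1 / 2 ≤ S.max' hne := Finset.le_max' _ _ (Finset.mem_insert_self _ _)
  refine ⟨pi / 2 * S.max' hne, by positivity, by nlinarith, fun j => ?_⟩
  gcongr
  exact Finset.le_max' _ _ (Finset.mem_insert_of_mem (Finset.mem_image_of_mem _ (Finset.mem_univ j)))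

end Pilipovic

end

theorem theorem2p4 (d : ℕ) (p : ENNReal) (hp : 1 ≤ p)
    (s : Pilipovic.RFlat) (hs : s ≤ Pilipovic.RFlat.half)
    (t₀ u : Fin d → ℝ) (hu : ∀ j, 0 < u j ∧ u j ≤ 1)
    (hu' : s < Pilipovic.RFlat.half → ∀ j, u j < 1)
    (f : Pilipovic.HermiteSeries d) :
    List.TFAE [
      f ∈ Pilipovic.beurlingSpace d p s,
      ∀ r : ℝ, 0 < r →
        (⨆ t ∈ Pilipovic.lattice t₀ u, Pilipovic.fracFourierNorm r s f t) < ⊤,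
      ∀ r : ℝ, 0 < r →
        (⨆ t : Fin d → ℝ, Pilipovic.fracFourierNorm r s f t) < ⊤] := by
  obtain ⟨W, hW, hom, hH, hC, hPL, hPL'⟩ := Pilipovic.exists_growth hs d
  have hh : ∃ h : ℝ, Pilipovic.PhragmenLindelofProperty W h ∧ ∀ j, Real.pi / 2 * u j ≤ h := by
    -- Below `1/2` all sectors have opening less than `π/2`; at `1/2`, `u_j = 1` is allowed and the
    -- critical principle is used.
    rcases hs.lt_or_eq with hlt | heq
    · obtain ⟨h, h0, h1, h2⟩ := Pilipovic.exists_lt_pi_div_two (hu' hlt)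
      exact ⟨h, hPL h h0 h1, h2⟩
    · exact ⟨_, hPL' heq, fun j => mul_le_of_le_one_right (by positivity) (hu j).2⟩
  obtain ⟨h, hPLh, huh⟩ := hh
  tfae_have 1 → 3 := by
    intro hf r hr
    obtain ⟨C, hC⟩ := Pilipovic.exists_fracFourierNorm_le hs hom hH
      ((Pilipovic.mem_beurlingSpace_iff hp hs f).1 hf) hr
    exact (iSup_le hC).trans_lt ENNReal.ofReal_lt_top
  tfae_have 3 → 2 := fun hf r hr =>
    (iSup₂_le_iSup _ _).trans_lt (hf r hr)
  tfae_have 2 → 1 := fun hf => (Pilipovic.mem_beurlingSpace_iff hp hs f).2 fun R hR =>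
    Pilipovic.bounded_seqWeight_of_lattice hW hom hC hPLh (fun j => (hu j).1) huh hf hR
  tfae_finish
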